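/- Let $\mathsf{fab}$ be the category of finitely generated free abelian groups and $\mathsf{Ab}$ the category of abelian groups. For a functor $F:\mathsf{fab}\to\mathsf{Ab}$ with $F(0)=0$ on zero morphisms and $A=A_1\oplus\dots\oplus A_m$, let $e_k$ be the idempotent endomorphism of $A$ given by the $k$-th summand; the $m$-th cross-effect $F_m(A_1|\dots|A_m)$ is the image of the idempotent $\sum_{S\subseteq\{1,\dots,m\}}(-1)^{m-|S|}F\big(\sum_{k\in S}e_k\big)$ of $F(A)$. Call $F$ a *weakly alternative cubic functor* if $F_m=0$ for all $m>3$ and $F(\mathbb Z)=0$. Put $F_m=F_m(\mathbb Z|\dots|\mathbb Z)$. For $1\le k\le m$ let $h^m_k:F_m\to F_{m+1}$ be the composite $F_m\hookrightarrow F(\mathbb Z^m)\to F(\mathbb Z^{m+1})\twoheadrightarrow F_{m+1}$ induced by the diagonal of the $k$-th summand (and the identity on the others), and $p^m_k:F_{m+1}\to F_m$ the composite $F_{m+1}\hookrightarrow F(\mathbb Z^{m+1})\to F(\mathbb Z^m)\twoheadrightarrow F_m$ induced by the summation on the $k$-th and $(k+1)$-st summands (and the identity on the others); write $h=h^1_1$,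 $p=p^1_1$, $h_i=h^2_i$, $p_i=p^2_i$. Let $\mathbf A$ be the preadditive category with objects $1,2,3$, generated by morphisms $h:1\to2$, $p:2\to1$, $h_1,h_2:2\to3$, $p_1,p_2:3\to2$ subject to the relations $$h_1p_2=h_2p_1=0,\quad h_1h=h_2h,\quad pp_1=pp_2,\quad h_ip_ih_i=2h_i,\quad p_ih_ip_i=2p_i\quad(i=1,2),$$ $$hph=2\big(h+(p_1+p_2)\bar h\big),\qquad php=2\big(p+\bar p(h_1+h_2)\big),$$ $$\bar hp+h_1+h_2=h_1p_1h_2p_2h_1+h_2p_2h_1p_1h_2,\qquad h\bar p+p_1+p_2=p_1h_2p_2h_1p_1+p_2h_1p_1h_2p_2,$$ where $\bar h=h_1h$ and $\bar p=pp_1$. Let $\mathbf A^a=\mathbf A/(\mathrm{id}_1)$ be its quotient by the ideal generated by the identity of the object $1$. An $\mathbf A^a$-module is an additive functor $\mathbf A^a\to\mathsf{Ab}$. Let $\mathbf C_0\subset\mathbb Z\times\mathrm{Mat}(2,\mathbb Z)$ be the subring of all pairs $(a,B)$ with $b_{12}\equiv0$ and $a\equiv b_{11}\pmod 3$. Let $\mathbf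 C=(\mathbb Z\times\mathbf C_0)\ltimes T$ be the ring whose additive group is $(\mathbb Z\times\mathbf C_0)\oplus T$, where $\mathbb Z\times\mathbf C_0$ is a subring and $T$ is a two-sided ideal which is an elementary abelian $2$-group with basis $\xi,\eta,\theta$, with multiplication determined by $$\xi\eta=\theta,\quad\eta\xi=0,\quad e\xi=\xi,\quad\eta e=\eta,\quad \xi\,(0,a,B)=a\,\xi,\quad (0,a,B)\,\eta=a\,\eta,$$ where $e=(1,0,0)$ and $(a,B)\in\mathbf C_0$. **Proposition.** (1) Weakly alternative cubic functors are modules over $\mathbf A^a$: there is an additive equivalence between the category of weakly alternative cubic functors (with natural transformations) and the category of $\mathbf A^a$-modules, under which $F$ corresponds, naturally in $F$, to the module taking the values $F_1=0,F_2,F_3$ at the objects $1,2,3$ and sending the generators $h,p,h_i,p_i$ to the maps $h,p,h_i,p_i$ of the cross-effects of $F$. (2) $\mathbf A^a$ is Morita equivalent to $\mathbf C$: there is an additive equivalence between the category of $\mathbf A^a$-modules and the category of left $\mathbf C$-modules. -/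

import Mathlib

open CategoryTheory

universe u

/-! ## Ideals in preadditive categories and the corresponding quotients -/

section Ideal

variable {C : Type*} [Category C] [Preadditive C]

/-- The value at `(X, Y)` of the two-sided ideal of a preadditive category generated by a class
`S` of morphisms: all sums of morphisms `± f ≫ s ≫ g` with `s` in `S`. -/
def idealSpan (S : MorphismProperty C) (X Y : C) : AddSubgroup (X ⟶ Y) :=
  AddSubgroup.closure
    {φ | ∃ (A B : C) (f : X ⟶ A) (s : A ⟶ B) (g : B ⟶ Y), S s ∧ φ = f ≫ s ≫ g}

lemma idealSpan_comp_left (S : MorphismProperty C) {X Y Z : C} (f : X ⟶ Y) {φ : Y ⟶ Z}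
    (h : φ ∈ idealSpan S Y Z) : f ≫ φ ∈ idealSpan S X Z := by
  have key : idealSpan S Y Z ≤ (idealSpan S X Z).comap (Preadditive.leftComp Z f) := by
    refine (AddSubgroup.closure_le _).2 ?_
    rintro _ ⟨A, B, a, s, b, hs, rfl⟩
    exact AddSubgroup.subset_closure ⟨A, B, f ≫ a, s, b, hs, by simp [Preadditive.leftComp]⟩
  exact key h

lemma idealSpan_comp_right (S : MorphismProperty C) {X Y Z : C} {φ : X ⟶ Y} (f : Y ⟶ Z)
    (h : φ ∈ idealSpan S X Y) : φ ≫ f ∈ idealSpan S X Z := by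
  have key : idealSpan S X Y ≤ (idealSpan S X Z).comap (Preadditive.rightComp X f) := by
    refine (AddSubgroup.closure_le _).2 ?_
    rintro _ ⟨A, B, a, s, b, hs, rfl⟩
    exact AddSubgroup.subset_closure ⟨A, B, a, s, b ≫ f, hs, by simp [Preadditive.rightComp]⟩
  exact key h

/-- Two morphisms are related if their difference lies in the ideal generated by `S`. -/
def idealRel (S : MorphismProperty C) : HomRel C :=
  fun X Y f g => f - g ∈ idealSpan S X Y

instance idealRel_congruence (S : MorphismProperty C) : Congruence (idealRel S) where
  equivalence :=
    { refl := fun f => by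
        change f - f ∈ _
        rw [sub_self]
        exact zero_mem _
      symm := fun {f g} h => by
        have := neg_mem h
        rwa [neg_sub] at this
      trans := fun {f g k} h h' => by
        have := add_mem h h'
        rwa [sub_add_sub_cancel] at this }
  comp_left := by
    intro _ _ _ f g g' h
    have := idealSpan_comp_left S f h
    change _ - _ ∈ _
    rwa [← Preadditive.comp_sub]
  comp_right := by
    intro _ _ _ f f' g h
    have := idealSpan_comp_right S g h
    change _ - _ ∈ _
    rwa [← Preadditive.sub_comp]

/-- The quotient of a preadditive category by the ideal generated by `S`. -/
abbrev IdealQuotient (S : MorphismProperty C) := Quotient (idealRel S)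

instance idealQuotientPreadditive (S : MorphismProperty C) : Preadditive (IdealQuotient S) :=
  Quotient.preadditive (idealRel S) (fun _ _ f₁ f₂ g₁ g₂ h h' => by
    have := add_mem h h'
    rwa [sub_add_sub_comm] at this)

end Ideal

/-! ## The category `𝐀` and its quotient `𝐀ᵃ` -/

/-- The three objects `1, 2, 3` of the category `𝐀`. -/
inductive CubicObj : Type
  | one | two | three

/-- The natural number `m` that an object of `𝐀` is called after. -/
def CubicObj.deg : CubicObj → ℕ
  | one => 1
  | two => 2
  | three => 3

/-- The generating morphisms of `𝐀`. -/
inductive CubicGen : CubicObj → CubicObj → Type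
  | h : CubicGen .one .two
  | p : CubicGen .two .one
  | h₁ : CubicGen .two .three
  | h₂ : CubicGen .two .three
  | p₁ : CubicGen .three .two
  | p₂ : CubicGen .three .two

instance : Quiver CubicObj := ⟨CubicGen⟩

/-- The free preadditive category on the generating morphisms. -/
abbrev FreeCubic := Free ℤ (Paths CubicObj)

namespace FreeCubic

/-- An object of the free preadditive category. -/
def ob (X : CubicObj) : FreeCubic := X

/-- A generator as a morphism of the free preadditive category. -/
noncomputable def gen {X Y : CubicObj} (g : X ⟶ Y) : ob X ⟶ ob Y :=
  (Free.embedding ℤ (Paths CubicObj)).map g.toPath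

noncomputable def h : ob .one ⟶ ob .two := gen CubicGen.h
noncomputable def p : ob .two ⟶ ob .one := gen CubicGen.p
noncomputable def h₁ : ob .two ⟶ ob .three := gen CubicGen.h₁
noncomputable def h₂ : ob .two ⟶ ob .three := gen CubicGen.h₂
noncomputable def p₁ : ob .three ⟶ ob .two := gen CubicGen.p₁
noncomputable def p₂ : ob .three ⟶ ob .two := gen CubicGen.p₂

/-- `h̄ = h₁h`, written in diagrammatic order. -/
noncomputable def hbar : ob .one ⟶ ob .three := h ≫ h₁

/-- `p̄ = pp₁`, written in diagrammatic order. -/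
noncomputable def pbar : ob .three ⟶ ob .one := p₁ ≫ p

/-- The defining relations of `𝐀`, each stated as a morphism that has to become zero. In the usual
right-to-left notation for composition they read: `h₁p₂ = h₂p₁ = 0`, `h₁h = h₂h`, `pp₁ = pp₂`,
`hᵢpᵢhᵢ = 2hᵢ`, `pᵢhᵢpᵢ = 2pᵢ`, `hph = 2(h + (p₁ + p₂)h̄)`, `php = 2(p + p̄(h₁ + h₂))`,
`h̄p + h₁ + h₂ = h₁p₁h₂p₂h₁ + h₂p₂h₁p₁h₂`, `hp̄ + p₁ + p₂ = p₁h₂p₂h₁p₁ + p₂h₁p₁h₂p₂`.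
Below, `≫` composes from left to right, so every word is reversed. -/
inductive rel : MorphismProperty FreeCubic
  | h₁p₂ : rel (p₂ ≫ h₁)
  | h₂p₁ : rel (p₁ ≫ h₂)
  | h₁h : rel (h ≫ h₁ - h ≫ h₂)
  | pp₁ : rel (p₁ ≫ p - p₂ ≫ p)
  | h₁p₁h₁ : rel (h₁ ≫ p₁ ≫ h₁ - (2 : ℤ) • h₁)
  | h₂p₂h₂ : rel (h₂ ≫ p₂ ≫ h₂ - (2 : ℤ) • h₂)
  | p₁h₁p₁ : rel (p₁ ≫ h₁ ≫ p₁ - (2 : ℤ) • p₁)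
  | p₂h₂p₂ : rel (p₂ ≫ h₂ ≫ p₂ - (2 : ℤ) • p₂)
  | hph : rel (h ≫ p ≫ h - (2 : ℤ) • (h + hbar ≫ (p₁ + p₂)))
  | php : rel (p ≫ h ≫ p - (2 : ℤ) • (p + (h₁ + h₂) ≫ pbar))
  | hbarp : rel (p ≫ hbar + h₁ + h₂
      - (h₁ ≫ p₂ ≫ h₂ ≫ p₁ ≫ h₁ + h₂ ≫ p₁ ≫ h₁ ≫ p₂ ≫ h₂))
  | hpbar : rel (pbar ≫ h + p₁ + p₂
      - (p₁ ≫ h₁ ≫ p₂ ≫ h₂ ≫ p₁ + p₂ ≫ h₂ ≫ p₁ ≫ h₁ ≫ p₂))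

end FreeCubic

/-- The preadditive category `𝐀`, presented by generators and relations. -/
abbrev CubicCat := IdealQuotient FreeCubic.rel

/-- An object of `𝐀`. -/
noncomputable def CubicCat.ob (X : CubicObj) : CubicCat := (Quotient.functor _).obj (FreeCubic.ob X)

/-- A generating morphism of `𝐀`. -/
noncomputable def CubicCat.gen {X Y : CubicObj} (g : X ⟶ Y) : CubicCat.ob X ⟶ CubicCat.ob Y :=
  (Quotient.functor _).map (FreeCubic.gen g)

/-- The identity morphism of the object `1` of `𝐀`, as a class of morphisms. -/
inductive CubicCat.idOne : MorphismProperty CubicCat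
  | mk : CubicCat.idOne (𝟙 (CubicCat.ob .one))

/-- The category `𝐀ᵃ = 𝐀/(id₁)`, the quotient of `𝐀` by the ideal generated by `id₁`. -/
abbrev AltCat := IdealQuotient CubicCat.idOne

/-- An object of `𝐀ᵃ`. -/
noncomputable def AltCat.ob (X : CubicObj) : AltCat := (Quotient.functor _).obj (CubicCat.ob X)

/-- The image in `𝐀ᵃ` of a generating morphism of `𝐀`. -/
noncomputable def AltCat.gen {X Y : CubicObj} (g : X ⟶ Y) : AltCat.ob X ⟶ AltCat.ob Y :=
  (Quotient.functor _).map (CubicCat.gen g)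

/-! ## Polynomial functors, cross-effects, weakly alternative cubic functors -/

/-- The category of finitely generated free abelian groups. -/
abbrev Fab :=
  ObjectProperty.FullSubcategory
    (fun M : AddCommGrpCat.{0} => Module.Finite ℤ M ∧ Module.Free ℤ M)

namespace Fab

/-- The direct sum of a finite family of finitely generated free abelian groups. -/
def sum {m : ℕ} (A : Fin m → Fab) : Fab :=
  ⟨AddCommGrpCat.of (∀ k, (A k).obj), by
    have h₁ := fun k => (A k).property.1
    have h₂ := fun k => (A k).property.2
    let e := (AddEquiv.refl (∀ k, (A k).obj)).toIntLinearEquiv (modM := Pi.module _ _ _)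
      (modM₂ := AddCommGroup.toIntModule _)
    exact ⟨Module.Finite.equiv e, Module.Free.of_equiv e⟩⟩

/-- The idempotent `∑_{k ∈ S} e_k` of the direct sum, where `e_k` is the projection onto the
`k`-th summand followed by its embedding. -/
def proj {m : ℕ} (A : Fin m → Fab) (S : Finset (Fin m)) : sum A ⟶ sum A :=
  ObjectProperty.homMk (AddCommGrpCat.ofHom
    (AddMonoidHom.mk' (fun x k => if k ∈ S then x k else 0) (fun x y => by
      funext k; by_cases hk : k ∈ S <;> simp [hk]) :
      (∀ k, (A k).obj) →+ (∀ k, (A k).obj)))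

/-- The group `ℤ`. -/
def Z : Fab := ⟨AddCommGrpCat.of ℤ, inferInstanceAs (Module.Finite ℤ ℤ),
  inferInstanceAs (Module.Free ℤ ℤ)⟩

/-- The direct sum `ℤ ⊕ ⋯ ⊕ ℤ` of `m` copies of `ℤ`. -/
abbrev pow (m : ℕ) : Fab := sum (fun _ : Fin m => Z)

/-- `ℤᵐ → ℤᵐ⁺¹`: the diagonal on the `k`-th summand, the identity on the other ones. Here
`Fin.predAbove k` is the surjection that takes the value `k` at the positions `k` and `k + 1`. -/
def diag {m : ℕ} (k : Fin m) : pow m ⟶ pow (m + 1) :=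
  ObjectProperty.homMk (AddCommGrpCat.ofHom
    (AddMonoidHom.mk' (fun x j => x (k.predAbove j)) (fun _ _ => rfl) :
      (Fin m → ℤ) →+ (Fin (m + 1) → ℤ)))

/-- `ℤᵐ⁺¹ → ℤᵐ`: the summation on the `k`-th and `(k + 1)`-st summands, the identity on the other
ones. -/
def codiag {m : ℕ} (k : Fin m) : pow (m + 1) ⟶ pow m :=
  ObjectProperty.homMk (AddCommGrpCat.ofHom
    (AddMonoidHom.mk' (fun y i => ∑ j, if k.predAbove j = i then y j else 0) (fun x y => by
      funext i
      simp only [Pi.add_apply, ← Finset.sum_add_distrib]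
      exact Finset.sum_congr rfl fun j _ => by by_cases hj : k.predAbove j = i <;> simp [hj]) :
      (Fin (m + 1) → ℤ) →+ (Fin m → ℤ)))

end Fab

section CrossEffect

variable (F : Fab ⥤ AddCommGrpCat.{u})

/-- The idempotent `f(1 2 … m)` of `F(A₁ ⊕ ⋯ ⊕ A_m)`, in closed form: the alternating sum of the
`F(∑_{k ∈ S} e_k)` over all sets `S` of indices. -/
def crossIdem {m : ℕ} (A : Fin m → Fab) : F.obj (Fab.sum A) ⟶ F.obj (Fab.sum A) :=
  ∑ S : Finset (Fin m), (-1 : ℤ) ^ (m - S.card) • F.map (Fab.proj A S)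

/-- The cross-effect `F_m(A₁|…|A_m)`, the image of the idempotent `f(1 2 … m)`. -/
def crossEffect {m : ℕ} (A : Fin m → Fab) : AddCommGrpCat.{u} :=
  AddCommGrpCat.of (AddMonoidHom.range (crossIdem F A).hom)

/-- The embedding of the direct summand `F_m(A₁|…|A_m)` in `F(A₁ ⊕ ⋯ ⊕ A_m)`. -/
def crossIncl {m : ℕ} (A : Fin m → Fab) : crossEffect F A ⟶ F.obj (Fab.sum A) :=
  AddCommGrpCat.ofHom (AddMonoidHom.range (crossIdem F A).hom).subtype

/-- The projection of `F(A₁ ⊕ ⋯ ⊕ A_m)` onto the direct summand `F_m(A₁|…|A_m)`. -/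
def crossProj {m : ℕ} (A : Fin m → Fab) : F.obj (Fab.sum A) ⟶ crossEffect F A :=
  AddCommGrpCat.ofHom (crossIdem F A).hom.rangeRestrict

/-- The morphism `hᵐ_k : F_m(ℤ|…|ℤ) → F_{m+1}(ℤ|…|ℤ)`. -/
def crossH {m : ℕ} (k : Fin m) :
    crossEffect F (fun _ : Fin m => Fab.Z) ⟶ crossEffect F (fun _ : Fin (m + 1) => Fab.Z) :=
  crossIncl F _ ≫ F.map (Fab.diag k) ≫ crossProj F _

/-- The morphism `pᵐ_k : F_{m+1}(ℤ|…|ℤ) → F_m(ℤ|…|ℤ)`. -/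
def crossP {m : ℕ} (k : Fin m) :
    crossEffect F (fun _ : Fin (m + 1) => Fab.Z) ⟶ crossEffect F (fun _ : Fin m => Fab.Z) :=
  crossIncl F _ ≫ F.map (Fab.codiag k) ≫ crossProj F _

/-- The morphism of the diagram `F₁ ⇄ F₂ ⇄ F₃` of `F` that is named by a generator of `𝐀`. -/
def crossGen : ∀ {X Y : CubicObj}, (X ⟶ Y) →
    (crossEffect F (fun _ : Fin X.deg => Fab.Z) ⟶ crossEffect F (fun _ : Fin Y.deg => Fab.Z))
  | _, _, CubicGen.h => crossH F (m := 1) 0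
  | _, _, CubicGen.p => crossP F (m := 1) 0
  | _, _, CubicGen.h₁ => crossH F (m := 2) 0
  | _, _, CubicGen.h₂ => crossH F (m := 2) 1
  | _, _, CubicGen.p₁ => crossP F (m := 2) 0
  | _, _, CubicGen.p₂ => crossP F (m := 2) 1

end CrossEffect

lemma crossIdem_naturality {F G : Fab ⥤ AddCommGrpCat.{u}} (η : F ⟶ G) {m : ℕ}
    (A : Fin m → Fab) :
    crossIdem F A ≫ η.app (Fab.sum A) = η.app (Fab.sum A) ≫ crossIdem G A := by
  simp [crossIdem, Preadditive.sum_comp, Preadditive.comp_sum]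

/-- The cross-effect `F_m(A₁|…|A_m)` as a functor in `F`: a natural transformation is restricted to
the direct summands. -/
def crossEffectFunctor {m : ℕ} (A : Fin m → Fab) :
    (Fab ⥤ AddCommGrpCat.{u}) ⥤ AddCommGrpCat.{u} where
  obj F := crossEffect F A
  map {F G} η := AddCommGrpCat.ofHom
    (((η.app (Fab.sum A)).hom.comp (AddMonoidHom.range (crossIdem F A).hom).subtype).codRestrict
      (AddMonoidHom.range (crossIdem G A).hom) (by
        rintro ⟨_, x, rfl⟩
        exact ⟨(η.app (Fab.sum A)).hom x,
          (congrArg (fun f => f.hom x) (crossIdem_naturality η A)).symm⟩))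
  map_id F := rfl
  map_comp η θ := rfl

/-- A functor `F` from finitely generated free abelian groups to abelian groups is a weakly
alternative cubic functor if it sends zero morphisms to zero, is polynomial of degree at most `3`
(all its cross-effects `F_m` with `m > 3` vanish), and `F(ℤ) = 0`. -/
structure IsWeaklyAlternativeCubic (F : Fab ⥤ AddCommGrpCat.{u}) : Prop where
  map_zero : ∀ X Y : Fab, F.map (0 : X ⟶ Y) = 0
  degree_le : ∀ m : ℕ, 3 < m → ∀ A : Fin m → Fab, Subsingleton (crossEffect F A)
  zero_at_Z : Subsingleton (F.obj Fab.Z)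

/-- The category of weakly alternative cubic functors and natural transformations. -/
abbrev WeaklyAlternativeCubic :=
  ObjectProperty.FullSubcategory
    (fun F : Fab ⥤ AddCommGrpCat.{u} => IsWeaklyAlternativeCubic F)

/-! ## The ring `𝐂 = (ℤ × 𝐂₀) ⋉ T` -/

/-- The subring `𝐂₀` of `ℤ × Mat(2, ℤ)` of all pairs `(a, B)` with `b₁₂ ≡ 0` and
`a ≡ b₁₁` modulo `3`. -/
def C₀ : Subring (ℤ × Matrix (Fin 2) (Fin 2) ℤ) where
  carrier := {x | x.2 0 1 ≡ 0 [ZMOD 3] ∧ x.1 ≡ x.2 0 0 [ZMOD 3]}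
  mul_mem' := by
    rintro ⟨a, B⟩ ⟨a', B'⟩ ⟨h₁, h₂⟩ ⟨h₁', h₂'⟩
    simp only [Set.mem_ofPred_eq, Prod.mk_mul_mk, Matrix.mul_apply, Fin.sum_univ_two] at *
    constructor
    · simpa using (h₁'.mul_left (B 0 0)).add (h₁.mul_right (B' 1 1))
    · simpa using (h₂.mul h₂').add (h₁.mul_right (B' 1 0)).symm
  one_mem' := by simp
  add_mem' := by
    rintro ⟨a, B⟩ ⟨a', B'⟩ ⟨h₁, h₂⟩ ⟨h₁', h₂'⟩
    exact ⟨by simpa using h₁.add h₁', by simpa using h₂.add h₂'⟩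
  zero_mem' := by simp
  neg_mem' := by
    rintro ⟨a, B⟩ ⟨h₁, h₂⟩
    exact ⟨by simpa using h₁.neg, by simpa using h₂.neg⟩

/-- The underlying set of `𝐂 = (ℤ × 𝐂₀) ⋉ T`: the element with components `n`, `c`, `x`, `y`, `t`
is `(n, c) + xξ + yη + tθ`, where `T` is the elementary `2`-group with basis `ξ, η, θ`. -/
@[ext]
structure RingC : Type where
  n : ℤ
  c : C₀
  x : ZMod 2
  y : ZMod 2
  t : ZMod 2

namespace RingC

/-- The component `a` of the element `c = (a, B)` of `𝐂₀`. -/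
def a (r : RingC) : ℤ := r.c.1.1

instance : Zero RingC := ⟨⟨0, 0, 0, 0, 0⟩⟩
instance : One RingC := ⟨⟨1, 1, 0, 0, 0⟩⟩
instance : Add RingC :=
  ⟨fun r s => ⟨r.n + s.n, r.c + s.c, r.x + s.x, r.y + s.y, r.t + s.t⟩⟩
instance : Neg RingC := ⟨fun r => ⟨-r.n, -r.c, -r.x, -r.y, -r.t⟩⟩

/-- The multiplication determined by `ξη = θ`, `ηξ = 0`, `eξ = ξ`, `ηe = η` for `e = (1, 0, 0)`,
and `ξ(0, a, B) = aξ`, `(0, a, B)η = aη`. -/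
instance : Mul RingC :=
  ⟨fun r s =>
    { n := r.n * s.n
      c := r.c * s.c
      x := r.n * s.x + r.x * s.a
      y := r.a * s.y + r.y * s.n
      t := r.n * s.t + r.t * s.n + r.x * s.y }⟩

@[simp] lemma zero_n : (0 : RingC).n = 0 := rfl
@[simp] lemma zero_c : (0 : RingC).c = 0 := rfl
@[simp] lemma zero_x : (0 : RingC).x = 0 := rfl
@[simp] lemma zero_y : (0 : RingC).y = 0 := rfl
@[simp] lemma zero_t : (0 : RingC).t = 0 := rfl
@[simp] lemma zero_a : (0 : RingC).a = 0 := rfl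
@[simp] lemma one_n : (1 : RingC).n = 1 := rfl
@[simp] lemma one_c : (1 : RingC).c = 1 := rfl
@[simp] lemma one_x : (1 : RingC).x = 0 := rfl
@[simp] lemma one_y : (1 : RingC).y = 0 := rfl
@[simp] lemma one_t : (1 : RingC).t = 0 := rfl
@[simp] lemma one_a : (1 : RingC).a = 1 := rfl
@[simp] lemma add_n (r s : RingC) : (r + s).n = r.n + s.n := rfl
@[simp] lemma add_c (r s : RingC) : (r + s).c = r.c + s.c := rfl
@[simp] lemma add_x (r s : RingC) : (r + s).x = r.x + s.x := rfl
@[simp] lemma add_y (r s : RingC) : (r + s).y = r.y + s.y := rfl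
@[simp] lemma add_t (r s : RingC) : (r + s).t = r.t + s.t := rfl
@[simp] lemma add_a (r s : RingC) : (r + s).a = r.a + s.a := rfl
@[simp] lemma neg_n (r : RingC) : (-r).n = -r.n := rfl
@[simp] lemma neg_c (r : RingC) : (-r).c = -r.c := rfl
@[simp] lemma neg_x (r : RingC) : (-r).x = -r.x := rfl
@[simp] lemma neg_y (r : RingC) : (-r).y = -r.y := rfl
@[simp] lemma neg_t (r : RingC) : (-r).t = -r.t := rfl
@[simp] lemma mul_n (r s : RingC) : (r * s).n = r.n * s.n := rfl
@[simp] lemma mul_c (r s : RingC) : (r * s).c = r.c * s.c := rfl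
@[simp] lemma mul_x (r s : RingC) : (r * s).x = r.n * s.x + r.x * s.a := rfl
@[simp] lemma mul_y (r s : RingC) : (r * s).y = r.a * s.y + r.y * s.n := rfl
@[simp] lemma mul_t (r s : RingC) : (r * s).t = r.n * s.t + r.t * s.n + r.x * s.y := rfl
@[simp] lemma mul_a (r s : RingC) : (r * s).a = r.a * s.a := rfl

instance : Ring RingC where
  add_assoc r s q := by ext1 <;> simp [add_assoc]
  zero_add r := by ext1 <;> simp
  add_zero r := by ext1 <;> simp
  add_comm r s := by ext1 <;> simp [add_comm]
  neg_add_cancel r := by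
    ext1
    · exact neg_add_cancel r.n
    · exact neg_add_cancel r.c
    · exact neg_add_cancel r.x
    · exact neg_add_cancel r.y
    · exact neg_add_cancel r.t
  mul_assoc r s q := by ext1 <;> simp [mul_assoc] <;> ring
  one_mul r := by ext1 <;> simp
  mul_one r := by ext1 <;> simp
  zero_mul r := by ext1 <;> simp
  mul_zero r := by ext1 <;> simp
  left_distrib r s q := by ext1 <;> simp [mul_add] <;> ring
  right_distrib r s q := by ext1 <;> simp [add_mul] <;> ring
  nsmul := nsmulRec
  zsmul := zsmulRec

end RingC

/-! ## Functors out of ideal quotients and free preadditive categories -/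

/-! Part (1). Let `CubicLin` be the linearisation of the category of finitely generated free abelian
groups, divided by the identity of ℤ and by the cross-effect idempotents of degree above three.
Weakly alternative cubic functors are the additive functors on `CubicLin`. In its idempotent
completion the summand cut out of ℤᵐ by `eps m` represents the m-th cross-effect; here `eps 1 = 0`
and `eps 2 = 𝟙`. The claim is that these summands form a copy of 𝐀ᵃ and that they generate
`CubicLin`.

The symbols `duo a b` and `trio a b c` are the universal elements of the second and third
cross-effect. `trio` is trilinear because fourth deviations vanish, `duo` is bilinear up to terms
`diag k ≫ trio`, and both vanish when all arguments coincide, since such a map factors through ℤ.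
Polarising these facts gives the relations of 𝐀ᵃ (`CubicLin.altRels`), hence the functor behind
`theta`. It is full (`theta_full`) because all symbols arise from those on basis vectors by
diagonals and codiagonals. It is faithful (`theta_injective`) because `AltCat.isComb` bounds the
groups of morphisms from above by normal forms, and numerical functionals separate these: the
endomorphisms of 3 form ℤ[S₃] modulo the norm, detected by coefficients of permutations, and on the
endomorphisms of 2 there are in addition the determinant and a cubic form with values in ℤ/2.
Generation is `id_mem_summandIdeal`: every identity is a sum of rank one maps, and sums of more than
three of these reduce to shorter ones. The cross-effect functor is then fully faithful, and Yoneda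
shows that coinduction along the summands makes it essentially surjective.

Part (2). Write words in the order of `≫` and put x₁ = p₁h₁, x₂ = p₂h₂. The relations give xᵢ² =
2xᵢ, x₁x₂x₁ = x₁, x₂x₁x₂ = x₂. The orthogonal idempotents h₁p₂h₂p₁ and h₂p₁h₁p₂ of the object 2
factor through 3, so only their complement `idem` is new, and the image of `idem` together with the
object 3 generates all modules. The ring acting on the sum of the two values is 𝐂: x₁, x₂ generate
𝐂₀ as a unital ring, while ξ and η come from p₁ followed by `idem` and from `idem` followed by h₁;
these are killed by 2. In the proof 𝐂 is presented by generators and relations (`RingC.comb_mul`), a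
𝐂-module N is sent to eN ⊕ x₁x₂N ⊕ x₂x₁N at 2 and to the kernel of e at 3, and the inverse
construction is `AltRels.Glued`. -/

section IdealLift

universe v₁ v₂ u₁ u₂

variable {C : Type u₁} [Category.{v₁} C] {D : Type u₂} [Category.{v₂} D] [Preadditive D]

section

variable [Preadditive C] {S : MorphismProperty C}

instance idealQuotient_functor_additive (S : MorphismProperty C) :
    (CategoryTheory.Quotient.functor (idealRel S)).Additive where
  map_add := rfl

lemma map_eq_zero_of_mem_idealSpan (F : C ⥤ D) [F.Additive]
    (h : ∀ ⦃X Y : C⦄ (s : X ⟶ Y), S s → F.map s = 0) {X Y : C} {φ : X ⟶ Y}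
    (hφ : φ ∈ idealSpan S X Y) : F.map φ = 0 := by
  induction hφ using AddSubgroup.closure_induction with
  | mem x hx =>
    obtain ⟨A, B, f, s, g, hs, rfl⟩ := hx
    simp [h s hs]
  | zero => exact F.map_zero _ _
  | add x y _ _ hx hy => rw [F.map_add, hx, hy, add_zero]
  | neg x _ hx => rw [F.map_neg, hx, neg_zero]

lemma idealQuotient_map_eq_zero {X Y : C} {s : X ⟶ Y} (hs : S s) :
    (CategoryTheory.Quotient.functor (idealRel S)).map s = 0 := by
  rw [← (CategoryTheory.Quotient.functor (idealRel S)).map_zero]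
  refine CategoryTheory.Quotient.sound _ (?_ : s - 0 ∈ idealSpan S X Y)
  rw [sub_zero]
  exact AddSubgroup.subset_closure ⟨X, Y, 𝟙 X, s, 𝟙 Y, hs, by simp⟩

/-- An additive functor that kills `S` factors through the quotient by the ideal generated
by `S`. -/
def idealLift (F : C ⥤ D) [F.Additive] (h : ∀ ⦃X Y : C⦄ (s : X ⟶ Y), S s → F.map s = 0) :
    IdealQuotient S ⥤ D :=
  CategoryTheory.Quotient.lift _ F fun X Y f g hfg => by
    have := map_eq_zero_of_mem_idealSpan F h (φ := f - g) hfg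
    rwa [F.map_sub, sub_eq_zero] at this

instance idealLift_additive (F : C ⥤ D) [F.Additive]
    (h : ∀ ⦃X Y : C⦄ (s : X ⟶ Y), S s → F.map s = 0) : (idealLift F h).Additive where
  map_add {X Y f g} := by
    obtain ⟨f, rfl⟩ := (CategoryTheory.Quotient.functor _).map_surjective f
    obtain ⟨g, rfl⟩ := (CategoryTheory.Quotient.functor _).map_surjective g
    exact F.map_add

end

lemma Finsupp.induction_int {α : Type*} {p : (α →₀ ℤ) → Prop}
    (zero : p 0) (add : ∀ f g, p f → p g → p (f + g)) (neg : ∀ f, p f → p (-f))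
    (single : ∀ a, p (Finsupp.single a 1)) (f : α →₀ ℤ) : p f := by
  have key : ∀ (a : α) (n : ℕ), p (Finsupp.single a (n : ℤ)) := by
    intro a n
    induction n with
    | zero => simpa using zero
    | succ n ih =>
      rw [Nat.cast_succ, Finsupp.single_add]
      exact add _ _ ih (single a)
  induction f using Finsupp.induction_linear with
  | zero => exact zero
  | add f g hf hg => exact add f g hf hg
  | single f r =>
    obtain ⟨n, rfl | rfl⟩ := r.eq_nat_or_neg
    · exact key f n
    · rw [Finsupp.single_neg]
      exact neg _ (key f n)

/-- A morphism as a formal linear combination of morphisms. -/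
noncomputable def freeHom {X Y : C} (f : X ⟶ Y) : Free.of ℤ X ⟶ Free.of ℤ Y :=
  (Free.embedding ℤ C).map f

lemma freeHom_comp {X Y Z : C} (f : X ⟶ Y) (g : Y ⟶ Z) :
    freeHom (f ≫ g) = freeHom f ≫ freeHom g :=
  (Free.embedding ℤ C).map_comp f g

lemma free_hom_induction {X Y : C} {p : (Free.of ℤ X ⟶ Free.of ℤ Y) → Prop}
    (zero : p 0) (add : ∀ f g, p f → p g → p (f + g)) (neg : ∀ f, p f → p (-f))
    (emb : ∀ f : X ⟶ Y, p (freeHom f))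
    (f : Free.of ℤ X ⟶ Free.of ℤ Y) : p f :=
  Finsupp.induction_int zero add neg emb f

/-- The additive extension of the action of a functor on morphisms to formal linear
combinations of morphisms. -/
noncomputable def freeLiftHom (F : C ⥤ D) (X Y : C) :
    (Free.of ℤ X ⟶ Free.of ℤ Y) →+ (F.obj X ⟶ F.obj Y) :=
  Finsupp.liftAddHom (fun g : X ⟶ Y => zmultiplesHom _ (F.map g))

lemma freeLiftHom_freeHom (F : C ⥤ D) {X Y : C} (f : X ⟶ Y) :
    freeLiftHom F X Y (freeHom f) = F.map f :=
  (Finsupp.liftAddHom_apply_single _ _ _).trans (one_smul ℤ _)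

lemma freeLiftHom_comp (F : C ⥤ D) {X Y Z : C} (f : Free.of ℤ X ⟶ Free.of ℤ Y)
    (g : Free.of ℤ Y ⟶ Free.of ℤ Z) :
    freeLiftHom F X Z (f ≫ g) = freeLiftHom F X Y f ≫ freeLiftHom F Y Z g := by
  induction f using free_hom_induction with
  | zero => simp only [Limits.zero_comp, map_zero]
  | add f₁ f₂ h₁ h₂ => simp only [Preadditive.add_comp, map_add, h₁, h₂]
  | neg f h => simp only [Preadditive.neg_comp, map_neg, h]
  | emb f =>
    induction g using free_hom_induction with
    | zero => simp only [Limits.comp_zero, map_zero]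
    | add f₁ f₂ h₁ h₂ => simp only [Preadditive.comp_add, map_add, h₁, h₂]
    | neg f h => simp only [Preadditive.comp_neg, map_neg, h]
    | emb g =>
      rw [← freeHom_comp, freeLiftHom_freeHom, freeLiftHom_freeHom, freeLiftHom_freeHom,
        F.map_comp]

/-- The additive extension of a functor to the free preadditive category. -/
noncomputable def freeLift (F : C ⥤ D) : Free ℤ C ⥤ D where
  obj X := F.obj X
  map {X Y} f := freeLiftHom F X Y f
  map_id X := (freeLiftHom_freeHom F (𝟙 (id X : C))).trans (F.map_id _)
  map_comp f g := freeLiftHom_comp F f g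

instance freeLift_additive (F : C ⥤ D) : (freeLift F).Additive where
  map_add {X Y f g} := map_add (freeLiftHom F X Y) f g

lemma freeLift_map_freeHom (F : C ⥤ D) {X Y : C} (f : X ⟶ Y) :
    (freeLift F).map (freeHom f) = F.map f :=
  freeLiftHom_freeHom F f

end IdealLift

/-! ## The category `𝐀ᵃ` by generators and relations -/

/-- The relations between the generators `h₁, h₂, p₁, p₂` of `𝐀ᵃ`. -/
structure AltRels {D : Type*} [Category* D] [Preadditive D] {A B : D}
    (h₁ h₂ : A ⟶ B) (p₁ p₂ : B ⟶ A) : Prop where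
  p₂h₁ : p₂ ≫ h₁ = 0
  p₁h₂ : p₁ ≫ h₂ = 0
  h₁p₁h₁ : h₁ ≫ p₁ ≫ h₁ = (2 : ℤ) • h₁
  h₂p₂h₂ : h₂ ≫ p₂ ≫ h₂ = (2 : ℤ) • h₂
  p₁h₁p₁ : p₁ ≫ h₁ ≫ p₁ = (2 : ℤ) • p₁
  p₂h₂p₂ : p₂ ≫ h₂ ≫ p₂ = (2 : ℤ) • p₂
  add_h : h₁ + h₂ = h₁ ≫ p₂ ≫ h₂ ≫ p₁ ≫ h₁ + h₂ ≫ p₁ ≫ h₁ ≫ p₂ ≫ h₂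
  add_p : p₁ + p₂ = p₁ ≫ h₁ ≫ p₂ ≫ h₂ ≫ p₁ + p₂ ≫ h₂ ≫ p₁ ≫ h₁ ≫ p₂

namespace AltCat

variable {D : Type*} [Category* D] [Preadditive D]

/-- The morphism of `𝐀ᵃ` given by a formal linear combination of paths. -/
noncomputable def ofFree {X Y : CubicObj} (f : FreeCubic.ob X ⟶ FreeCubic.ob Y) : ob X ⟶ ob Y :=
  (CategoryTheory.Quotient.functor (idealRel CubicCat.idOne)).map
    ((CategoryTheory.Quotient.functor (idealRel FreeCubic.rel)).map f)

lemma ofFree_surjective {X Y : CubicObj} (f : ob X ⟶ ob Y) : ∃ g, ofFree g = f := by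
  obtain ⟨f, rfl⟩ := (CategoryTheory.Quotient.functor (idealRel CubicCat.idOne)).map_surjective f
  obtain ⟨f, rfl⟩ := (CategoryTheory.Quotient.functor (idealRel FreeCubic.rel)).map_surjective f
  exact ⟨f, rfl⟩

lemma ofFree_add {X Y : CubicObj} (f g : FreeCubic.ob X ⟶ FreeCubic.ob Y) :
    ofFree (f + g) = ofFree f + ofFree g := rfl

lemma ofFree_neg {X Y : CubicObj} (f : FreeCubic.ob X ⟶ FreeCubic.ob Y) :
    ofFree (-f) = -ofFree f := rfl

lemma ofFree_sub {X Y : CubicObj} (f g : FreeCubic.ob X ⟶ FreeCubic.ob Y) :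
    ofFree (f - g) = ofFree f - ofFree g := by
  rw [sub_eq_add_neg, ofFree_add, ofFree_neg, sub_eq_add_neg]

lemma ofFree_comp {X Y Z : CubicObj} (f : FreeCubic.ob X ⟶ FreeCubic.ob Y)
    (g : FreeCubic.ob Y ⟶ FreeCubic.ob Z) : ofFree (f ≫ g) = ofFree f ≫ ofFree g := rfl

lemma ofFree_two_zsmul {X Y : CubicObj} (f : FreeCubic.ob X ⟶ FreeCubic.ob Y) :
    ofFree ((2 : ℤ) • f) = (2 : ℤ) • ofFree f := by
  rw [two_zsmul, ofFree_add, two_zsmul]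

lemma ofFree_rel {X Y : CubicObj} {s : FreeCubic.ob X ⟶ FreeCubic.ob Y} (hs : FreeCubic.rel s) :
    ofFree s = 0 := by
  unfold ofFree
  rw [idealQuotient_map_eq_zero hs]
  rfl

lemma id_one : 𝟙 (ob .one) = 0 :=
  idealQuotient_map_eq_zero (S := CubicCat.idOne) CubicCat.idOne.mk

lemma eq_zero_of_source_one {Y : AltCat} (f : ob .one ⟶ Y) : f = 0 := by
  rw [← Category.id_comp f, id_one, Limits.zero_comp]

lemma eq_zero_of_target_one {Y : AltCat} (f : Y ⟶ ob .one) : f = 0 := by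
  rw [← Category.comp_id f, id_one, Limits.comp_zero]

/-- The generating morphism `h₁` of `𝐀ᵃ`. -/
noncomputable abbrev h₁ : ob .two ⟶ ob .three := gen CubicGen.h₁
/-- The generating morphism `h₂` of `𝐀ᵃ`. -/
noncomputable abbrev h₂ : ob .two ⟶ ob .three := gen CubicGen.h₂
/-- The generating morphism `p₁` of `𝐀ᵃ`. -/
noncomputable abbrev p₁ : ob .three ⟶ ob .two := gen CubicGen.p₁
/-- The generating morphism `p₂` of `𝐀ᵃ`. -/
noncomputable abbrev p₂ : ob .three ⟶ ob .two := gen CubicGen.p₂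

/-- Since the identity of the object 1 is zero, the words through it drop out of the defining
relations, and these eight remain. -/
lemma altRels : AltRels h₁ h₂ p₁ p₂ where
  p₂h₁ := ofFree_rel .h₁p₂
  p₁h₂ := ofFree_rel .h₂p₁
  h₁p₁h₁ := sub_eq_zero.1 ((ofFree_sub _ _).symm.trans (ofFree_rel .h₁p₁h₁)) |>.trans
    (ofFree_two_zsmul _)
  h₂p₂h₂ := sub_eq_zero.1 ((ofFree_sub _ _).symm.trans (ofFree_rel .h₂p₂h₂)) |>.trans
    (ofFree_two_zsmul _)
  p₁h₁p₁ := sub_eq_zero.1 ((ofFree_sub _ _).symm.trans (ofFree_rel .p₁h₁p₁)) |>.trans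
    (ofFree_two_zsmul _)
  p₂h₂p₂ := sub_eq_zero.1 ((ofFree_sub _ _).symm.trans (ofFree_rel .p₂h₂p₂)) |>.trans
    (ofFree_two_zsmul _)
  add_h := by
    have h : gen CubicGen.p ≫ gen CubicGen.h ≫ h₁ + h₁ + h₂ =
        h₁ ≫ p₂ ≫ h₂ ≫ p₁ ≫ h₁ + h₂ ≫ p₁ ≫ h₁ ≫ p₂ ≫ h₂ :=
      sub_eq_zero.1 ((ofFree_sub _ _).symm.trans (ofFree_rel .hbarp))
    rwa [eq_zero_of_target_one (gen CubicGen.p), Limits.zero_comp, zero_add] at h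
  add_p := by
    have h : (p₁ ≫ gen CubicGen.p) ≫ gen CubicGen.h + p₁ + p₂ =
        p₁ ≫ h₁ ≫ p₂ ≫ h₂ ≫ p₁ + p₂ ≫ h₂ ≫ p₁ ≫ h₁ ≫ p₂ :=
      sub_eq_zero.1 ((ofFree_sub _ _).symm.trans (ofFree_rel .hpbar))
    rwa [eq_zero_of_source_one (gen CubicGen.h), Limits.comp_zero, zero_add] at h

lemma hom_induction {P : ∀ ⦃X Y : CubicObj⦄, (ob X ⟶ ob Y) → Prop}
    (zero : ∀ X Y, P (0 : ob X ⟶ ob Y))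
    (add : ∀ ⦃X Y⦄ (f g : ob X ⟶ ob Y), P f → P g → P (f + g))
    (neg : ∀ ⦃X Y⦄ (f : ob X ⟶ ob Y), P f → P (-f))
    (id : ∀ X, P (𝟙 (ob X)))
    (comp : ∀ ⦃X Y Z⦄ (f : ob X ⟶ ob Y) (g : Y ⟶ Z), P f → P (f ≫ gen g))
    ⦃X Y : CubicObj⦄ (f : ob X ⟶ ob Y) : P f := by
  obtain ⟨f, rfl⟩ := ofFree_surjective f
  refine free_hom_induction (C := Paths CubicObj) (p := fun f => P (ofFree f)) ?_ ?_ ?_ ?_ f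
  · exact zero X Y
  · exact fun f g hf hg => add _ _ hf hg
  · exact fun f hf => neg _ hf
  · intro f
    refine Paths.induction_fixed_source (V := CubicObj) (a := X)
      (fun {Y} f => P (X := X) (Y := Y) (ofFree (freeHom (C := Paths CubicObj) f))) (id X) ?_ f
    intro Y Z f g ih
    have h := congrArg (ofFree (X := X) (Y := Z))
      (freeHom_comp (C := Paths CubicObj) f ((Paths.of CubicObj).map g))
    exact h ▸ comp (Y := Y) _ g ih

/-- The prefunctor on generators that is given by maps `h₁, h₂, p₁, p₂` and sends `h` and `p`
to zero. -/
def prefunctor (o : CubicObj → D) (h₁ h₂ : o .two ⟶ o .three) (p₁ p₂ : o .three ⟶ o .two) :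
    CubicObj ⥤q D where
  obj := o
  map {X Y} g := match X, Y, g with
    | _, _, .h => 0
    | _, _, .p => 0
    | _, _, .h₁ => h₁
    | _, _, .h₂ => h₂
    | _, _, .p₁ => p₁
    | _, _, .p₂ => p₂

section lift

variable (o : CubicObj → D) (h₀ : 𝟙 (o .one) = 0) {h₁ h₂ : o .two ⟶ o .three}
  {p₁ p₂ : o .three ⟶ o .two} (r : AltRels h₁ h₂ p₁ p₂)

/-- The extension of the generators to a functor on the free preadditive category. -/
noncomputable def freeExtend (h₁ h₂ : o .two ⟶ o .three) (p₁ p₂ : o .three ⟶ o .two) :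
    FreeCubic ⥤ D :=
  freeLift (Paths.lift (prefunctor o h₁ h₂ p₁ p₂))

instance : (freeExtend o h₁ h₂ p₁ p₂).Additive := freeLift_additive _

/-- The action of `freeExtend` on morphisms. -/
noncomputable def freeExtendHom (h₁ h₂ : o .two ⟶ o .three) (p₁ p₂ : o .three ⟶ o .two)
    {X Y : CubicObj} : (FreeCubic.ob X ⟶ FreeCubic.ob Y) →+ (o X ⟶ o Y) :=
  (freeExtend o h₁ h₂ p₁ p₂).mapAddHom

lemma freeExtendHom_comp {X Y Z : CubicObj} (f : FreeCubic.ob X ⟶ FreeCubic.ob Y)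
    (g : FreeCubic.ob Y ⟶ FreeCubic.ob Z) :
    freeExtendHom o h₁ h₂ p₁ p₂ (f ≫ g) =
      freeExtendHom o h₁ h₂ p₁ p₂ f ≫ freeExtendHom o h₁ h₂ p₁ p₂ g :=
  (freeExtend o h₁ h₂ p₁ p₂).map_comp f g

lemma freeExtend_gen {X Y : CubicObj} (g : X ⟶ Y) :
    freeExtendHom o h₁ h₂ p₁ p₂ (FreeCubic.gen g) = (prefunctor o h₁ h₂ p₁ p₂).map g :=
  (freeLift_map_freeHom _ _).trans (Paths.lift_toPath _ g)

lemma freeExtend_h : freeExtendHom o h₁ h₂ p₁ p₂ FreeCubic.h = 0 := freeExtend_gen o _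
lemma freeExtend_p : freeExtendHom o h₁ h₂ p₁ p₂ FreeCubic.p = 0 := freeExtend_gen o _
lemma freeExtend_h₁ : freeExtendHom o h₁ h₂ p₁ p₂ FreeCubic.h₁ = h₁ := freeExtend_gen o _
lemma freeExtend_h₂ : freeExtendHom o h₁ h₂ p₁ p₂ FreeCubic.h₂ = h₂ := freeExtend_gen o _
lemma freeExtend_p₁ : freeExtendHom o h₁ h₂ p₁ p₂ FreeCubic.p₁ = p₁ := freeExtend_gen o _
lemma freeExtend_p₂ : freeExtendHom o h₁ h₂ p₁ p₂ FreeCubic.p₂ = p₂ := freeExtend_gen o _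

include r in
lemma freeExtend_rel ⦃X Y : FreeCubic⦄ (s : X ⟶ Y) (hs : FreeCubic.rel s) :
    (freeExtend o h₁ h₂ p₁ p₂).map s = 0 := by
  suffices h : ∀ ⦃X Y : CubicObj⦄ (s : FreeCubic.ob X ⟶ FreeCubic.ob Y), FreeCubic.rel s →
    freeExtendHom o h₁ h₂ p₁ p₂ s = 0 from h s hs
  rintro X Y s ⟨⟩ <;> simp only [FreeCubic.hbar, FreeCubic.pbar, map_sub, map_add,
    map_zsmul, freeExtendHom_comp, freeExtend_h, freeExtend_p,
    freeExtend_h₁, freeExtend_h₂, freeExtend_p₁, freeExtend_p₂, Limits.zero_comp, Limits.comp_zero,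
    sub_self, zero_add, smul_zero, add_zero]
  · exact r.p₂h₁
  · exact r.p₁h₂
  · rw [r.h₁p₁h₁, sub_self]
  · rw [r.h₂p₂h₂, sub_self]
  · rw [r.p₁h₁p₁, sub_self]
  · rw [r.p₂h₂p₂, sub_self]
  · rw [← r.add_h, sub_self]
  · rw [← r.add_p, sub_self]

/-- The additive functor on `𝐀ᵃ` with prescribed values on the generators. -/
noncomputable def lift : AltCat ⥤ D :=
  idealLift (idealLift (freeExtend o h₁ h₂ p₁ p₂) (freeExtend_rel o r)) (by
    rintro _ _ _ ⟨⟩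
    exact ((idealLift _ _).map_id _).trans h₀)

instance lift_additive : (lift o h₀ r).Additive := idealLift_additive _ _

lemma lift_gen {X Y : CubicObj} (g : X ⟶ Y) :
    (lift o h₀ r).map (gen g) = (prefunctor o h₁ h₂ p₁ p₂).map g :=
  freeExtend_gen o g

end lift

end AltCat

/-! ### Consequences of the relations of 𝐀ᵃ -/

namespace AltRels

section

variable {D : Type*} [Category* D] [Preadditive D] {A B E : D}
  {h₁ h₂ : A ⟶ B} {p₁ p₂ : B ⟶ A} (r : AltRels h₁ h₂ p₁ p₂)
include r

/-- The relations are symmetric under exchange of the indices. -/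
lemma swap : AltRels h₂ h₁ p₂ p₁ where
  p₂h₁ := r.p₁h₂
  p₁h₂ := r.p₂h₁
  h₁p₁h₁ := r.h₂p₂h₂
  h₂p₂h₂ := r.h₁p₁h₁
  p₁h₁p₁ := r.p₂h₂p₂
  p₂h₂p₂ := r.p₁h₁p₁
  add_h := by rw [add_comm, r.add_h, add_comm]
  add_p := by rw [add_comm, r.add_p, add_comm]

lemma p₂h₁_assoc (k : B ⟶ E) : p₂ ≫ h₁ ≫ k = 0 := by
  rw [← Category.assoc, r.p₂h₁, Limits.zero_comp]

lemma p₁h₂_assoc (k : B ⟶ E) : p₁ ≫ h₂ ≫ k = 0 := by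
  rw [← Category.assoc, r.p₁h₂, Limits.zero_comp]

lemma h₁p₁h₁_assoc (k : B ⟶ E) : h₁ ≫ p₁ ≫ h₁ ≫ k = (2 : ℤ) • (h₁ ≫ k) := by
  rw [← Preadditive.zsmul_comp, ← r.h₁p₁h₁, Category.assoc, Category.assoc]

lemma h₂p₂h₂_assoc (k : B ⟶ E) : h₂ ≫ p₂ ≫ h₂ ≫ k = (2 : ℤ) • (h₂ ≫ k) :=
  r.swap.h₁p₁h₁_assoc k

lemma p₁h₁p₁_assoc (k : A ⟶ E) : p₁ ≫ h₁ ≫ p₁ ≫ k = (2 : ℤ) • (p₁ ≫ k) := by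
  rw [← Preadditive.zsmul_comp, ← r.p₁h₁p₁, Category.assoc, Category.assoc]

lemma p₂h₂p₂_assoc (k : A ⟶ E) : p₂ ≫ h₂ ≫ p₂ ≫ k = (2 : ℤ) • (p₂ ≫ k) :=
  r.swap.p₁h₁p₁_assoc k

/-- Composing `add_h` with p₁ kills the words that begin with h₂. In ℤ[S₃] modulo the norm this is
the identity x₁x₂x₁ = x₁ for xᵢ = 1 + sᵢ with sᵢ the adjacent transpositions. -/
lemma braid₁ : p₁ ≫ h₁ ≫ p₂ ≫ h₂ ≫ p₁ ≫ h₁ = p₁ ≫ h₁ := by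
  have h := congrArg (p₁ ≫ ·) r.add_h
  simp only [Preadditive.comp_add, r.p₁h₂, r.p₁h₂_assoc, add_zero] at h
  exact h.symm

lemma braid₂ : p₂ ≫ h₂ ≫ p₁ ≫ h₁ ≫ p₂ ≫ h₂ = p₂ ≫ h₂ := r.swap.braid₁

lemma braid₁_assoc (k : B ⟶ E) : p₁ ≫ h₁ ≫ p₂ ≫ h₂ ≫ p₁ ≫ h₁ ≫ k = p₁ ≫ h₁ ≫ k := by
  have h := congrArg (· ≫ k) r.braid₁
  simpa only [Category.assoc] using h

lemma braid₂_assoc (k : B ⟶ E) : p₂ ≫ h₂ ≫ p₁ ≫ h₁ ≫ p₂ ≫ h₂ ≫ k = p₂ ≫ h₂ ≫ k :=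
  r.swap.braid₁_assoc k

/-- Orients `add_h` as a rewriting rule, so that only the long word beginning with h₁ survives in
normal forms. -/
lemma long_h : h₂ ≫ p₁ ≫ h₁ ≫ p₂ ≫ h₂ = h₁ + h₂ - h₁ ≫ p₂ ≫ h₂ ≫ p₁ ≫ h₁ := by
  rw [r.add_h, add_sub_cancel_left]

lemma long_p : p₂ ≫ h₂ ≫ p₁ ≫ h₁ ≫ p₂ = p₁ + p₂ - p₁ ≫ h₁ ≫ p₂ ≫ h₂ ≫ p₁ := by
  rw [r.add_p, add_sub_cancel_left]

/-- After composing `long_h` with p₁h₁, the braid relation produces h₂p₁h₁ on both sides; cancelling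
it leaves the claim. -/
lemma two_long_h : (2 : ℤ) • (h₁ ≫ p₂ ≫ h₂ ≫ p₁ ≫ h₁) = (2 : ℤ) • h₁ := by
  have h := congrArg (· ≫ p₁ ≫ h₁) r.long_h
  simp only [Category.assoc, Preadditive.sub_comp, Preadditive.add_comp,
    r.h₁p₁h₁, Preadditive.comp_zsmul, r.braid₁] at h
  rw [add_sub_assoc, add_comm, sub_add] at h
  have h' := sub_eq_self.1 h.symm
  exact (sub_eq_zero.1 h')

lemma two_long_p : (2 : ℤ) • (p₁ ≫ h₁ ≫ p₂ ≫ h₂ ≫ p₁) = (2 : ℤ) • p₁ := by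
  have h := congrArg (p₁ ≫ h₁ ≫ ·) r.long_p
  simp only [Preadditive.comp_sub, Preadditive.comp_add, r.h₁p₁h₁_assoc, r.p₁h₁p₁,
    Preadditive.comp_zsmul, r.braid₁_assoc] at h
  rw [add_sub_assoc, add_comm, sub_add] at h
  have h' := sub_eq_self.1 h.symm
  exact (sub_eq_zero.1 h')

/-- The element `θ` of `𝐂` as an endomorphism. -/
lemma two_theta : (2 : ℤ) • (h₁ ≫ p₁ - (2 : ℤ) • (h₁ ≫ p₂ ≫ h₂ ≫ p₁)) = 0 := by
  have h := congrArg (· ≫ p₁) r.two_long_h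
  simp only [Preadditive.zsmul_comp, Category.assoc, r.p₁h₁p₁, Preadditive.comp_zsmul] at h
  rw [smul_sub, h, sub_self]

/-- The torsion elements hᵢpᵢ − 2(…) built from the two indices coincide, as one sees by computing
h₂p₁h₁p₂h₂p₁ once from `long_h` and once from `long_p`. Hence a single torsion coefficient suffices
in `IsComb`. -/
lemma theta_eq : h₂ ≫ p₂ = (2 : ℤ) • (h₂ ≫ p₁ ≫ h₁ ≫ p₂) +
    (h₁ ≫ p₁ - (2 : ℤ) • (h₁ ≫ p₂ ≫ h₂ ≫ p₁)) := by
  have h := congrArg (· ≫ p₁) r.long_h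
  have k := congrArg (h₂ ≫ ·) r.long_p
  simp only [Category.assoc, Preadditive.sub_comp, Preadditive.add_comp, r.p₁h₁p₁,
    Preadditive.comp_zsmul, Preadditive.comp_sub, Preadditive.comp_add, r.h₂p₂h₂_assoc] at h k
  rw [h] at k
  rw [k]
  module

end

end AltRels

/-! ### Normal forms for the morphisms of 𝐀ᵃ -/

namespace AltCat

/-- Every morphism of `𝐀ᵃ` is a linear combination of the given ones. -/
def IsComb : ∀ ⦃X Y : CubicObj⦄, (ob X ⟶ ob Y) → Prop
  | .two, .two, f => ∃ a b c d e t : ℤ, f = a • 𝟙 _ + b • (h₁ ≫ p₂) + c • (h₂ ≫ p₁) +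
      d • (h₁ ≫ p₂ ≫ h₂ ≫ p₁) + e • (h₂ ≫ p₁ ≫ h₁ ≫ p₂) +
      t • (h₁ ≫ p₁ - (2 : ℤ) • (h₁ ≫ p₂ ≫ h₂ ≫ p₁))
  | .two, .three, f => ∃ a b c d t : ℤ, f = a • h₁ + b • h₂ + c • (h₁ ≫ p₂ ≫ h₂) +
      d • (h₂ ≫ p₁ ≫ h₁) + t • (h₁ - h₁ ≫ p₂ ≫ h₂ ≫ p₁ ≫ h₁)
  | .three, .two, f => ∃ a b c d t : ℤ, f = a • p₁ + b • p₂ + c • (p₁ ≫ h₁ ≫ p₂) +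
      d • (p₂ ≫ h₂ ≫ p₁) + t • (p₁ - p₁ ≫ h₁ ≫ p₂ ≫ h₂ ≫ p₁)
  | .three, .three, f => ∃ a b c d e : ℤ, f = a • 𝟙 _ + b • (p₁ ≫ h₁) + c • (p₂ ≫ h₂) +
      d • (p₁ ≫ h₁ ≫ p₂ ≫ h₂) + e • (p₂ ≫ h₂ ≫ p₁ ≫ h₁)
  | .one, _, f => f = 0
  | _, .one, f => f = 0

lemma isComb_zero (X Y : CubicObj) : IsComb (0 : ob X ⟶ ob Y) := by
  cases X <;> cases Y <;> first
    | exact rfl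
    | exact ⟨0, 0, 0, 0, 0, 0, by simp⟩
    | exact ⟨0, 0, 0, 0, 0, by simp⟩

lemma isComb_neg ⦃X Y : CubicObj⦄ (f : ob X ⟶ ob Y) (hf : IsComb f) : IsComb (-f) := by
  cases X <;> cases Y
  case two.two =>
    obtain ⟨a, b, c, d, e, t, rfl⟩ := hf
    exact ⟨-a, -b, -c, -d, -e, -t, by module⟩
  case two.three | three.two | three.three =>
    obtain ⟨a, b, c, d, e, rfl⟩ := hf
    exact ⟨-a, -b, -c, -d, -e, by module⟩
  all_goals exact neg_eq_zero.2 hf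

lemma isComb_add ⦃X Y : CubicObj⦄ (f g : ob X ⟶ ob Y) (hf : IsComb f) (hg : IsComb g) :
    IsComb (f + g) := by
  cases X <;> cases Y
  case two.two =>
    obtain ⟨a, b, c, d, e, t, rfl⟩ := hf
    obtain ⟨a', b', c', d', e', t', rfl⟩ := hg
    exact ⟨a + a', b + b', c + c', d + d', e + e', t + t', by module⟩
  case two.three | three.two | three.three =>
    obtain ⟨a, b, c, d, e, rfl⟩ := hf
    obtain ⟨a', b', c', d', e', rfl⟩ := hg
    exact ⟨a + a', b + b', c + c', d + d', e + e', by module⟩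
  all_goals
    cases hf
    cases hg
    exact add_zero _

/-- Each witness is read off from the products of the normal words with one generator, after
`long_h` or `long_p` has removed the excluded long word. -/
lemma isComb_comp ⦃X Y Z : CubicObj⦄ (f : ob X ⟶ ob Y) (g : Y ⟶ Z) (hf : IsComb f) :
    IsComb (f ≫ gen g) := by
  have r := altRels
  change CubicGen Y Z at g
  cases g <;> cases X
  case h.one | p.one | h₁.one | h₂.one | p₁.one | p₂.one =>
    rw [eq_zero_of_source_one (_ ≫ _)]
    exact isComb_zero _ _
  case p.two | p.three =>
    rw [eq_zero_of_target_one (_ ≫ _)]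
    exact isComb_zero _ _
  case h.two | h.three =>
    rw [eq_zero_of_target_one f, Limits.zero_comp]
    exact isComb_zero _ _
  case h₁.two =>
    obtain ⟨a, b, c, d, e, t, rfl⟩ := hf
    -- The long word equals h₁ minus the torsion morphism, whence a + d and −d; the t-term vanishes
    -- by `two_long_h`.
    refine ⟨a + d, 0, 0, c, -d, ?_⟩
    simp only [Preadditive.add_comp, Preadditive.zsmul_comp, Preadditive.sub_comp, Category.assoc,
      Category.id_comp, r.p₂h₁, r.h₁p₁h₁, r.two_long_h, Limits.comp_zero]
    module
  case h₂.two =>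
    obtain ⟨a, b, c, d, e, t, rfl⟩ := hf
    refine ⟨0, a + e, b, 0, e, ?_⟩
    simp only [Preadditive.add_comp, Preadditive.zsmul_comp, Preadditive.sub_comp, Category.assoc,
      Category.id_comp, r.p₁h₂, r.long_h, Limits.comp_zero]
    module
  case h₁.three =>
    obtain ⟨a, b, c, d, t, rfl⟩ := hf
    refine ⟨0, a, 0, 0, d, ?_⟩
    simp only [Preadditive.add_comp, Preadditive.zsmul_comp, Preadditive.sub_comp, Category.assoc,
      r.p₂h₁, r.braid₁, Limits.comp_zero]
    module
  case h₂.three =>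
    obtain ⟨a, b, c, d, t, rfl⟩ := hf
    refine ⟨0, 0, b, c, 0, ?_⟩
    simp only [Preadditive.add_comp, Preadditive.zsmul_comp, Preadditive.sub_comp, Category.assoc,
      r.p₁h₂, Limits.comp_zero]
    module
  case p₁.two =>
    obtain ⟨a, b, c, d, t, rfl⟩ := hf
    refine ⟨0, 0, b + 2 * d, c + 2 * a, 0, a + t, ?_⟩
    simp only [Preadditive.add_comp, Preadditive.zsmul_comp, Preadditive.sub_comp, Category.assoc,
      r.p₁h₁p₁, Preadditive.comp_zsmul]
    module
  case p₂.two =>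
    obtain ⟨a, b, c, d, t, rfl⟩ := hf
    -- `theta_eq` splits b • h₂p₂ into a multiple of a normal word and b times the torsion element;
    -- `long_p` turns the t-term into −t times that element.
    refine ⟨0, a + 2 * c, 0, 0, d + 2 * b, b - t, ?_⟩
    simp only [Preadditive.add_comp, Preadditive.zsmul_comp, Preadditive.sub_comp, Category.assoc,
      r.p₂h₂p₂, Preadditive.comp_zsmul, r.long_p, Preadditive.comp_add,
      Preadditive.comp_sub, r.h₁p₁h₁_assoc]
    rw [r.theta_eq]
    module
  case p₁.three =>
    obtain ⟨a, b, c, d, e, rfl⟩ := hf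
    refine ⟨a + 2 * b + d, 0, 0, c + 2 * e, -d, ?_⟩
    simp only [Preadditive.add_comp, Preadditive.zsmul_comp, Category.assoc,
      Category.id_comp, r.p₁h₁p₁, Preadditive.comp_zsmul]
    module
  case p₂.three =>
    obtain ⟨a, b, c, d, e, rfl⟩ := hf
    refine ⟨0, a + 2 * c + e, b + 2 * d, 0, e, ?_⟩
    simp only [Preadditive.add_comp, Preadditive.zsmul_comp, Category.assoc,
      Category.id_comp, r.p₂h₂p₂, Preadditive.comp_zsmul, r.long_p]
    module

lemma isComb ⦃X Y : CubicObj⦄ (f : ob X ⟶ ob Y) : IsComb f := by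
  refine hom_induction isComb_zero isComb_add isComb_neg ?_ isComb_comp f
  rintro (_ | _ | _)
  · exact id_one
  · exact ⟨1, 0, 0, 0, 0, 0, by simp⟩
  · exact ⟨1, 0, 0, 0, 0, by simp⟩

end AltCat

/-! ## The preadditive category that carries weakly alternative cubic functors -/

/-- The combinations of morphisms that each weakly alternative cubic functor kills. -/
inductive CubicLin.rel : MorphismProperty (Free ℤ Fab)
  | idZ : CubicLin.rel (freeHom (𝟙 Fab.Z))
  | cross {m : ℕ} (hm : 3 < m) (A : Fin m → Fab) :
      CubicLin.rel (∑ S : Finset (Fin m), (-1 : ℤ) ^ (m - S.card) • freeHom (Fab.proj A S))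

/-- The preadditive category generated by finitely generated free abelian groups, modulo the
identity of `ℤ` and the cross-effects of degree greater than three. -/
abbrev CubicLin := IdealQuotient CubicLin.rel

namespace CubicLin

variable {A B C : Fab}

/-- An object of `CubicLin`. -/
noncomputable def of (A : Fab) : CubicLin := (CategoryTheory.Quotient.functor _).obj (Free.of ℤ A)

/-- The class of a formal linear combination of morphisms. -/
noncomputable def ofFree (A B : Fab) : (Free.of ℤ A ⟶ Free.of ℤ B) →+ (of A ⟶ of B) :=
  (CategoryTheory.Quotient.functor (idealRel rel)).mapAddHom

/-- The class of a morphism. -/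
noncomputable def cls (f : A ⟶ B) : of A ⟶ of B := ofFree A B (freeHom f)

lemma ofFree_surjective : Function.Surjective (ofFree A B) :=
  (CategoryTheory.Quotient.functor (idealRel rel)).map_surjective

lemma ofFree_comp (f : Free.of ℤ A ⟶ Free.of ℤ B) (g : Free.of ℤ B ⟶ Free.of ℤ C) :
    ofFree A C (f ≫ g) = ofFree A B f ≫ ofFree B C g := rfl

lemma cls_comp (f : A ⟶ B) (g : B ⟶ C) : cls (f ≫ g) = cls f ≫ cls g := by
  rw [cls, freeHom_comp, ofFree_comp, cls, cls]

lemma cls_id (A : Fab) : cls (𝟙 A) = 𝟙 (of A) := rfl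

lemma hom_induction {p : (of A ⟶ of B) → Prop} (zero : p 0)
    (add : ∀ f g, p f → p g → p (f + g)) (neg : ∀ f, p f → p (-f)) (cls : ∀ f, p (cls f))
    (f : of A ⟶ of B) : p f := by
  obtain ⟨f, rfl⟩ := ofFree_surjective f
  induction f using free_hom_induction with
  | zero => simpa using zero
  | add f g hf hg => simpa using add _ _ hf hg
  | neg f hf => simpa using neg _ hf
  | emb f => exact cls f

lemma cls_id_Z : cls (𝟙 Fab.Z) = 0 := idealQuotient_map_eq_zero rel.idZ

lemma cls_factor_eq_zero (u : A ⟶ Fab.Z) (v : Fab.Z ⟶ B) : cls (u ≫ v) = 0 := by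
  rw [← Category.id_comp v, cls_comp, cls_comp, cls_id_Z, Limits.zero_comp, Limits.comp_zero]

lemma cls_zero : cls (0 : A ⟶ B) = 0 := by
  rw [← Limits.comp_zero (f := (0 : A ⟶ Fab.Z)), cls_factor_eq_zero]

lemma sum_cls_proj {m : ℕ} (hm : 3 < m) (A : Fin m → Fab) :
    ∑ S : Finset (Fin m), (-1 : ℤ) ^ (m - S.card) • cls (Fab.proj A S) = 0 := by
  have h : ofFree _ _ (∑ S : Finset (Fin m), (-1 : ℤ) ^ (m - S.card) • freeHom (Fab.proj A S)) = 0 :=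
    idealQuotient_map_eq_zero (rel.cross hm A)
  rw [map_sum] at h
  rw [← h]
  exact Finset.sum_congr rfl fun S _ => (map_zsmul _ _ _).symm

end CubicLin

namespace Fab

variable {m : ℕ} {A B : Fab}

/-- The morphism to a direct sum with given components. -/
def toSum (A : Fab) {B : Fin m → Fab} (f : ∀ k, A ⟶ B k) : A ⟶ sum B :=
  ObjectProperty.homMk (AddCommGrpCat.ofHom
    (AddMonoidHom.mk' (fun x k => (f k).hom x) (fun x y => by ext; simp) :
      A.obj →+ (∀ k, (B k).obj)))

/-- The morphism from a direct sum with given components. -/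
def fromSum {A : Fin m → Fab} (B : Fab) (f : ∀ k, A k ⟶ B) : sum A ⟶ B :=
  ObjectProperty.homMk (AddCommGrpCat.ofHom
    (AddMonoidHom.mk' (fun x => ∑ k, (f k).hom (x k)) (fun x y => by
      simp [Finset.sum_add_distrib]) : (∀ k, (A k).obj) →+ B.obj))

@[ext]
lemma hom_ext {f g : A ⟶ B} (h : ∀ x : A.obj, f.hom x = g.hom x) : f = g := by
  apply ObjectProperty.hom_ext
  ext x
  exact h x

lemma add_hom_apply (f g : A ⟶ B) (x : A.obj) : (f + g).hom x = f.hom x + g.hom x := rfl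

lemma sum_hom_apply {ι : Type*} (s : Finset ι) (f : ι → (A ⟶ B)) (x : A.obj) :
    (∑ i ∈ s, f i).hom x = ∑ i ∈ s, (f i).hom x := by
  classical
  induction s using Finset.induction_on with
  | empty => rfl
  | insert a s ha ih => rw [Finset.sum_insert ha, Finset.sum_insert ha, add_hom_apply, ih]

lemma toSum_proj_fromSum (C : Fin m → Fab) (f : ∀ k, A ⟶ C k) (g : ∀ k, C k ⟶ B)
    (S : Finset (Fin m)) : toSum A f ≫ proj C S ≫ fromSum B g = ∑ k ∈ S, f k ≫ g k := by
  ext x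
  rw [sum_hom_apply]
  change ∑ k, (g k).hom (if k ∈ S then (f k).hom x else 0) = ∑ k ∈ S, (g k).hom ((f k).hom x)
  rw [← Finset.sum_subset (Finset.subset_univ S)
    (fun k _ hk => by rw [if_neg hk]; exact map_zero _)]
  exact Finset.sum_congr rfl fun k hk => by rw [if_pos hk]

lemma proj_eq_sum (C : Fin m → Fab) (S : Finset (Fin m)) :
    proj C S = ∑ k ∈ S, proj C {k} := by
  ext x
  rw [sum_hom_apply]
  funext j
  refine Eq.trans ?_ (Finset.sum_apply (M := fun k => (C k).obj) j S _).symm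
  change (if j ∈ S then x j else 0) = ∑ k ∈ S, if j ∈ ({k} : Finset _) then x j else 0
  simp [Finset.sum_ite_eq]

end Fab

namespace CubicLin

variable {A B : Fab}

/-- Pull the relation for Bᵐ back along the map with components f and push it forward along the
summation map: the partial idempotents become partial sums. -/
lemma sum_cls_sum {m : ℕ} (hm : 3 < m) (f : Fin m → (A ⟶ B)) :
    ∑ S : Finset (Fin m), (-1 : ℤ) ^ (m - S.card) • cls (∑ k ∈ S, f k) = 0 := by
  have h := congrArg (fun y => cls (Fab.toSum A f) ≫ y ≫ cls (Fab.fromSum B (fun _ => 𝟙 B)))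
    (sum_cls_proj hm (fun _ => B))
  simpa only [Preadditive.sum_comp, Preadditive.comp_sum, Preadditive.zsmul_comp,
    Preadditive.comp_zsmul, ← cls_comp, Fab.toSum_proj_fromSum, Category.comp_id,
    Limits.zero_comp, Limits.comp_zero] using h

/-- The case m = 4 solved for its top term. The empty set contributes nothing, as the zero map
factors through ℤ. -/
lemma cls_sum_four (f g h k : A ⟶ B) :
    cls (f + g + h + k) = cls (f + g + h) + cls (f + g + k) + cls (f + h + k) + cls (g + h + k)
      - cls (f + g) - cls (f + h) - cls (f + k) - cls (g + h) - cls (g + k) - cls (h + k)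
      + cls f + cls g + cls h + cls k := by
  have key := sum_cls_sum (m := 4) (by norm_num) ![f, g, h, k]
  have hu : (Finset.univ : Finset (Finset (Fin 4))) = {∅, {0}, {1}, {2}, {3}, {0, 1}, {0, 2}, {0, 3},
    {1, 2}, {1, 3}, {2, 3}, {0, 1, 2}, {0, 1, 3}, {0, 2, 3}, {1, 2, 3}, {0, 1, 2, 3}} := by decide
  rw [hu] at key
  repeat rw [Finset.sum_insert (by decide)] at key
  simp [← add_assoc, cls_zero] at key
  rw [← sub_eq_zero, ← key]
  abel

section functional

variable {R : Type*} [AddCommGroup R]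

/-- The extension of a function on morphisms to formal linear combinations. -/
noncomputable def freeEval (φ : (A ⟶ B) → R) : (Free.of ℤ A ⟶ Free.of ℤ B) →+ R :=
  Finsupp.liftAddHom (fun f : A ⟶ B => zmultiplesHom _ (φ f))

lemma freeEval_freeHom (φ : (A ⟶ B) → R) (f : A ⟶ B) : freeEval φ (freeHom f) = φ f :=
  (Finsupp.liftAddHom_apply_single _ _ _).trans (one_smul ℤ _)

/-- A function on morphisms is cubic if its higher deviations vanish, and if it vanishes on
morphisms that factor through `ℤ`. -/
structure IsCubic (φ : (A ⟶ B) → R) : Prop where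
  factor : ∀ (u : A ⟶ Fab.Z) (v : Fab.Z ⟶ B), φ (u ≫ v) = 0
  cross : ∀ (m : ℕ) (_ : 3 < m) (f : Fin m → (A ⟶ B)),
    ∑ S : Finset (Fin m), (-1 : ℤ) ^ (m - S.card) • φ (∑ k ∈ S, f k) = 0

lemma freeEval_comp_comp {φ : (A ⟶ B) → R} {C D : Fab} {s : Free.of ℤ C ⟶ Free.of ℤ D}
    (hs : ∀ (f : A ⟶ C) (g : D ⟶ B), freeEval φ (freeHom f ≫ s ≫ freeHom g) = 0)
    (f : Free.of ℤ A ⟶ Free.of ℤ C) (g : Free.of ℤ D ⟶ Free.of ℤ B) :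
    freeEval φ (f ≫ s ≫ g) = 0 := by
  induction f using free_hom_induction with
  | zero => simp
  | add f g hf hg => simp only [Preadditive.add_comp, map_add, hf, hg, add_zero]
  | neg f hf => simp only [Preadditive.neg_comp, map_neg, hf, neg_zero]
  | emb f =>
    induction g using free_hom_induction with
    | zero => simp
    | add g g' hf hg => simp only [Preadditive.comp_add, map_add, hf, hg, add_zero]
    | neg g hf => simp only [Preadditive.comp_neg, map_neg, hf, neg_zero]
    | emb g => exact hs f g

/-- The two conditions of `IsCubic` suffice for the whole two-sided ideal: composing with f and g
preserves maps through ℤ, and turns the idempotents of a direct sum into partial sums of the maps f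
≫ eₖ ≫ g. -/
lemma IsCubic.freeEval_eq_zero {φ : (A ⟶ B) → R} (hφ : IsCubic φ) {C D : Free ℤ Fab}
    (f : Free.of ℤ A ⟶ C) (s : C ⟶ D) (g : D ⟶ Free.of ℤ B) (hs : rel s) :
    freeEval φ (f ≫ s ≫ g) = 0 := by
  rcases hs with _ | ⟨hm, C⟩
  · refine freeEval_comp_comp (C := Fab.Z) (D := Fab.Z) (s := freeHom (𝟙 Fab.Z)) (fun f g => ?_) f g
    rw [← freeHom_comp, ← freeHom_comp, freeEval_freeHom, Category.id_comp]
    exact hφ.factor _ _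
  · refine freeEval_comp_comp (C := Fab.sum C) (D := Fab.sum C)
      (s := ∑ S, (-1 : ℤ) ^ (_ - S.card) • freeHom (Fab.proj C S)) (fun f g => ?_) f g
    rw [Preadditive.sum_comp, Preadditive.comp_sum, map_sum,
      ← hφ.cross _ hm (fun k => f ≫ Fab.proj C {k} ≫ g)]
    refine Finset.sum_congr rfl fun S _ => ?_
    rw [Preadditive.zsmul_comp, Preadditive.comp_zsmul, map_zsmul, ← freeHom_comp, ← freeHom_comp,
      freeEval_freeHom, Fab.proj_eq_sum, Preadditive.sum_comp, Preadditive.comp_sum]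

/-- A cubic function on morphisms as an additive map on morphisms of `CubicLin`. -/
noncomputable def IsCubic.eval {φ : (A ⟶ B) → R} (hφ : IsCubic φ) : (of A ⟶ of B) →+ R where
  toFun := Quot.lift (freeEval φ) (by
    rintro f g h
    rw [HomRel.compClosure_iff_self] at h
    have key : idealSpan rel (Free.of ℤ A) (Free.of ℤ B) ≤ (freeEval φ).ker := by
      refine (AddSubgroup.closure_le _).2 ?_
      rintro _ ⟨C, D, f, s, g, hs, rfl⟩
      exact hφ.freeEval_eq_zero f s g hs
    exact sub_eq_zero.1 ((map_sub (freeEval φ) f g).symm.trans (key h)))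
  map_zero' := map_zero (freeEval φ)
  map_add' x y := by
    obtain ⟨x, rfl⟩ := ofFree_surjective x
    obtain ⟨y, rfl⟩ := ofFree_surjective y
    exact map_add (freeEval φ) x y

lemma IsCubic.eval_cls {φ : (A ⟶ B) → R} (hφ : IsCubic φ) (f : A ⟶ B) : hφ.eval (cls f) = φ f :=
  freeEval_freeHom φ f

end functional

end CubicLin

/-! ### Weakly alternative cubic functors as additive functors on `CubicLin` -/

namespace IsWeaklyAlternativeCubic

variable {F G : Fab ⥤ AddCommGrpCat.{u}} (hF : IsWeaklyAlternativeCubic F)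
  (hG : IsWeaklyAlternativeCubic G) {A B C : Fab}

include hF in
lemma crossIdem_eq_zero {m : ℕ} (hm : 3 < m) (A : Fin m → Fab) : crossIdem F A = 0 := by
  have := hF.degree_le m hm A
  ext x
  exact congrArg Subtype.val (Subsingleton.elim (α := crossEffect F A)
    ⟨(crossIdem F A).hom x, x, rfl⟩ 0)

/-- The extension of a weakly alternative cubic functor to `CubicLin`. -/
noncomputable def extend : CubicLin ⥤ AddCommGrpCat.{u} :=
  idealLift (freeLift F) (by
    rintro _ _ _ (_ | ⟨hm, A⟩)
    · refine (freeLift_map_freeHom F (𝟙 Fab.Z)).trans ?_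
      have := hF.zero_at_Z
      ext x
      exact Subsingleton.elim (α := F.obj Fab.Z) _ _
    · refine Eq.trans ?_ (hF.crossIdem_eq_zero hm A)
      refine (map_sum (freeLiftHom F (Fab.sum A) (Fab.sum A)) _ _).trans ?_
      refine Finset.sum_congr rfl fun S _ => ?_
      rw [map_zsmul, freeLiftHom_freeHom])

instance extend_additive : hF.extend.Additive := idealLift_additive _ _

/-- The action of the extension of `F` to `CubicLin` on morphisms. -/
noncomputable def mapHom : (CubicLin.of A ⟶ CubicLin.of B) →+ (F.obj A ⟶ F.obj B) :=
  hF.extend.mapAddHom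

lemma mapHom_cls (f : A ⟶ B) : hF.mapHom (CubicLin.cls f) = F.map f :=
  freeLift_map_freeHom F f

lemma mapHom_comp (f : CubicLin.of A ⟶ CubicLin.of B) (g : CubicLin.of B ⟶ CubicLin.of C) :
    hF.mapHom (f ≫ g) = hF.mapHom f ≫ hF.mapHom g :=
  hF.extend.map_comp f g

lemma mapHom_id (A : Fab) : hF.mapHom (𝟙 (CubicLin.of A)) = 𝟙 (F.obj A) :=
  hF.extend.map_id _

lemma mapHom_naturality (η : F ⟶ G) (f : CubicLin.of A ⟶ CubicLin.of B) :
    hF.mapHom f ≫ η.app B = η.app A ≫ hG.mapHom f := by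
  induction f using CubicLin.hom_induction with
  | zero => simp
  | add f g hf hg => simp only [map_add, Preadditive.add_comp, Preadditive.comp_add, hf, hg]
  | neg f hf => simp only [map_neg, Preadditive.neg_comp, Preadditive.comp_neg, hf]
  | cls f => rw [mapHom_cls, mapHom_cls, η.naturality]

end IsWeaklyAlternativeCubic

/-! ### Homomorphisms out of ℤᵐ -/

namespace Fab

variable {m : ℕ} {A B C : Fab}

/-- The homomorphism `ℤ → B` with prescribed value at `1`. -/
def ofElt (b : B.obj) : Z ⟶ B :=
  ObjectProperty.homMk (AddCommGrpCat.ofHom (zmultiplesHom _ b))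

/-- The `k`-th coordinate on `ℤᵐ`. -/
def coord (k : Fin m) : pow m ⟶ Z :=
  ObjectProperty.homMk (AddCommGrpCat.ofHom (Pi.evalAddMonoidHom (fun _ : Fin m => ℤ) k))

/-- The homomorphism `ℤᵐ → B` with prescribed values at the basis vectors. -/
def desc (b : Fin m → B.obj) : pow m ⟶ B := ∑ k, coord k ≫ ofElt (b k)

/-- The standard basis of `ℤᵐ`. -/
def basis (i : Fin m) : (pow m).obj := fun j => ((if j = i then 1 else 0 : ℤ) : ℤ)

/-- The value of a homomorphism on `ℤᵐ`. -/
def powEval (f : pow m ⟶ B) : (Fin m → ℤ) →+ B.obj := f.hom.hom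

lemma pow_hom_ext {f g : pow m ⟶ B} (h : ∀ x, powEval f x = powEval g x) : f = g :=
  hom_ext h

lemma powEval_desc (b : Fin m → B.obj) (x : Fin m → ℤ) : powEval (desc b) x = ∑ k, x k • b k :=
  sum_hom_apply _ _ _

lemma powEval_comp (f : pow m ⟶ B) (g : B ⟶ C) (x : Fin m → ℤ) :
    powEval (f ≫ g) x = g.hom.hom (powEval f x) := rfl

lemma powEval_sum {ι : Type*} (s : Finset ι) (f : ι → (pow m ⟶ B)) (x : Fin m → ℤ) :
    powEval (∑ i ∈ s, f i) x = ∑ i ∈ s, powEval (f i) x :=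
  sum_hom_apply s f x

lemma powEval_diag_comp (k : Fin m) (g : pow (m + 1) ⟶ B) (x : Fin m → ℤ) :
    powEval (diag k ≫ g) x = powEval g (fun j => x (k.predAbove j)) := rfl

lemma powEval_codiag_comp (k : Fin m) (g : pow m ⟶ B) (x : Fin (m + 1) → ℤ) :
    powEval (codiag k ≫ g) x = powEval g (fun i => ∑ j, if k.predAbove j = i then x j else 0) := rfl

lemma powEval_proj_comp (S : Finset (Fin m)) (g : pow m ⟶ B) (x : Fin m → ℤ) :
    powEval (proj _ S ≫ g) x = powEval g (fun k => if k ∈ S then x k else 0) := rfl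

lemma powEval_coord_comp (k : Fin m) (b : B.obj) (x : Fin m → ℤ) :
    powEval (coord k ≫ ofElt b) x = x k • b := rfl

lemma ofElt_add (b c : B.obj) : ofElt (b + c) = ofElt b + ofElt c := by
  ext n
  exact smul_add (M := ℤ) n b c

lemma ofElt_zero : ofElt (0 : B.obj) = 0 := by
  ext n
  exact smul_zero (M := ℤ) n

lemma proj_comp_desc (S : Finset (Fin m)) (b : Fin m → B.obj) :
    proj _ S ≫ desc b = ∑ k ∈ S, coord k ≫ ofElt (b k) := by
  refine pow_hom_ext fun x => ?_
  simp only [powEval_proj_comp, powEval_desc, powEval_sum, powEval_coord_comp, ite_smul, zero_smul]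
  simp

lemma desc_comp (b : Fin m → B.obj) (f : B ⟶ C) : desc b ≫ f = desc (fun k => f.hom.hom (b k)) := by
  refine pow_hom_ext fun x => ?_
  simp only [powEval_comp, powEval_desc, map_sum, map_zsmul]

lemma desc_basis : desc (basis (m := m)) = 𝟙 _ := by
  refine pow_hom_ext fun x => ?_
  rw [powEval_desc]
  have h : ∑ k, x k • (fun j => if j = k then (1 : ℤ) else 0 : Fin m → ℤ) = x := by
    ext j
    simp
  exact h

lemma diag_comp_desc (k : Fin m) (b : Fin (m + 1) → B.obj) :
    diag k ≫ desc b = desc (fun i => ∑ j, if k.predAbove j = i then b j else 0) := by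
  refine pow_hom_ext fun x => ?_
  simp only [powEval_diag_comp, powEval_desc, Finset.smul_sum, smul_ite, smul_zero]
  rw [Finset.sum_comm]
  simp

lemma codiag_comp_desc (k : Fin m) (b : Fin m → B.obj) :
    codiag k ≫ desc b = desc (fun j => b (k.predAbove j)) := by
  refine pow_hom_ext fun x => ?_
  simp only [powEval_codiag_comp, powEval_desc, Finset.sum_smul, ite_smul, zero_smul]
  rw [Finset.sum_comm]
  simp

end Fab

/-! ### Universal elements of the second and third cross-effect -/

namespace CubicLin

variable {B C : Fab}

lemma cls_coord {m : ℕ} (k : Fin m) (b : B.obj) : cls (Fab.coord k ≫ Fab.ofElt b) = 0 :=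
  cls_factor_eq_zero _ _

/-- The idempotent of `ℤᵐ` that cuts out the cross-effect. -/
noncomputable def eps (m : ℕ) : of (Fab.pow m) ⟶ of (Fab.pow m) :=
  ∑ S : Finset (Fin m), (-1 : ℤ) ^ (m - S.card) • cls (Fab.proj _ S)

/-- The universal element with two arguments. -/
noncomputable def duo (a b : B.obj) : of (Fab.pow 2) ⟶ of B := cls (Fab.desc ![a, b])

/-- The universal element with three arguments. -/
noncomputable def trio (a b c : B.obj) : of (Fab.pow 3) ⟶ of B := eps 3 ≫ cls (Fab.desc ![a, b, c])

lemma eps_comp_cls_desc {m : ℕ} (b : Fin m → B.obj) : eps m ≫ cls (Fab.desc b) =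
    ∑ S : Finset (Fin m), (-1 : ℤ) ^ (m - S.card) • cls (∑ k ∈ S, Fab.coord k ≫ Fab.ofElt (b k)) := by
  simp only [eps, Preadditive.sum_comp, Preadditive.zsmul_comp, ← cls_comp, Fab.proj_comp_desc]

/-- The terms with fewer than two indices factor through ℤ, so only the full set contributes. -/
lemma eps_two : eps 2 = 𝟙 _ := by
  have h := eps_comp_cls_desc (Fab.basis (m := 2))
  rw [Fab.desc_basis, cls_id, Category.comp_id] at h
  have hu : (Finset.univ : Finset (Finset (Fin 2))) = {∅, {0}, {1}, {0, 1}} := by decide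
  rw [h, hu]
  repeat rw [Finset.sum_insert (by decide)]
  simp only [Finset.sum_singleton, Finset.sum_empty, cls_zero, cls_coord, smul_zero, zero_add]
  rw [← cls_id, ← Fab.desc_basis, Fab.desc, Finset.card_pair (by decide), Nat.sub_self, pow_zero,
    one_smul]
  rfl

lemma trio_eq (a b c : B.obj) : trio a b c =
    cls (Fab.coord 0 ≫ Fab.ofElt a + Fab.coord 1 ≫ Fab.ofElt b + Fab.coord 2 ≫ Fab.ofElt c) -
    cls (Fab.coord 0 ≫ Fab.ofElt a + Fab.coord 1 ≫ Fab.ofElt b) -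
    cls (Fab.coord 0 ≫ Fab.ofElt a + Fab.coord 2 ≫ Fab.ofElt c) -
    cls (Fab.coord 1 ≫ Fab.ofElt b + Fab.coord 2 ≫ Fab.ofElt c) := by
  rw [trio, eps_comp_cls_desc]
  have hu : (Finset.univ : Finset (Finset (Fin 3))) =
    {∅, {0}, {1}, {2}, {0, 1}, {0, 2}, {1, 2}, {0, 1, 2}} := by decide
  rw [hu]
  repeat rw [Finset.sum_insert (by decide)]
  simp [← add_assoc, cls_zero, cls_coord]
  abel

end CubicLin

/-! ### The calculus of `duo` and `trio`, and the relations of 𝐀ᵃ -/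

namespace CubicLin

variable {B C : Fab}

lemma cls_zero_add_coord {m : ℕ} (k : Fin m) (f : Fab.pow m ⟶ B) :
    cls (f + Fab.coord k ≫ Fab.ofElt (0 : B.obj)) = cls f := by
  rw [Fab.ofElt_zero, Limits.comp_zero, add_zero]

lemma duo_zero_right (a : B.obj) : duo a 0 = 0 := by
  rw [duo, Fab.desc, Fin.sum_univ_two]
  exact (cls_zero_add_coord _ _).trans (cls_coord _ _)

lemma duo_zero_left (a : B.obj) : duo 0 a = 0 := by
  rw [duo, Fab.desc, Fin.sum_univ_two, add_comm]
  exact (cls_zero_add_coord _ _).trans (cls_coord _ _)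

lemma trio_eq_desc (a b c : B.obj) : trio a b c =
    cls (Fab.desc ![a, b, c]) - cls (Fab.desc ![a, b, 0]) - cls (Fab.desc ![a, 0, c]) -
      cls (Fab.desc ![0, b, c]) := by
  rw [trio_eq]
  simp [Fab.desc, Fin.sum_univ_three, Fab.ofElt_zero]

/-- Apply `cls_sum_four` to the rank one maps belonging to a, a', b, c. The first two share a
coordinate, so their sum still has rank one and vanishes. -/
lemma trio_add₁ (a a' b c : B.obj) : trio (a + a') b c = trio a b c + trio a' b c := by
  have h₀ : cls (Fab.coord (m := 3) 0 ≫ Fab.ofElt a + Fab.coord 0 ≫ Fab.ofElt a') = 0 := by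
    rw [← Preadditive.comp_add, ← Fab.ofElt_add, cls_coord]
  simp only [trio_eq, Fab.ofElt_add, Preadditive.comp_add]
  rw [cls_sum_four, h₀]
  simp only [cls_coord]
  abel

lemma trio_add₂ (a b b' c : B.obj) : trio a (b + b') c = trio a b c + trio a b' c := by
  have h₀ : cls (Fab.coord (m := 3) 1 ≫ Fab.ofElt b + Fab.coord 1 ≫ Fab.ofElt b') = 0 := by
    rw [← Preadditive.comp_add, ← Fab.ofElt_add, cls_coord]
  simp only [trio_eq, Fab.ofElt_add, Preadditive.comp_add, ← add_assoc]
  rw [cls_sum_four, h₀]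
  simp only [cls_coord]
  abel

lemma trio_add₃ (a b c c' : B.obj) : trio a b (c + c') = trio a b c + trio a b c' := by
  have h₀ : cls (Fab.coord (m := 3) 2 ≫ Fab.ofElt c + Fab.coord 2 ≫ Fab.ofElt c') = 0 := by
    rw [← Preadditive.comp_add, ← Fab.ofElt_add, cls_coord]
  simp only [trio_eq, Fab.ofElt_add, Preadditive.comp_add, ← add_assoc]
  rw [cls_sum_four, h₀]
  simp only [cls_coord]
  abel

lemma trio_zero₁ (b c : B.obj) : trio 0 b c = 0 := by
  have h := trio_add₁ 0 0 b c
  rwa [add_zero, left_eq_add] at h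

lemma trio_zero₂ (a c : B.obj) : trio a 0 c = 0 := by
  have h := trio_add₂ a 0 0 c
  rwa [add_zero, left_eq_add] at h

lemma trio_zero₃ (a b : B.obj) : trio a b 0 = 0 := by
  have h := trio_add₃ a b 0 0
  rwa [add_zero, left_eq_add] at h

lemma trio_comp (a b c : B.obj) (f : B ⟶ C) :
    trio a b c ≫ cls f = trio (f.hom.hom a) (f.hom.hom b) (f.hom.hom c) := by
  rw [trio, Category.assoc, ← cls_comp, Fab.desc_comp, trio]
  congr 3
  funext i
  fin_cases i <;> rfl

lemma duo_comp (a b : B.obj) (f : B ⟶ C) :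
    duo a b ≫ cls f = duo (f.hom.hom a) (f.hom.hom b) := by
  rw [duo, ← cls_comp, Fab.desc_comp, duo]
  congr 2
  funext i
  fin_cases i <;> rfl

lemma trio_basis : trio (Fab.basis 0) (Fab.basis 1) (Fab.basis 2) = eps 3 := by
  have h : (![Fab.basis 0, Fab.basis 1, Fab.basis 2] : Fin 3 → (Fab.pow 3).obj) = Fab.basis := by
    funext i
    fin_cases i <;> rfl
  rw [trio, h, Fab.desc_basis, cls_id, Category.comp_id]

lemma duo_basis : duo (Fab.basis 0) (Fab.basis 1) = 𝟙 _ := by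
  have h : (![Fab.basis 0, Fab.basis 1] : Fin 2 → (Fab.pow 2).obj) = Fab.basis := by
    funext i
    fin_cases i <;> rfl
  rw [duo, h, Fab.desc_basis, cls_id]

lemma proj_basis {m : ℕ} {S : Finset (Fin m)} {i : Fin m} (hi : i ∉ S) :
    (Fab.proj (fun _ : Fin m => Fab.Z) S).hom.hom (Fab.basis i) = 0 := by
  funext j
  change (if j ∈ S then (if j = i then (1 : ℤ) else 0) else 0) = 0
  split_ifs with h₁ h₂
  · exact absurd (h₂ ▸ h₁) hi
  · rfl
  · rfl

lemma proj_univ {m : ℕ} (A : Fin m → Fab) : Fab.proj A Finset.univ = 𝟙 _ := by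
  ext x
  funext j
  exact if_pos (Finset.mem_univ j)

/-- `eps 3` is `trio` at the basis, and the projection annihilates one of its three arguments. -/
lemma eps_three_comp_proj {S : Finset (Fin 3)} (hS : S ≠ Finset.univ) :
    eps 3 ≫ cls (Fab.proj _ S) = 0 := by
  obtain ⟨i, hi⟩ : ∃ i, i ∉ S := by
    by_contra! h
    exact hS (Finset.eq_univ_of_forall h)
  rw [← trio_basis, trio_comp]
  have h := proj_basis hi
  fin_cases i
  · exact (congrArg (trio · _ _) h).trans (trio_zero₁ _ _)
  · exact (congrArg (trio _ · _) h).trans (trio_zero₂ _ _)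
  · exact (congrArg (trio _ _ ·) h).trans (trio_zero₃ _ _)

lemma eps_three_idem : eps 3 ≫ eps 3 = eps 3 := by
  nth_rw 2 [eps]
  rw [Preadditive.comp_sum, Finset.sum_eq_single Finset.univ]
  · rw [proj_univ, cls_id, Preadditive.comp_zsmul, Category.comp_id]
    simp
  · intro S _ hS
    rw [Preadditive.comp_zsmul, eps_three_comp_proj hS, smul_zero]
  · simp

lemma eps_comp_trio (a b c : B.obj) : eps 3 ≫ trio a b c = trio a b c := by
  rw [trio, ← Category.assoc, eps_three_idem]

/-- The diagonal maps between cross-effects. -/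
noncomputable def diag (k : Fin 2) : of (Fab.pow 2) ⟶ of (Fab.pow 3) := cls (Fab.diag k) ≫ eps 3

/-- The codiagonal maps between cross-effects. -/
noncomputable def codiag (k : Fin 2) : of (Fab.pow 3) ⟶ of (Fab.pow 2) :=
  eps 3 ≫ cls (Fab.codiag k)

lemma diag_comp_eps (k : Fin 2) : diag k ≫ eps 3 = diag k := by
  rw [diag, Category.assoc, eps_three_idem]

lemma eps_comp_codiag (k : Fin 2) : eps 3 ≫ codiag k = codiag k := by
  rw [codiag, ← Category.assoc, eps_three_idem]

lemma cls_diag_zero (a b c : B.obj) :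
    cls (Fab.diag (0 : Fin 2)) ≫ cls (Fab.desc ![a, b, c]) = duo (a + b) c := by
  rw [← cls_comp, Fab.diag_comp_desc, duo]
  congr 2
  funext i
  fin_cases i <;> simp [Fin.sum_univ_three, Fin.predAbove]

lemma cls_diag_one (a b c : B.obj) :
    cls (Fab.diag (1 : Fin 2)) ≫ cls (Fab.desc ![a, b, c]) = duo a (b + c) := by
  rw [← cls_comp, Fab.diag_comp_desc, duo]
  congr 2
  funext i
  fin_cases i <;> simp [Fin.sum_univ_three, Fin.predAbove]

/-- The diagonal merges the first two arguments, so the expansion of `trio a b c` as an alternating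
sum becomes the deviation of `duo` from additivity. -/
lemma duo_add_left (a b c : B.obj) :
    duo (a + b) c = duo a c + duo b c + diag 0 ≫ trio a b c := by
  rw [diag, Category.assoc, eps_comp_trio, trio_eq_desc]
  simp only [Preadditive.comp_sub, cls_diag_zero, add_zero, zero_add, duo_zero_right]
  abel

lemma duo_add_right (a b c : B.obj) :
    duo a (b + c) = duo a b + duo a c + diag 1 ≫ trio a b c := by
  rw [diag, Category.assoc, eps_comp_trio, trio_eq_desc]
  simp only [Preadditive.comp_sub, cls_diag_one, add_zero, zero_add, duo_zero_left]
  abel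

lemma codiag_zero_comp_duo (a b : B.obj) : codiag 0 ≫ duo a b = trio a a b := by
  rw [codiag, Category.assoc, duo, ← cls_comp, Fab.codiag_comp_desc, trio]
  congr 3
  funext i
  fin_cases i <;> rfl

lemma codiag_one_comp_duo (a b : B.obj) : codiag 1 ≫ duo a b = trio a b b := by
  rw [codiag, Category.assoc, duo, ← cls_comp, Fab.codiag_comp_desc, trio]
  congr 3
  funext i
  fin_cases i <;> rfl

lemma desc_const {m : ℕ} (a : B.obj) :
    Fab.desc (fun _ : Fin m => a) = (∑ k, Fab.coord k) ≫ Fab.ofElt a := by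
  rw [Fab.desc, Preadditive.sum_comp]

/-- The map ℤ² → B with both values equal to a factors through ℤ. This is where F(ℤ) = 0 enters the
relations. -/
lemma duo_self (a : B.obj) : duo a a = 0 := by
  have h : ![a, a] = fun _ => a := by
    funext i
    fin_cases i <;> rfl
  rw [duo, h, desc_const, cls_factor_eq_zero]

lemma trio_self (a : B.obj) : trio a a a = 0 := by
  rw [← codiag_zero_comp_duo, duo_self, Limits.comp_zero]

/-- Polarisation of `duo_self` at a + b. -/
lemma duo_swap (a b : B.obj) : duo b a = -(duo a b + diag 1 ≫ trio a a b + diag 1 ≫ trio b a b +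
    diag 0 ≫ trio a b a + diag 0 ≫ trio a b b) := by
  have h := duo_self (a + b)
  simp only [duo_add_left, duo_add_right, trio_add₁, Preadditive.comp_add] at h
  simp only [duo_self] at h
  rw [← sub_eq_zero, ← h]
  abel

lemma trio_polarized₂ (a b : B.obj) : trio a a b + trio a b a + trio b a a + trio a b b +
    trio b a b + trio b b a = 0 := by
  have h := trio_self (a + b)
  simp only [trio_add₁, trio_add₂, trio_add₃] at h
  simp only [trio_self] at h
  rw [← h]
  abel

/-- Compare the deviations from additivity on the two sides of `codiag_zero_comp_duo`. Thus the
codiagonal followed by the diagonal acts on `trio` as 1 plus a transposition. -/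
lemma codiag_diag_zero (a b c : B.obj) :
    codiag 0 ≫ diag 0 ≫ trio a b c = trio a b c + trio b a c := by
  have h := codiag_zero_comp_duo (a + b) c
  simp only [duo_add_left, Preadditive.comp_add, codiag_zero_comp_duo, trio_add₁, trio_add₂] at h
  rw [← sub_eq_zero] at h ⊢
  rw [← h]
  abel

lemma codiag_diag_one (a b c : B.obj) :
    codiag 1 ≫ diag 1 ≫ trio a b c = trio a b c + trio a c b := by
  have h := codiag_one_comp_duo a (b + c)
  simp only [duo_add_right, Preadditive.comp_add, codiag_one_comp_duo, trio_add₃, trio_add₂] at h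
  rw [← sub_eq_zero] at h ⊢
  rw [← h]
  abel

lemma diag_zero_trio_comm (a b c : B.obj) : diag 0 ≫ trio a b c = diag 0 ≫ trio b a c := by
  have h := duo_add_left a b c
  rw [add_comm a b, duo_add_left, add_comm (duo b c)] at h
  exact (add_left_cancel h).symm

lemma diag_one_trio_comm (a b c : B.obj) : diag 1 ≫ trio a b c = diag 1 ≫ trio a c b := by
  have h := duo_add_right a b c
  rw [add_comm b c, duo_add_right, add_comm (duo a c)] at h
  exact (add_left_cancel h).symm

/-- The third deviation of the vanishing function x ↦ `duo x x`. -/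
lemma diag_polarized (a b c : B.obj) :
    diag 0 ≫ trio a b c + diag 0 ≫ trio a c b + diag 0 ≫ trio b c a +
      diag 1 ≫ trio a b c + diag 1 ≫ trio b a c + diag 1 ≫ trio c a b = 0 := by
  have h := duo_self (a + b + c)
  have h₁ := duo_self (a + b)
  have h₂ := duo_self (a + c)
  have h₃ := duo_self (b + c)
  simp only [duo_add_left, duo_add_right, trio_add₁, trio_add₂,
    Preadditive.comp_add] at h h₁ h₂ h₃
  simp only [duo_self] at h h₁ h₂ h₃
  have := congrArg₂ (· - ·) h (congrArg₂ (· + ·) h₁ (congrArg₂ (· + ·) h₂ h₃))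
  simp only [add_zero, sub_zero] at this
  rw [← this]
  abel

/-- Yoneda: the universal case is `trio` at the basis, which is `eps 3`. -/
lemma eq_of_comp_trio {X : CubicLin} {f g : X ⟶ of (Fab.pow 3)} (hf : f ≫ eps 3 = f)
    (hg : g ≫ eps 3 = g) (h : ∀ a b c : (Fab.pow 3).obj, f ≫ trio a b c = g ≫ trio a b c) :
    f = g := by
  rw [← hf, ← hg, ← trio_basis, h]

lemma eq_of_comp_duo {X : CubicLin} {f g : X ⟶ of (Fab.pow 2)}
    (h : ∀ a b : (Fab.pow 2).obj, f ≫ duo a b = g ≫ duo a b) : f = g := by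
  have := h (Fab.basis 0) (Fab.basis 1)
  rwa [duo_basis, Category.comp_id, Category.comp_id] at this

/-- All relations are tested on symbols. The vanishing products express that `trio (a + b) c c` and
`trio a a (b + c)` are additive in a, b and in b, c, so the correction term of `duo` has to die. The
relations with factor 2 come from the symmetry of `diag k ≫ trio` in the merged arguments, or from
the repeated arguments of `trio`. The last two are the polarised forms of `duo_self` and
`trio_self`. -/
theorem altRels : AltRels (diag 0) (diag 1) (codiag 0) (codiag 1) where
  p₂h₁ := by
    refine eq_of_comp_trio (by rw [Category.assoc, diag_comp_eps]) Limits.zero_comp fun a b c => ?_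
    have h := codiag_one_comp_duo (a + b) c
    simp only [duo_add_left, Preadditive.comp_add, codiag_one_comp_duo, trio_add₁] at h
    simpa using h
  p₁h₂ := by
    refine eq_of_comp_trio (by rw [Category.assoc, diag_comp_eps]) Limits.zero_comp fun a b c => ?_
    have h := codiag_zero_comp_duo a (b + c)
    simp only [duo_add_right, Preadditive.comp_add, codiag_zero_comp_duo, trio_add₃] at h
    simpa using h
  h₁p₁h₁ := by
    refine eq_of_comp_trio (by simp only [Category.assoc, diag_comp_eps])
      (by rw [Preadditive.zsmul_comp, diag_comp_eps]) fun a b c => ?_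
    simp only [Category.assoc, codiag_diag_zero, Preadditive.comp_add, Preadditive.zsmul_comp]
    rw [diag_zero_trio_comm b a c, two_zsmul]
  h₂p₂h₂ := by
    refine eq_of_comp_trio (by simp only [Category.assoc, diag_comp_eps])
      (by rw [Preadditive.zsmul_comp, diag_comp_eps]) fun a b c => ?_
    simp only [Category.assoc, codiag_diag_one, Preadditive.comp_add, Preadditive.zsmul_comp]
    rw [diag_one_trio_comm a c b, two_zsmul]
  p₁h₁p₁ := by
    refine eq_of_comp_duo fun a b => ?_
    simp only [Category.assoc, codiag_diag_zero, codiag_zero_comp_duo, two_zsmul,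
      Preadditive.add_comp]
  p₂h₂p₂ := by
    refine eq_of_comp_duo fun a b => ?_
    simp only [Category.assoc, codiag_diag_one, codiag_one_comp_duo, two_zsmul,
      Preadditive.add_comp]
  add_h := by
    refine eq_of_comp_trio (by simp only [Preadditive.add_comp, diag_comp_eps])
      (by simp only [Preadditive.add_comp, Category.assoc, diag_comp_eps]) fun a b c => ?_
    simp only [Category.assoc, Preadditive.add_comp, codiag_diag_zero, codiag_diag_one,
      Preadditive.comp_add]
    have h := diag_polarized a b c
    rw [diag_zero_trio_comm b a c, diag_one_trio_comm a c b]
    rw [← sub_eq_zero, ← neg_eq_zero, ← h]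
    abel
  add_p := by
    refine eq_of_comp_duo fun a b => ?_
    simp only [Category.assoc, Preadditive.add_comp, codiag_diag_zero, codiag_diag_one,
      Preadditive.comp_add, codiag_zero_comp_duo, codiag_one_comp_duo]
    have h := trio_polarized₂ a b
    rw [← sub_eq_zero, ← neg_eq_zero, ← h]
    abel

end CubicLin

/-! ### Generation of all symbols by those on increasing basis vectors -/

lemma Fab.pow_induction {m : ℕ} {p : (Fab.pow m).obj → Prop} (zero : p 0)
    (add : ∀ a b, p a → p b → p (a + b)) (neg : ∀ a, p a → p (-a))
    (basis : ∀ i, p (Fab.basis i)) (a : (Fab.pow m).obj) : p a := by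
  have hmem : a ∈ AddSubgroup.closure (Set.range (Fab.basis (m := m))) := by
    obtain ⟨x, rfl⟩ : ∃ x : Fin m → ℤ, Fab.powEval (𝟙 (Fab.pow m)) x = a := ⟨a, rfl⟩
    rw [← Fab.desc_basis, Fab.powEval_desc]
    exact sum_mem fun k _ => zsmul_mem (AddSubgroup.subset_closure (Set.mem_range_self k)) _
  induction hmem using AddSubgroup.closure_induction with
  | mem x hx =>
    obtain ⟨i, rfl⟩ := hx
    exact basis i
  | zero => exact zero
  | add x y _ _ hx hy => exact add x y hx hy
  | neg x _ hx => exact neg x hx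

namespace CubicLin

section generation

variable {m : ℕ} {X : CubicLin} {S₂ : AddSubgroup (of (Fab.pow 2) ⟶ X)}
  {S₃ : AddSubgroup (of (Fab.pow 3) ⟶ X)}
  (hd : ∀ k, ∀ f ∈ S₃, diag k ≫ f ∈ S₂) (hc : ∀ k, ∀ f ∈ S₂, codiag k ≫ f ∈ S₃)
  {B : Fab} {y : of B ⟶ X}

include hd hc

/-- The transposition is `codiag 0 ≫ diag 0` minus the identity on symbols, and both preserve S₃. -/
lemma trio_swap₁_mem {a b c : B.obj} (h : trio a b c ≫ y ∈ S₃) : trio b a c ≫ y ∈ S₃ := by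
  have h' := sub_mem (hc 0 _ (hd 0 _ h)) h
  rwa [← Category.assoc, ← Category.assoc, Category.assoc (codiag 0), codiag_diag_zero,
    Preadditive.add_comp, add_sub_cancel_left] at h'

lemma trio_swap₂_mem {a b c : B.obj} (h : trio a b c ≫ y ∈ S₃) : trio a c b ≫ y ∈ S₃ := by
  have h' := sub_mem (hc 1 _ (hd 1 _ h)) h
  rwa [← Category.assoc, ← Category.assoc, Category.assoc (codiag 1), codiag_diag_one,
    Preadditive.add_comp, add_sub_cancel_left] at h'

omit hd in
lemma trio_self₁_mem {a b : B.obj} (h : duo a b ≫ y ∈ S₂) : trio a a b ≫ y ∈ S₃ := by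
  have h' := hc 0 _ h
  rwa [← Category.assoc, codiag_zero_comp_duo] at h'

omit hd in
lemma trio_self₂_mem {a b : B.obj} (h : duo a b ≫ y ∈ S₂) : trio a b b ≫ y ∈ S₃ := by
  have h' := hc 1 _ h
  rwa [← Category.assoc, codiag_one_comp_duo] at h'

/-- The correction terms of `duo_swap` are diagonals of `trio` with a repeated argument, which come
from `duo a b` by codiagonals and transpositions. -/
lemma duo_swap_mem {a b : B.obj} (h : duo a b ≫ y ∈ S₂) : duo b a ≫ y ∈ S₂ := by
  have h₁ := trio_self₁_mem hc h
  have h₂ := trio_self₂_mem hc h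
  simp only [duo_swap a b, Preadditive.neg_comp, Preadditive.add_comp, Category.assoc]
  exact neg_mem (add_mem (add_mem (add_mem (add_mem h (hd _ _ h₁))
    (hd _ _ (trio_swap₁_mem hd hc h₂))) (hd _ _ (trio_swap₂_mem hd hc h₁))) (hd _ _ h₂))

variable {y : of (Fab.pow m) ⟶ X}
  (h₂ : ∀ i j, i < j → duo (Fab.basis i) (Fab.basis j) ≫ y ∈ S₂)
  (h₃ : ∀ i j k, i < j → j < k → trio (Fab.basis i) (Fab.basis j) (Fab.basis k) ≫ y ∈ S₃)
include h₂

lemma duo_basis_mem (i j : Fin m) : duo (Fab.basis i) (Fab.basis j) ≫ y ∈ S₂ := by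
  rcases lt_trichotomy i j with h | rfl | h
  · exact h₂ i j h
  · rw [duo_self, Limits.zero_comp]
    exact zero_mem _
  · exact duo_swap_mem hd hc (h₂ j i h)

include h₃

/-- Transpositions sort the indices; if two of them agree, the symbol is a transposed codiagonal of
a `duo`. -/
lemma trio_basis_mem (i j k : Fin m) :
    trio (Fab.basis i) (Fab.basis j) (Fab.basis k) ≫ y ∈ S₃ := by
  have hdb := duo_basis_mem hd hc h₂
  rcases lt_trichotomy i j with h | rfl | h
  · rcases lt_trichotomy j k with h' | rfl | h'
    · exact h₃ i j k h h'
    · exact trio_self₂_mem hc (hdb i j)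
    · rcases lt_trichotomy i k with h'' | rfl | h''
      · exact trio_swap₂_mem hd hc (h₃ i k j h'' h')
      · exact trio_swap₂_mem hd hc (trio_self₁_mem hc (hdb i j))
      · exact trio_swap₂_mem hd hc (trio_swap₁_mem hd hc (h₃ k i j h'' h))
  · exact trio_self₁_mem hc (hdb i k)
  · rcases lt_trichotomy j k with h' | rfl | h'
    · rcases lt_trichotomy i k with h'' | rfl | h''
      · exact trio_swap₁_mem hd hc (h₃ j i k h h'')
      · exact trio_swap₁_mem hd hc (trio_self₂_mem hc (hdb j i))
      · exact trio_swap₁_mem hd hc (trio_swap₂_mem hd hc (h₃ j k i h' h''))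
    · exact trio_self₂_mem hc (hdb i j)
    · exact trio_swap₁_mem hd hc (trio_swap₂_mem hd hc (trio_swap₁_mem hd hc (h₃ k j i h' h)))

lemma trio_mem (a b c : (Fab.pow m).obj) : trio a b c ≫ y ∈ S₃ := by
  induction a using Fab.pow_induction with
  | zero => rw [trio_zero₁, Limits.zero_comp]; exact zero_mem _
  | add a a' h h' => rw [trio_add₁, Preadditive.add_comp]; exact add_mem h h'
  | neg a h =>
    have := trio_add₁ a (-a) b c
    rw [add_neg_cancel, trio_zero₁] at this
    rw [← neg_eq_of_add_eq_zero_right this.symm, Preadditive.neg_comp]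
    exact neg_mem h
  | basis i =>
    induction b using Fab.pow_induction with
    | zero => rw [trio_zero₂, Limits.zero_comp]; exact zero_mem _
    | add a a' h h' => rw [trio_add₂, Preadditive.add_comp]; exact add_mem h h'
    | neg b h =>
      have := trio_add₂ (Fab.basis i) b (-b) c
      rw [add_neg_cancel, trio_zero₂] at this
      rw [← neg_eq_of_add_eq_zero_right this.symm, Preadditive.neg_comp]
      exact neg_mem h
    | basis j =>
      induction c using Fab.pow_induction with
      | zero => rw [trio_zero₃, Limits.zero_comp]; exact zero_mem _
      | add a a' h h' => rw [trio_add₃, Preadditive.add_comp]; exact add_mem h h'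
      | neg c h =>
        have := trio_add₃ (Fab.basis i) (Fab.basis j) c (-c)
        rw [add_neg_cancel, trio_zero₃] at this
        rw [← neg_eq_of_add_eq_zero_right this.symm, Preadditive.neg_comp]
        exact neg_mem h
      | basis k => exact trio_basis_mem hd hc h₂ h₃ i j k

/-- `duo` is only bilinear up to diagonals of `trio`, so the statement for all `trio` has to come
before. -/
lemma duo_mem (a b : (Fab.pow m).obj) : duo a b ≫ y ∈ S₂ := by
  have ht := trio_mem hd hc h₂ h₃
  have hadd₁ : ∀ a a' b, duo a b ≫ y ∈ S₂ → duo a' b ≫ y ∈ S₂ → duo (a + a') b ≫ y ∈ S₂ := by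
    intro a a' b h h'
    rw [duo_add_left, Preadditive.add_comp, Preadditive.add_comp, Category.assoc]
    exact add_mem (add_mem h h') (hd _ _ (ht _ _ _))
  have hneg₁ : ∀ a b, duo a b ≫ y ∈ S₂ → duo (-a) b ≫ y ∈ S₂ := by
    intro a b h
    have := congrArg (· ≫ y) (duo_add_left a (-a) b)
    simp only [add_neg_cancel, duo_zero_left, Limits.zero_comp, Preadditive.add_comp,
      Category.assoc] at this
    rw [add_right_comm] at this
    rw [← neg_eq_of_add_eq_zero_right this.symm]
    exact neg_mem (add_mem h (hd _ _ (ht _ _ _)))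
  induction a using Fab.pow_induction with
  | zero => rw [duo_zero_left, Limits.zero_comp]; exact zero_mem _
  | add a a' h h' => exact hadd₁ a a' b h h'
  | neg a h => exact hneg₁ a b h
  | basis i =>
    -- The swap reduces the induction on the second argument to additivity in the first.
    refine duo_swap_mem hd hc ?_
    induction b using Fab.pow_induction with
    | zero => rw [duo_zero_left, Limits.zero_comp]; exact zero_mem _
    | add a a' h h' => exact hadd₁ a a' _ h h'
    | neg a h => exact hneg₁ a _ h
    | basis j => exact duo_basis_mem hd hc h₂ j i

end generation

/-! ### The functor from 𝐀ᵃ to the cross-effect summands and its fullness -/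

lemma eps_one : eps 1 = 0 := by
  have h := eps_comp_cls_desc (Fab.basis (m := 1))
  rw [Fab.desc_basis, cls_id, Category.comp_id] at h
  have hu : (Finset.univ : Finset (Finset (Fin 1))) = {∅, {0}} := by decide
  rw [h, hu, Finset.sum_insert (by decide)]
  simp only [Finset.sum_singleton, Finset.sum_empty, cls_zero, cls_coord, smul_zero, zero_add]

lemma eps_deg_idem (X : CubicObj) : eps X.deg ≫ eps X.deg = eps X.deg := by
  cases X
  · change eps 1 ≫ eps 1 = eps 1
    rw [eps_one, Limits.comp_zero]
  · change eps 2 ≫ eps 2 = eps 2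
    rw [eps_two, Category.comp_id]
  · exact eps_three_idem

/-- The direct summand of `ℤᵐ` that represents the `m`-th cross-effect. -/
noncomputable def summand (X : CubicObj) : Idempotents.Karoubi CubicLin :=
  ⟨of (Fab.pow X.deg), eps X.deg, eps_deg_idem X⟩

/-- A diagonal map as a morphism of direct summands. -/
noncomputable def diagK (k : Fin 2) : summand .two ⟶ summand .three :=
  ⟨diag k, by
    change eps 2 ≫ diag k ≫ eps 3 = diag k
    rw [eps_two, Category.id_comp, diag_comp_eps]⟩

/-- A codiagonal map as a morphism of direct summands. -/
noncomputable def codiagK (k : Fin 2) : summand .three ⟶ summand .two :=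
  ⟨codiag k, by
    change eps 3 ≫ codiag k ≫ eps 2 = codiag k
    rw [eps_two, Category.comp_id, eps_comp_codiag]⟩

lemma altRelsK : AltRels (diagK 0) (diagK 1) (codiagK 0) (codiagK 1) where
  p₂h₁ := Idempotents.Karoubi.hom_ext _ _ altRels.p₂h₁
  p₁h₂ := Idempotents.Karoubi.hom_ext _ _ altRels.p₁h₂
  h₁p₁h₁ := Idempotents.Karoubi.hom_ext _ _ (by
    rw [two_zsmul]; exact altRels.h₁p₁h₁.trans (two_zsmul _))
  h₂p₂h₂ := Idempotents.Karoubi.hom_ext _ _ (by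
    rw [two_zsmul]; exact altRels.h₂p₂h₂.trans (two_zsmul _))
  p₁h₁p₁ := Idempotents.Karoubi.hom_ext _ _ (by
    rw [two_zsmul]; exact altRels.p₁h₁p₁.trans (two_zsmul _))
  p₂h₂p₂ := Idempotents.Karoubi.hom_ext _ _ (by
    rw [two_zsmul]; exact altRels.p₂h₂p₂.trans (two_zsmul _))
  add_h := Idempotents.Karoubi.hom_ext _ _ altRels.add_h
  add_p := Idempotents.Karoubi.hom_ext _ _ altRels.add_p

/-- The functor from `𝐀ᵃ` to the idempotent completion of `CubicLin`. -/
noncomputable def fromAlt : AltCat ⥤ Idempotents.Karoubi CubicLin :=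
  AltCat.lift summand (Idempotents.Karoubi.hom_ext _ _ eps_one) altRelsK

instance : fromAlt.Additive := AltCat.lift_additive _ _ _

variable {X Y Z : CubicObj}

/-- The action of a morphism of `𝐀ᵃ` on the universal cross-effects. -/
noncomputable def theta :
    (AltCat.ob X ⟶ AltCat.ob Y) →+ (of (Fab.pow X.deg) ⟶ of (Fab.pow Y.deg)) where
  toFun f := (fromAlt.map f).f
  map_zero' := by rw [fromAlt.map_zero]; rfl
  map_add' f g := by rw [fromAlt.map_add]; rfl

lemma theta_id (X : CubicObj) : theta (𝟙 (AltCat.ob X)) = eps X.deg :=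
  congrArg Idempotents.Karoubi.Hom.f (fromAlt.map_id (AltCat.ob X))

lemma theta_comp (f : AltCat.ob X ⟶ AltCat.ob Y) (g : AltCat.ob Y ⟶ AltCat.ob Z) :
    theta (f ≫ g) = theta f ≫ theta g :=
  congrArg Idempotents.Karoubi.Hom.f (fromAlt.map_comp f g)

lemma eps_comp_theta (f : AltCat.ob X ⟶ AltCat.ob Y) : eps X.deg ≫ theta f = theta f := by
  rw [← theta_id, ← theta_comp, Category.id_comp]

lemma theta_comp_eps (f : AltCat.ob X ⟶ AltCat.ob Y) : theta f ≫ eps Y.deg = theta f := by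
  rw [← theta_id, ← theta_comp, Category.comp_id]

lemma theta_h₁ : theta AltCat.h₁ = diag 0 :=
  congrArg Idempotents.Karoubi.Hom.f (AltCat.lift_gen _ _ altRelsK CubicGen.h₁)

lemma theta_h₂ : theta AltCat.h₂ = diag 1 :=
  congrArg Idempotents.Karoubi.Hom.f (AltCat.lift_gen _ _ altRelsK CubicGen.h₂)

lemma theta_p₁ : theta AltCat.p₁ = codiag 0 :=
  congrArg Idempotents.Karoubi.Hom.f (AltCat.lift_gen _ _ altRelsK CubicGen.p₁)

lemma theta_p₂ : theta AltCat.p₂ = codiag 1 :=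
  congrArg Idempotents.Karoubi.Hom.f (AltCat.lift_gen _ _ altRelsK CubicGen.p₂)

lemma diag_comp_mem (k : Fin 2) : ∀ f ∈ (theta (X := .three) (Y := Y)).range,
    diag k ≫ f ∈ (theta (X := .two) (Y := Y)).range := by
  rintro _ ⟨f, rfl⟩
  fin_cases k
  · exact ⟨AltCat.h₁ ≫ f, by rw [theta_comp, theta_h₁]; rfl⟩
  · exact ⟨AltCat.h₂ ≫ f, by rw [theta_comp, theta_h₂]; rfl⟩

lemma codiag_comp_mem (k : Fin 2) : ∀ f ∈ (theta (X := .two) (Y := Y)).range,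
    codiag k ≫ f ∈ (theta (X := .three) (Y := Y)).range := by
  rintro _ ⟨f, rfl⟩
  fin_cases k
  · exact ⟨AltCat.p₁ ≫ f, by rw [theta_comp, theta_p₁]; rfl⟩
  · exact ⟨AltCat.p₂ ≫ f, by rw [theta_comp, theta_p₂]; rfl⟩

lemma proj_comm {m : ℕ} (A : Fin m → Fab) (S T : Finset (Fin m)) :
    Fab.proj A S ≫ Fab.proj A T = Fab.proj A T ≫ Fab.proj A S := by
  ext x
  funext j
  change (if j ∈ T then (if j ∈ S then x j else 0) else 0) =
    if j ∈ S then (if j ∈ T then x j else 0) else 0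
  split_ifs <;> rfl

lemma proj_comp_eps_three {S : Finset (Fin 3)} (hS : S ≠ Finset.univ) :
    cls (Fab.proj _ S) ≫ eps 3 = 0 := by
  rw [← eps_three_comp_proj hS]
  simp only [eps, Preadditive.sum_comp, Preadditive.comp_sum, Preadditive.zsmul_comp,
    Preadditive.comp_zsmul, ← cls_comp, proj_comm _ S]

lemma proj_basis_of_mem {m : ℕ} {S : Finset (Fin m)} {i : Fin m} (hi : i ∈ S) :
    (Fab.proj (fun _ : Fin m => Fab.Z) S).hom.hom (Fab.basis i) = Fab.basis i := by
  funext j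
  change (if j ∈ S then (if j = i then (1 : ℤ) else 0) else 0) = if j = i then (1 : ℤ) else 0
  split_ifs with h₁ h₂ h₂
  · rfl
  · rfl
  · exact absurd (h₂ ▸ hi) h₁
  · rfl

/-- Two basis vectors are fixed by the projection to a proper set of coordinates, and `eps 3` kills
that projection. -/
lemma duo_basis_comp_eps_three (i j : Fin 3) : duo (Fab.basis i) (Fab.basis j) ≫ eps 3 = 0 := by
  have hS : ({i, j} : Finset (Fin 3)) ≠ Finset.univ := by
    intro h
    have := congrArg Finset.card h
    rw [Finset.card_fin] at this
    have := Finset.card_le_two (a := i) (b := j)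
    omega
  have h := duo_comp (Fab.basis i) (Fab.basis j) (Fab.proj (fun _ => Fab.Z) {i, j})
  rw [proj_basis_of_mem (by simp), proj_basis_of_mem (by simp)] at h
  rw [← h, Category.assoc, proj_comp_eps_three hS, Limits.comp_zero]

lemma duo_basis_comp_eps_two {i j : Fin 2} (h : i < j) :
    duo (Fab.basis i) (Fab.basis j) ≫ eps 2 = eps 2 := by
  obtain rfl : i = 0 := by omega
  obtain rfl : j = 1 := by omega
  rw [duo_basis, Category.id_comp]

lemma trio_basis_comp_eps_three {i j k : Fin 3} (h : i < j) (h' : j < k) :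
    trio (Fab.basis i) (Fab.basis j) (Fab.basis k) ≫ eps 3 = eps 3 := by
  obtain rfl : i = 0 := by omega
  obtain rfl : j = 1 := by omega
  obtain rfl : k = 2 := by omega
  rw [trio_basis, eps_three_idem]

/-- The generation lemmas, applied to the ranges of `theta` and to y = `eps Y.deg`. On increasing
basis symbols the composite with `eps` is either `eps` itself, the image of an identity, or zero. -/
lemma symbols_mem (Y : CubicObj) :
    (∀ a b, duo a b ≫ eps Y.deg ∈ (theta (X := .two) (Y := Y)).range) ∧
    (∀ a b c, trio a b c ≫ eps Y.deg ∈ (theta (X := .three) (Y := Y)).range) := by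
  have h₂ : ∀ i j, i < j → duo (Fab.basis i) (Fab.basis j) ≫ eps Y.deg ∈
      (theta (X := .two) (Y := Y)).range := by
    intro i j hij
    cases Y
    · exact absurd hij (by simp [Subsingleton.elim (α := Fin 1) i j])
    · exact ⟨𝟙 _, (theta_id _).trans (duo_basis_comp_eps_two hij).symm⟩
    · exact ⟨0, (map_zero _).trans (duo_basis_comp_eps_three i j).symm⟩
  have h₃ : ∀ i j k, i < j → j < k → trio (Fab.basis i) (Fab.basis j) (Fab.basis k) ≫ eps Y.deg ∈
      (theta (X := .three) (Y := Y)).range := by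
    intro i j k hij hjk
    cases Y
    · exact absurd hij (by simp [Subsingleton.elim (α := Fin 1) i j])
    · have : ∀ i j k : Fin 2, i < j → j < k → False := by decide
      exact (this i j k hij hjk).elim
    · exact ⟨𝟙 _, (theta_id _).trans (trio_basis_comp_eps_three hij hjk).symm⟩
  exact ⟨duo_mem diag_comp_mem codiag_comp_mem h₂ h₃, trio_mem diag_comp_mem codiag_comp_mem h₂ h₃⟩

lemma cls_eq_duo {B : Fab} (f : Fab.pow 2 ⟶ B) :
    cls f = duo (f.hom.hom (Fab.basis 0)) (f.hom.hom (Fab.basis 1)) := by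
  rw [← duo_comp, duo_basis, Category.id_comp]

lemma eps_comp_cls_eq_trio {B : Fab} (f : Fab.pow 3 ⟶ B) : eps 3 ≫ cls f =
    trio (f.hom.hom (Fab.basis 0)) (f.hom.hom (Fab.basis 1)) (f.hom.hom (Fab.basis 2)) := by
  rw [← trio_comp, trio_basis]

/-- A class of a homomorphism, compressed on the left by `eps`, is a `duo` or a `trio` of its values
at the basis, so `symbols_mem` applies. -/
theorem theta_full (y : of (Fab.pow X.deg) ⟶ of (Fab.pow Y.deg)) :
    ∃ f : AltCat.ob X ⟶ AltCat.ob Y, theta f = eps X.deg ≫ y ≫ eps Y.deg := by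
  induction y using hom_induction with
  | zero => exact ⟨0, by simp⟩
  | add f g hf hg =>
    obtain ⟨f', hf⟩ := hf
    obtain ⟨g', hg⟩ := hg
    exact ⟨f' + g', by simp only [map_add, hf, hg, Preadditive.add_comp, Preadditive.comp_add]⟩
  | neg f hf =>
    obtain ⟨f', hf⟩ := hf
    exact ⟨-f', by simp only [map_neg, hf, Preadditive.neg_comp, Preadditive.comp_neg]⟩
  | cls f =>
    cases X
    · refine ⟨0, ?_⟩
      rw [map_zero, show eps CubicObj.one.deg = 0 from eps_one, Limits.zero_comp]
    · obtain ⟨g, hg⟩ := (symbols_mem Y).1 _ _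
      refine ⟨g, hg.trans ?_⟩
      rw [← cls_eq_duo f, show eps CubicObj.two.deg = 𝟙 _ from eps_two, Category.id_comp]
      rfl
    · obtain ⟨g, hg⟩ := (symbols_mem Y).2 _ _ _
      refine ⟨g, hg.trans ?_⟩
      rw [← eps_comp_cls_eq_trio f]
      exact Category.assoc _ _ _

end CubicLin

/-! ### Vanishing of higher deviations of products of additive functions -/

lemma sum_powerset_alternating_eq_zero {m : ℕ} (p : Finset (Fin m) → ℤ) (l : Fin m)
    (hp : ∀ S, l ∉ S → p (insert l S) = p S) :
    ∑ S : Finset (Fin m), (-1 : ℤ) ^ (m - S.card) * p S = 0 := by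
  have key : ∀ S : Finset (Fin m), l ∉ S →
      (-1 : ℤ) ^ (m - S.card) * p S + (-1 : ℤ) ^ (m - (insert l S).card) * p (insert l S) = 0 := by
    intro S hS
    have h₁ : (insert l S).card ≤ m := (Finset.card_le_univ _).trans (Fintype.card_fin m).le
    rw [hp S hS]
    rw [Finset.card_insert_of_notMem hS] at h₁ ⊢
    obtain ⟨k, hk⟩ := Nat.exists_eq_add_of_le h₁
    rw [show m - S.card = k + 1 by omega, show m - (S.card + 1) = k by omega, pow_succ]
    ring
  refine Finset.sum_involution (fun S _ => if l ∈ S then S.erase l else insert l S) ?_ ?_ ?_ ?_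
  · intro S _
    by_cases hl : l ∈ S
    · simp only [hl, if_true]
      have h := key (S.erase l) (Finset.notMem_erase l S)
      rw [Finset.insert_erase hl] at h
      rw [add_comm, h]
    · simp only [hl, if_false]
      exact key S hl
  · intro S _ _ h
    by_cases hl : l ∈ S
    · simp only [hl, if_true] at h
      exact Finset.notMem_erase l S (h.symm ▸ hl)
    · simp only [hl, if_false] at h
      exact hl (h ▸ Finset.mem_insert_self l S)
  · exact fun _ _ => Finset.mem_univ _
  · intro S _
    by_cases hl : l ∈ S <;> simp [hl]

/-- Expand the product over maps κ from n to m indices. Each κ misses some l, and whether κ takes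
its values in S does not depend on l ∈ S, so the sets with and without l cancel. -/
lemma sum_alternating_prod_eq_zero {m n : ℕ} (h : n < m) (α : Fin n → Fin m → ℤ) :
    ∑ S : Finset (Fin m), (-1 : ℤ) ^ (m - S.card) * ∏ r, ∑ k ∈ S, α r k = 0 := by
  classical
  have expand : ∀ S : Finset (Fin m), ∏ r, ∑ k ∈ S, α r k =
      ∑ κ : Fin n → Fin m, if ∀ r, κ r ∈ S then ∏ r, α r (κ r) else 0 := by
    intro S
    rw [Finset.prod_univ_sum, ← Finset.sum_filter]
    refine Finset.sum_congr ?_ fun _ _ => rfl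
    ext κ
    simp [Fintype.mem_piFinset]
  simp only [expand, Finset.mul_sum]
  rw [Finset.sum_comm]
  refine Finset.sum_eq_zero fun κ _ => ?_
  obtain ⟨l, hl⟩ : ∃ l, ∀ r, κ r ≠ l := by
    by_contra! hκ
    have := Fintype.card_le_of_surjective κ hκ
    simp at this
    omega
  refine sum_powerset_alternating_eq_zero _ l fun S _ => ?_
  have : (∀ r, κ r ∈ insert l S) ↔ ∀ r, κ r ∈ S :=
    forall_congr' fun r => by simp [hl r]
  simp only [this]

/-! ### Functionals separating the normal forms: faithfulness -/

namespace CubicLin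

/-- An entry of the matrix of a homomorphism `ℤᵐ → ℤⁿ`. -/
def entry {m n : ℕ} (i : Fin m) (j : Fin n) : (Fab.pow m ⟶ Fab.pow n) →+ ℤ where
  toFun f := (f.hom.hom (Fab.basis i) : Fin n → ℤ) j
  map_zero' := rfl
  map_add' _ _ := rfl

lemma entry_factor {m n : ℕ} (u : Fab.pow m ⟶ Fab.Z) (v : Fab.Z ⟶ Fab.pow n) :
    ∃ (x : Fin m → ℤ) (y : Fin n → ℤ), ∀ i j, entry i j (u ≫ v) = x i * y j := by
  refine ⟨fun i => (u.hom.hom (Fab.basis i) : ℤ), fun j => (v.hom.hom (1 : ℤ) : Fin n → ℤ) j,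
    fun i j => ?_⟩
  have h : ∀ k : ℤ, (v.hom.hom k : Fin n → ℤ) = k • (v.hom.hom (1 : ℤ) : Fin n → ℤ) := by
    intro k
    refine Eq.trans ?_ (map_zsmul v.hom.hom k (1 : ℤ))
    exact congrArg v.hom.hom (by simp : k = k • (1 : ℤ))
  exact (congrFun (h _) j).trans rfl

/-- A coordinate of an element of `ℤⁿ`. -/
def coeff {n : ℕ} (j : Fin n) : (Fab.pow n).obj →+ ℤ where
  toFun a := (a : Fin n → ℤ) j
  map_zero' := rfl
  map_add' _ _ := rfl

lemma entry_desc {m n : ℕ} (i : Fin m) (j : Fin n) (b : Fin m → (Fab.pow n).obj) :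
    entry i j (Fab.desc b) = coeff j (b i) := by
  have h : Fab.powEval (Fab.desc b) (fun j => if j = i then 1 else 0) = b i := by
    rw [Fab.powEval_desc]
    simp
  exact congrFun h j

lemma sum_alternating_entries {m n : ℕ} {N : ℕ} (hN : 3 < N) (f : Fin N → (Fab.pow m ⟶ Fab.pow n))
    {d : ℕ} (hd : d ≤ 3) (α : Fin d → ((Fab.pow m ⟶ Fab.pow n) →+ ℤ)) :
    ∑ S : Finset (Fin N), (-1 : ℤ) ^ (N - S.card) • ∏ r, α r (∑ k ∈ S, f k) = 0 := by
  simp only [map_sum, smul_eq_mul]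
  exact sum_alternating_prod_eq_zero (by omega) _

section three

/-- The coefficient of a permutation of the arguments, up to the norm element. -/
def permFun (s : Equiv.Perm (Fin 3)) (f : Fab.pow 3 ⟶ Fab.pow 3) : ℤ :=
  ∏ r, entry r (s r) f - ∏ r, entry r (Fin.revPerm r) f

/-- On a rank one matrix (xᵢyⱼ) the product along any permutation is ∏ xᵢ ∏ yⱼ; subtracting the
product along the reversal makes the functional vanish there. A product of three additive functions
has no deviations of order above three. -/
lemma permFun_isCubic (s : Equiv.Perm (Fin 3)) : IsCubic (permFun s) where
  factor u v := by
    obtain ⟨x, y, h⟩ := entry_factor u v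
    simp only [permFun, h, Finset.prod_mul_distrib, Equiv.prod_comp, sub_self]
  cross N hN f := by
    simp only [permFun, smul_sub, Finset.sum_sub_distrib,
      sum_alternating_entries hN f le_rfl, sub_self]

lemma permFun_desc_eq_zero (s : Equiv.Perm (Fin 3)) {b : Fin 3 → (Fab.pow 3).obj} (r : Fin 3)
    (hr : b r = 0) : permFun s (Fab.desc b) = 0 := by
  have h : ∀ t : Fin 3 → Fin 3, ∏ r, entry r (t r) (Fab.desc b) = 0 := fun t =>
    Finset.prod_eq_zero (Finset.mem_univ r) (by rw [entry_desc, hr]; rfl)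
  rw [permFun, h, h, sub_zero]

lemma prod_entry_desc (t : Fin 3 → Fin 3) (i j k : Fin 3) :
    ∏ r, entry r (t r) (Fab.desc ![Fab.basis i, Fab.basis j, Fab.basis k]) =
      if t 0 = i ∧ t 1 = j ∧ t 2 = k then 1 else 0 := by
  refine (Fin.prod_univ_three _).trans ?_
  rw [entry_desc, entry_desc, entry_desc]
  change (if t 0 = i then (1 : ℤ) else 0) * (if t 1 = j then (1 : ℤ) else 0) *
    (if t 2 = k then (1 : ℤ) else 0) = _
  split_ifs <;> simp_all

lemma permFun_trio (s : Equiv.Perm (Fin 3)) (i j k : Fin 3) :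
    (permFun_isCubic s).eval (trio (Fab.basis i) (Fab.basis j) (Fab.basis k)) =
      (if s 0 = i ∧ s 1 = j ∧ s 2 = k then 1 else 0) - if 2 = i ∧ 1 = j ∧ 0 = k then 1 else 0 := by
  rw [trio_eq_desc]
  simp only [map_sub, IsCubic.eval_cls]
  rw [permFun_desc_eq_zero (b := ![_, _, 0]) s 2 rfl, permFun_desc_eq_zero (b := ![_, 0, _]) s 1 rfl,
    permFun_desc_eq_zero (b := ![0, _, _]) s 0 rfl, permFun, prod_entry_desc, prod_entry_desc]
  simp only [sub_zero]
  rfl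

/-- With 1 plus a transposition for each `codiag k ≫ diag k`, the five words expand into
permutations of the basis symbol. The reversal 210 does not occur among them, so the functionals
relative to the reversal read off the coefficients of the other five permutations. -/
lemma coefficients_three {a b c d e : ℤ} (h : a • eps 3 + b • (codiag 0 ≫ diag 0) +
    c • (codiag 1 ≫ diag 1) + d • (codiag 0 ≫ diag 0 ≫ codiag 1 ≫ diag 1) +
    e • (codiag 1 ≫ diag 1 ≫ codiag 0 ≫ diag 0) = 0) :
    a = 0 ∧ b = 0 ∧ c = 0 ∧ d = 0 ∧ e = 0 := by
  have key := congrArg (· ≫ trio (Fab.basis 0 : (Fab.pow 3).obj) (Fab.basis 1) (Fab.basis 2)) h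
  simp only [Preadditive.add_comp, Preadditive.zsmul_comp, Category.assoc, eps_comp_trio,
    codiag_diag_zero, codiag_diag_one, Preadditive.comp_add, Limits.zero_comp] at key
  have ev := fun s : Equiv.Perm (Fin 3) => congrArg (permFun_isCubic s).eval key
  simp only [map_add, map_zsmul, permFun_trio, map_zero] at ev
  have h₁ := ev 1
  have h₂ := ev (Equiv.swap 0 1)
  have h₃ := ev (Equiv.swap 1 2)
  have h₄ := ev (finRotate 3)
  have h₅ := ev (finRotate 3).symm
  simp [Equiv.swap_apply_def] at h₁ h₂ h₃ h₄ h₅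
  have h₅ := h₅ (by decide)
  omega

/-- The general form of an endomorphism of the object `3`. -/
noncomputable def combThree (a b c d e : ℤ) : AltCat.ob .three ⟶ AltCat.ob .three :=
  a • 𝟙 _ + b • (AltCat.p₁ ≫ AltCat.h₁) + c • (AltCat.p₂ ≫ AltCat.h₂) +
    d • (AltCat.p₁ ≫ AltCat.h₁ ≫ AltCat.p₂ ≫ AltCat.h₂) +
    e • (AltCat.p₂ ≫ AltCat.h₂ ≫ AltCat.p₁ ≫ AltCat.h₁)

lemma combThree_eq_zero {a b c d e : ℤ} (hf : theta (combThree a b c d e) = 0) :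
    a = 0 ∧ b = 0 ∧ c = 0 ∧ d = 0 ∧ e = 0 := by
  refine coefficients_three (Eq.trans ?_ hf)
  simp only [combThree, map_add, map_zsmul, theta_comp, theta_h₁, theta_h₂, theta_p₁, theta_p₂,
    theta_id]
  rfl

end three

section two

lemma det_isCubic : IsCubic fun f : Fab.pow 2 ⟶ Fab.pow 2 =>
    ∏ r, entry r r f - ∏ r, entry r (Fin.rev r) f where
  factor u v := by
    obtain ⟨x, y, h⟩ := entry_factor u v
    simp only [h, Finset.prod_mul_distrib]
    rw [show (∏ i : Fin 2, y i.rev) = ∏ i, y i from Equiv.prod_comp Fin.revPerm y, sub_self]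
  cross N hN f := by
    simp only [smul_sub, Finset.sum_sub_distrib,
      sum_alternating_entries hN f (by norm_num : 2 ≤ 3), sub_zero]

lemma det_duo (a b : (Fab.pow 2).obj) : det_isCubic.eval (duo a b) =
    coeff 0 a * coeff 1 b - coeff 1 a * coeff 0 b := by
  refine (IsCubic.eval_cls _ _).trans ?_
  refine (congrArg₂ (· - ·) (Fin.prod_univ_two _) (Fin.prod_univ_two _)).trans ?_
  rw [entry_desc, entry_desc, entry_desc, entry_desc]
  rfl

/-- The determinant is bilinear, so the correction term in the additivity of `duo` evaluates to
zero. -/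
lemma det_diag_trio (k : Fin 2) (a b c : (Fab.pow 2).obj) :
    det_isCubic.eval (diag k ≫ trio a b c) = 0 := by
  fin_cases k
  · have h := congrArg det_isCubic.eval (duo_add_left a b c)
    simp only [map_add, det_duo] at h
    exact left_eq_add.1 (Eq.trans (by ring) h)
  · have h := congrArg det_isCubic.eval (duo_add_right a b c)
    simp only [map_add, det_duo] at h
    exact left_eq_add.1 (Eq.trans (by ring) h)

/-- Twice the functional that detects the torsion morphism of `𝐀ᵃ`. -/
def torsionForm (f : Fab.pow 2 ⟶ Fab.pow 2) : ℤ :=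
  ∏ r, ![entry 0 0, entry 1 0, entry 0 0 - entry 1 0] r f +
    ∏ r, ![entry 0 1, entry 1 1, entry 0 1 - entry 1 1] r f +
    ∏ r, (![entry 0 0 + entry 0 1, entry 1 0 + entry 1 1,
      entry 0 0 + entry 0 1 - (entry 1 0 + entry 1 1)] :
        Fin 3 → (Fab.pow 2 ⟶ Fab.pow 2) →+ ℤ) r f

lemma torsionForm_eq (f : Fab.pow 2 ⟶ Fab.pow 2) : torsionForm f =
    entry 0 0 f * entry 1 0 f * (entry 0 0 f - entry 1 0 f) +
    entry 0 1 f * entry 1 1 f * (entry 0 1 f - entry 1 1 f) +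
    (entry 0 0 f + entry 0 1 f) * (entry 1 0 f + entry 1 1 f) *
      (entry 0 0 f + entry 0 1 f - (entry 1 0 f + entry 1 1 f)) := by
  simp [torsionForm, Fin.prod_univ_three]

lemma even_mul_mul_sub (x y : ℤ) : 2 ∣ x * y * (x - y) := by
  refine Even.two_dvd ?_
  by_cases hx : Even x <;> by_cases hy : Even y <;> simp [Int.even_sub, hx, hy]

lemma two_dvd_torsionForm (f : Fab.pow 2 ⟶ Fab.pow 2) : 2 ∣ torsionForm f := by
  rw [torsionForm_eq]
  exact dvd_add (dvd_add (even_mul_mul_sub _ _) (even_mul_mul_sub _ _)) (even_mul_mul_sub _ _)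

/-- The form xy(x − y)/2 is summed over the linear forms z₀, z₁, z₀ + z₁ on the target, the nonzero
ones modulo 2. On a rank one matrix (xᵢyⱼ) the sum is k(y₀³ + y₁³ + (y₀ + y₁)³) with 2k = x₀x₁(x₀ −
x₁), and the sum of the three cubes is even. Higher deviations are shown to vanish over ℤ, before
the division by 2. -/
lemma torsion_isCubic : IsCubic fun f : Fab.pow 2 ⟶ Fab.pow 2 =>
    ((torsionForm f / 2 : ℤ) : ZMod 2) where
  factor u v := by
    obtain ⟨x, y, h⟩ := entry_factor u v
    obtain ⟨k, hk⟩ := even_mul_mul_sub (x 0) (x 1)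
    obtain ⟨l, hl⟩ := even_mul_mul_sub (y 0) (y 1)
    refine (ZMod.intCast_zmod_eq_zero_iff_dvd _ _).2 ?_
    have : torsionForm (u ≫ v) = 2 * (2 * (k * (y 0 ^ 3 + y 1 ^ 3 + y 0 * y 1 ^ 2 * 3 + 3 * l))) := by
      rw [torsionForm_eq]
      simp only [h]
      linear_combination (y 0 ^ 3 + y 1 ^ 3 + (y 0 + y 1) ^ 3) * hk + 6 * k * hl
    rw [this, Int.mul_ediv_cancel_left _ two_ne_zero]
    exact Dvd.intro _ rfl
  cross N hN f := by
    have h : ∑ S : Finset (Fin N), (-1 : ℤ) ^ (N - S.card) * torsionForm (∑ k ∈ S, f k) = 0 := by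
      have h₁ := fun α => sum_alternating_entries hN f le_rfl α
      simp only [smul_eq_mul] at h₁
      simp only [torsionForm, mul_add, Finset.sum_add_distrib, h₁, add_zero]
    have h' : ∑ S : Finset (Fin N), (-1 : ℤ) ^ (N - S.card) * (torsionForm (∑ k ∈ S, f k) / 2) =
        0 := by
      refine mul_left_cancel₀ (two_ne_zero (α := ℤ)) ?_
      rw [mul_zero, ← h, Finset.mul_sum]
      refine Finset.sum_congr rfl fun S _ => ?_
      rw [mul_left_comm, Int.mul_ediv_cancel' (two_dvd_torsionForm _)]
    have := congrArg (Int.cast (R := ZMod 2)) h'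
    simpa only [zsmul_eq_mul, Int.cast_sum, Int.cast_mul, Int.cast_zero] using this

lemma torsion_duo {a b : (Fab.pow 2).obj} {n : ℤ} (h : 2 * n =
    coeff 0 a * coeff 0 b * (coeff 0 a - coeff 0 b) +
    coeff 1 a * coeff 1 b * (coeff 1 a - coeff 1 b) +
    (coeff 0 a + coeff 1 a) * (coeff 0 b + coeff 1 b) *
      (coeff 0 a + coeff 1 a - (coeff 0 b + coeff 1 b))) :
    torsion_isCubic.eval (duo a b) = (n : ZMod 2) := by
  refine (IsCubic.eval_cls _ _).trans ?_
  rw [torsionForm_eq, entry_desc, entry_desc, entry_desc, entry_desc]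
  have : ∀ m : ℤ, 2 * n = m → ((m / 2 : ℤ) : ZMod 2) = n := by
    rintro _ rfl
    rw [Int.mul_ediv_cancel_left _ two_ne_zero]
  exact this _ h

/-- The torsion endomorphism of the object `2`. -/
noncomputable def torsion : AltCat.ob .two ⟶ AltCat.ob .two :=
  AltCat.h₁ ≫ AltCat.p₁ - (2 : ℤ) • (AltCat.h₁ ≫ AltCat.p₂ ≫ AltCat.h₂ ≫ AltCat.p₁)

lemma torsion_eval : torsion_isCubic.eval (theta torsion) = 1 := by
  have h : theta torsion = diag 0 ≫ codiag 0 -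
      (2 : ℤ) • (diag 0 ≫ codiag 1 ≫ diag 1 ≫ codiag 0) := by
    simp only [torsion, map_sub, map_zsmul, theta_comp, theta_h₁, theta_h₂, theta_p₁, theta_p₂]
    rfl
  have h₂ : ∀ x : ZMod 2, (2 : ℤ) • x = 0 := by decide
  have h' := congrArg torsion_isCubic.eval h
  replace h' := h'.trans ((map_sub _ _ _).trans (congrArg _ ((map_zsmul _ _ _).trans (h₂ _))))
  rw [sub_zero] at h'
  -- With repeated first argument the correction term is h₁p₁ itself. Modulo 2 the doubled `duo`
  -- drops out, so the value sought is that of `duo` at 2b₀, b₁.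
  have hd := duo_add_left (Fab.basis 0 : (Fab.pow 2).obj) (Fab.basis 0) (Fab.basis 1)
  rw [← codiag_zero_comp_duo, duo_basis, Category.comp_id] at hd
  have hd := congrArg torsion_isCubic.eval hd
  rw [map_add, map_add, ← two_zsmul (torsion_isCubic.eval _), h₂, zero_add] at hd
  refine h'.trans (hd.symm.trans ?_)
  -- For the vectors (2, 0) and (0, 1) only the third form contributes, namely 2 · 1 · (2 − 1) = 2
  -- before halving.
  exact torsion_duo (n := 1) (by rfl)

lemma even_of_theta {t : ℤ} (h : theta (t • torsion) = 0) : 2 ∣ t := by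
  rw [map_zsmul] at h
  have h' := (map_zsmul torsion_isCubic.eval t (theta torsion)).symm.trans
    ((congrArg torsion_isCubic.eval h).trans (map_zero _))
  replace h' : t • (1 : ZMod 2) = 0 := (congrArg (t • ·) torsion_eval).symm.trans h'
  rw [zsmul_eq_mul, mul_one] at h'
  exact (ZMod.intCast_zmod_eq_zero_iff_dvd _ _).1 h'

lemma det_diag_comp (k : Fin 2) (y : of (Fab.pow 3) ⟶ of (Fab.pow 2)) :
    det_isCubic.eval (diag k ≫ y) = 0 := by
  induction y using hom_induction with
  | zero => rw [Limits.comp_zero, map_zero]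
  | add f g hf hg => rw [Preadditive.comp_add, map_add, hf, hg, add_zero]
  | neg f hf => rw [Preadditive.comp_neg, map_neg, hf, neg_zero]
  | cls f => rw [← diag_comp_eps, Category.assoc, eps_comp_cls_eq_trio, det_diag_trio]

/-- The determinant as a functional on the endomorphisms of the object `2`. -/
noncomputable def detHom : (AltCat.ob .two ⟶ AltCat.ob .two) →+ ℤ :=
  det_isCubic.eval.comp (theta (X := .two) (Y := .two))

lemma detHom_eq_zero {f : AltCat.ob .two ⟶ AltCat.ob .two} (hf : theta f = 0) : detHom f = 0 :=
  (congrArg det_isCubic.eval hf).trans (map_zero _)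

lemma detHom_h₁_comp (f : AltCat.ob .three ⟶ AltCat.ob .two) : detHom (AltCat.h₁ ≫ f) = 0 := by
  refine (congrArg det_isCubic.eval (theta_comp _ f)).trans ?_
  rw [theta_h₁]
  exact det_diag_comp 0 (theta f)

lemma detHom_h₂_comp (f : AltCat.ob .three ⟶ AltCat.ob .two) : detHom (AltCat.h₂ ≫ f) = 0 := by
  refine (congrArg det_isCubic.eval (theta_comp _ f)).trans ?_
  rw [theta_h₂]
  exact det_diag_comp 1 (theta f)

lemma detHom_id : detHom (𝟙 (AltCat.ob .two)) = 1 :=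
  (congrArg det_isCubic.eval ((theta_id .two).trans (eps_two.trans duo_basis.symm))).trans
    (det_duo _ _)

end two

open AltCat

/-- Sandwiching f between pᵢ and hⱼ leads to endomorphisms of 3, whose coefficients are known; this
gives a + d = a + e = b = c = 0. The determinant kills everything that factors through 3 and
isolates a. What is left is a multiple of the torsion element, detected modulo 2. -/
theorem theta_injective_two_two {f : ob .two ⟶ ob .two} (hf : theta f = 0) : f = 0 := by
  have r := AltCat.altRels
  obtain ⟨a, b, c, d, e, t, rfl⟩ := isComb f
  have comp_zero : ∀ (u : ob .three ⟶ ob .two) (v : ob .two ⟶ ob .three) g,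
      u ≫ (a • 𝟙 _ + b • (h₁ ≫ p₂) + c • (h₂ ≫ p₁) + d • (h₁ ≫ p₂ ≫ h₂ ≫ p₁) +
        e • (h₂ ≫ p₁ ≫ h₁ ≫ p₂) + t • (h₁ ≫ p₁ - (2 : ℤ) • (h₁ ≫ p₂ ≫ h₂ ≫ p₁))) ≫ v = g →
      theta g = 0 := by
    rintro u v _ rfl
    rw [theta_comp, theta_comp, hf, Limits.zero_comp, Limits.comp_zero]
  have h₁₁ := (combThree_eq_zero (comp_zero p₁ h₁ (combThree 0 (a + d) 0 0 0) (by
    simp only [combThree, Preadditive.add_comp, Preadditive.zsmul_comp, Preadditive.sub_comp,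
      Preadditive.comp_add, Preadditive.comp_zsmul, Preadditive.comp_sub, Category.assoc,
      Category.id_comp, r.p₂h₁, r.p₁h₂_assoc, r.p₁h₁p₁_assoc, r.braid₁,
      Limits.comp_zero]
    module))).2.1
  have h₂₂ := (combThree_eq_zero (comp_zero p₂ h₂ (combThree 0 0 (a + e) 0 0) (by
    simp only [combThree, Preadditive.add_comp, Preadditive.zsmul_comp, Preadditive.sub_comp,
      Preadditive.comp_add, Preadditive.comp_zsmul, Preadditive.comp_sub, Category.assoc,
      Category.id_comp, r.p₁h₂, r.p₂h₁_assoc, r.braid₂,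
      Limits.comp_zero]
    module))).2.2.1
  have h₁₂ := (combThree_eq_zero (comp_zero p₁ h₂ (combThree 0 0 0 b 0) (by
    simp only [combThree, Preadditive.add_comp, Preadditive.zsmul_comp, Preadditive.sub_comp,
      Preadditive.comp_add, Preadditive.comp_zsmul, Preadditive.comp_sub, Category.assoc,
      Category.id_comp, r.p₁h₂, r.p₁h₂_assoc, Limits.comp_zero]
    module))).2.2.2.1
  have h₂₁ := (combThree_eq_zero (comp_zero p₂ h₁ (combThree 0 0 0 0 c) (by
    simp only [combThree, Preadditive.add_comp, Preadditive.zsmul_comp, Preadditive.sub_comp,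
      Preadditive.comp_add, Preadditive.comp_zsmul, Preadditive.comp_sub, Category.assoc,
      Category.id_comp, r.p₂h₁, r.p₂h₁_assoc, Limits.comp_zero]
    module))).2.2.2.2
  subst h₁₂ h₂₁
  have ha : a = 0 := by
    have h := detHom_eq_zero hf
    simpa only [map_add, map_sub, map_zsmul, detHom_id, detHom_h₁_comp, detHom_h₂_comp, mul_zero,
      sub_zero, add_zero, smul_eq_mul, mul_one] using h
  obtain rfl : a = 0 := ha
  obtain rfl : d = 0 := by omega
  obtain rfl : e = 0 := by omega
  have ht : (0 : ℤ) • 𝟙 _ + (0 : ℤ) • (h₁ ≫ p₂) + (0 : ℤ) • (h₂ ≫ p₁) +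
      (0 : ℤ) • (h₁ ≫ p₂ ≫ h₂ ≫ p₁) + (0 : ℤ) • (h₂ ≫ p₁ ≫ h₁ ≫ p₂) +
      t • (h₁ ≫ p₁ - (2 : ℤ) • (h₁ ≫ p₂ ≫ h₂ ≫ p₁)) = t • torsion := by
    rw [torsion]
    module
  rw [ht] at hf ⊢
  obtain ⟨s, rfl⟩ := even_of_theta hf
  rw [mul_comm, mul_smul, torsion, r.two_theta, smul_zero]

theorem theta_injective_two_three {f : ob .two ⟶ ob .three} (hf : theta f = 0) : f = 0 := by
  have r := AltCat.altRels
  obtain ⟨a, b, c, d, t, rfl⟩ := isComb f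
  have comp_zero : ∀ (u : ob .three ⟶ ob .two) g,
      u ≫ (a • h₁ + b • h₂ + c • (h₁ ≫ p₂ ≫ h₂) + d • (h₂ ≫ p₁ ≫ h₁) +
        t • (h₁ - h₁ ≫ p₂ ≫ h₂ ≫ p₁ ≫ h₁)) = g → theta g = 0 := by
    rintro u _ rfl
    rw [theta_comp, hf, Limits.comp_zero]
  obtain ⟨-, rfl, -, rfl, -⟩ := combThree_eq_zero (comp_zero p₁ (combThree 0 a 0 c 0) (by
    simp only [combThree, Preadditive.comp_add, Preadditive.comp_zsmul, Preadditive.comp_sub,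
      r.p₁h₂, r.p₁h₂_assoc, r.braid₁]
    module))
  obtain ⟨-, -, rfl, -, rfl⟩ := combThree_eq_zero (comp_zero p₂ (combThree 0 0 b 0 d) (by
    simp only [combThree, Preadditive.comp_add, Preadditive.comp_zsmul, Preadditive.comp_sub,
      r.p₂h₁, r.p₂h₁_assoc]
    module))
  -- Composition with p₁ carries the torsion morphism h₁ − h₁p₂h₂p₁h₁ to `torsion`, which reduces
  -- the parity of t to the endomorphisms of 2.
  have ht : theta (t • torsion) = 0 := by
    have h := congrArg (· ≫ theta p₁) hf
    simp only [← theta_comp, Limits.zero_comp] at h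
    rw [← h]
    congr 1
    simp only [torsion, Preadditive.add_comp, Preadditive.zsmul_comp, Preadditive.sub_comp,
      Category.assoc, r.p₁h₁p₁, Preadditive.comp_zsmul]
    module
  obtain ⟨s, rfl⟩ := even_of_theta ht
  have h : (2 : ℤ) • (h₁ - h₁ ≫ p₂ ≫ h₂ ≫ p₁ ≫ h₁) = 0 := by
    rw [smul_sub, r.two_long_h, sub_self]
  rw [mul_comm, mul_smul, h]
  module

theorem theta_injective_three_two {f : ob .three ⟶ ob .two} (hf : theta f = 0) : f = 0 := by
  have r := AltCat.altRels
  obtain ⟨a, b, c, d, t, rfl⟩ := isComb f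
  have comp_zero : ∀ (u : ob .two ⟶ ob .three) g,
      (a • p₁ + b • p₂ + c • (p₁ ≫ h₁ ≫ p₂) + d • (p₂ ≫ h₂ ≫ p₁) +
        t • (p₁ - p₁ ≫ h₁ ≫ p₂ ≫ h₂ ≫ p₁)) ≫ u = g → theta g = 0 := by
    rintro u _ rfl
    rw [theta_comp, hf, Limits.zero_comp]
  obtain ⟨-, rfl, -, -, rfl⟩ := combThree_eq_zero (comp_zero h₁ (combThree 0 a 0 0 d) (by
    simp only [combThree, Preadditive.add_comp, Preadditive.zsmul_comp, Preadditive.sub_comp,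
      Category.assoc, r.p₂h₁, r.braid₁, Limits.comp_zero]
    module))
  obtain ⟨-, -, rfl, rfl, -⟩ := combThree_eq_zero (comp_zero h₂ (combThree 0 0 b c 0) (by
    simp only [combThree, Preadditive.add_comp, Preadditive.zsmul_comp, Preadditive.sub_comp,
      Category.assoc, r.p₁h₂, Limits.comp_zero]
    module))
  have ht : theta (t • torsion) = 0 := by
    have h := congrArg (theta h₁ ≫ ·) hf
    simp only [← theta_comp, Limits.comp_zero] at h
    rw [← h]
    congr 1
    simp only [torsion, Preadditive.comp_add, Preadditive.comp_zsmul, Preadditive.comp_sub,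
      r.h₁p₁h₁_assoc]
    module
  obtain ⟨s, rfl⟩ := even_of_theta ht
  have h : (2 : ℤ) • (p₁ - p₁ ≫ h₁ ≫ p₂ ≫ h₂ ≫ p₁) = 0 := by
    rw [smul_sub, r.two_long_p, sub_self]
  rw [mul_comm, mul_smul, h]
  module

theorem theta_injective {X Y : CubicObj} : Function.Injective (theta (X := X) (Y := Y)) := by
  refine (injective_iff_map_eq_zero _).2 fun f hf => ?_
  cases X
  · exact eq_zero_of_source_one f
  · cases Y
    · exact eq_zero_of_target_one f
    · exact theta_injective_two_two hf
    · exact theta_injective_two_three hf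
  · cases Y
    · exact eq_zero_of_target_one f
    · exact theta_injective_three_two hf
    · obtain ⟨a, b, c, d, e, rfl⟩ := isComb f
      obtain ⟨rfl, rfl, rfl, rfl, rfl⟩ := combThree_eq_zero hf
      module

end CubicLin

/-! ## Each object of `CubicLin` is generated by the cross-effect summands -/

namespace CubicLin

variable {A B C : Fab}

/-- The sums of morphisms that factor through one of the cross-effect summands. -/
noncomputable def summandIdeal (A B : Fab) : AddSubgroup (of A ⟶ of B) :=
  AddSubgroup.closure {φ | ∃ (X : CubicObj) (v : of A ⟶ of (Fab.pow X.deg))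
    (w : of (Fab.pow X.deg) ⟶ of B), φ = v ≫ eps X.deg ≫ w}

/-- A morphism that factors through `ℤ`. -/
def IsRankOne (f : A ⟶ B) : Prop := ∃ (v : A ⟶ Fab.Z) (w : Fab.Z ⟶ B), f = v ≫ w

lemma cls_add_mem {f g : A ⟶ B} (hf : IsRankOne f) (hg : IsRankOne g) :
    cls (f + g) ∈ summandIdeal A B := by
  obtain ⟨v, w, rfl⟩ := hf
  obtain ⟨v', w', rfl⟩ := hg
  refine AddSubgroup.subset_closure ⟨.two, cls (Fab.toSum A (B := fun _ : Fin 2 => Fab.Z) ![v, v']),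
    cls (Fab.fromSum B ![w, w']), ?_⟩
  change cls (v ≫ w + v' ≫ w') = cls (Fab.toSum A (B := fun _ : Fin 2 => Fab.Z) ![v, v']) ≫ eps 2 ≫
    cls (Fab.fromSum B ![w, w'])
  have h := Fab.toSum_proj_fromSum (fun _ : Fin 2 => Fab.Z) ![v, v'] ![w, w'] Finset.univ
  rw [proj_univ, Category.id_comp, Fin.sum_univ_two] at h
  rw [eps_two, Category.id_comp, ← cls_comp]
  exact congrArg cls h.symm

/-- The alternating sum over subsets factors through the summand of ℤ³. Its other nonzero terms are
sums of two rank one maps, covered by `cls_add_mem`. -/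
lemma cls_add_add_mem {f g h : A ⟶ B} (hf : IsRankOne f) (hg : IsRankOne g) (hh : IsRankOne h) :
    cls (f + g + h) ∈ summandIdeal A B := by
  have hfg := cls_add_mem hf hg
  have hfh := cls_add_mem hf hh
  have hgh := cls_add_mem hg hh
  obtain ⟨v, w, rfl⟩ := hf
  obtain ⟨v', w', rfl⟩ := hg
  obtain ⟨v'', w'', rfl⟩ := hh
  let p := Fab.toSum A (B := fun _ : Fin 3 => Fab.Z) ![v, v', v'']
  let q := Fab.fromSum (A := fun _ : Fin 3 => Fab.Z) B ![w, w', w'']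
  have hm : cls p ≫ eps 3 ≫ cls q ∈ summandIdeal A B :=
    AddSubgroup.subset_closure ⟨.three, cls p, cls q, rfl⟩
  have hu : (Finset.univ : Finset (Finset (Fin 3))) =
    {∅, {0}, {1}, {2}, {0, 1}, {0, 2}, {1, 2}, {0, 1, 2}} := by decide
  have key : cls p ≫ eps 3 ≫ cls q = ∑ S : Finset (Fin 3), (-1 : ℤ) ^ (3 - S.card) •
      cls (∑ k ∈ S, ![v ≫ w, v' ≫ w', v'' ≫ w''] k) := by
    rw [eps]
    simp only [Preadditive.sum_comp, Preadditive.comp_sum, Preadditive.zsmul_comp,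
      Preadditive.comp_zsmul]
    refine Finset.sum_congr rfl fun S _ => congrArg _ ?_
    rw [← cls_comp, ← cls_comp]
    refine congrArg cls ((Fab.toSum_proj_fromSum _ _ _ S).trans (Finset.sum_congr rfl fun k _ => ?_))
    fin_cases k <;> rfl
  rw [key, hu] at hm
  repeat rw [Finset.sum_insert (by decide)] at hm
  simp [← add_assoc, cls_zero, cls_factor_eq_zero] at hm
  have := add_mem (add_mem (add_mem hm hfg) hfh) hgh
  convert this using 1
  abel

/-- Induction on the length. From four summands on, `cls_sum_four` is applied with the sum of the
tail `r :: l` as fourth map; each term on its right side is the class of a shorter sum. -/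
lemma cls_list_sum_mem : ∀ l : List (A ⟶ B), (∀ f ∈ l, IsRankOne f) → cls l.sum ∈ summandIdeal A B
  | [], _ => by rw [List.sum_nil, cls_zero]; exact zero_mem _
  | [f], h => by
    obtain ⟨v, w, rfl⟩ := h f (by simp)
    rw [List.sum_singleton, cls_factor_eq_zero]
    exact zero_mem _
  | [f, g], h => by
    rw [List.sum_cons, List.sum_singleton]
    exact cls_add_mem (h f (by simp)) (h g (by simp))
  | [f, g, k], h => by
    rw [List.sum_cons, List.sum_cons, List.sum_singleton, ← add_assoc]
    exact cls_add_add_mem (h f (by simp)) (h g (by simp)) (h k (by simp))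
  | f :: g :: k :: r :: l, h => by
    have ih (l' : List (A ⟶ B)) (hl' : l'.length < l.length + 4)
        (hs : ∀ x ∈ l', x ∈ f :: g :: k :: r :: l) : cls l'.sum ∈ summandIdeal A B :=
      cls_list_sum_mem l' fun x hx => h x (hs x hx)
    have h₁ := ih [f, g, k] (by simp) (by simp)
    have h₂ := ih (f :: g :: r :: l) (by simp) (by simp; tauto)
    have h₃ := ih (f :: k :: r :: l) (by simp) (by simp; tauto)
    have h₄ := ih (g :: k :: r :: l) (by simp) (by simp; tauto)
    have h₅ := ih [f, g] (by simp) (by simp)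
    have h₆ := ih [f, k] (by simp) (by simp)
    have h₇ := ih (f :: r :: l) (by simp) (by simp; tauto)
    have h₈ := ih [g, k] (by simp) (by simp)
    have h₉ := ih (g :: r :: l) (by simp) (by simp; tauto)
    have h₁₀ := ih (k :: r :: l) (by simp) (by simp; tauto)
    have h₁₁ := ih [f] (by simp) (by simp)
    have h₁₂ := ih [g] (by simp) (by simp)
    have h₁₃ := ih [k] (by simp) (by simp)
    have h₁₄ := ih (r :: l) (by simp) (by simp; tauto)
    rw [List.sum_cons, List.sum_cons, List.sum_cons, ← add_assoc, ← add_assoc, cls_sum_four]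
    simp only [List.sum_cons (a := f), List.sum_cons (a := g), List.sum_cons (a := k), List.sum_nil,
      add_zero, ← add_assoc] at h₁ h₂ h₃ h₄ h₅ h₆ h₇ h₈ h₉ h₁₀ h₁₁ h₁₂ h₁₃
    exact add_mem (add_mem (add_mem (add_mem (sub_mem (sub_mem (sub_mem (sub_mem (sub_mem (sub_mem
      (add_mem (add_mem (add_mem h₁ h₂) h₃) h₄) h₅) h₆) h₇) h₈) h₉) h₁₀) h₁₁) h₁₂) h₁₃) h₁₄
termination_by l => l.length

/-- A basis writes the identity as a sum of maps through ℤ. This is the sense in which the summands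
generate `CubicLin`. -/
lemma id_mem_summandIdeal (B : Fab) : 𝟙 (of B) ∈ summandIdeal B B := by
  have := B.property.1
  have := B.property.2
  let b := Module.Free.chooseBasis ℤ B.obj
  let c (i) : B ⟶ Fab.Z := ObjectProperty.homMk (AddCommGrpCat.ofHom (b.coord i).toAddMonoidHom)
  have h : 𝟙 B = (Finset.univ.toList.map fun i => c i ≫ Fab.ofElt (b i)).sum := by
    rw [Finset.sum_map_toList]
    ext x
    rw [Fab.sum_hom_apply]
    exact (b.sum_repr x).symm
  rw [← cls_id, h]
  refine cls_list_sum_mem _ fun f hf => ?_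
  obtain ⟨i, -, rfl⟩ := List.mem_map.1 hf
  exact ⟨_, _, rfl⟩

end CubicLin

/-! ## The module of cross-effects -/

section cross

variable (F : Fab ⥤ AddCommGrpCat.{u}) {m : ℕ} (A : Fin m → Fab)

lemma crossProj_comp_crossIncl : crossProj F A ≫ crossIncl F A = crossIdem F A := rfl

lemma crossIncl_ext {D : AddCommGrpCat.{u}} {f g : D ⟶ crossEffect F A}
    (h : f ≫ crossIncl F A = g ≫ crossIncl F A) : f = g := by
  ext x
  exact Subtype.ext (ConcreteCategory.congr_hom h x)

lemma crossProj_ext {D : AddCommGrpCat.{u}} {f g : crossEffect F A ⟶ D}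
    (h : crossProj F A ≫ f = crossProj F A ≫ g) : f = g := by
  ext ⟨_, x, rfl⟩
  exact ConcreteCategory.congr_hom h x

variable {G : Fab ⥤ AddCommGrpCat.{u}} (η : F ⟶ G)

/-- The map of cross-effects that is induced by a natural transformation. -/
def crossEffectMap : crossEffect F A ⟶ crossEffect G A := (crossEffectFunctor A).map η

lemma crossEffectMap_comp_crossIncl :
    crossEffectMap F A η ≫ crossIncl G A = crossIncl F A ≫ η.app _ := rfl

end cross

/-- The functor on `𝐀ᵃ` with a given action on the morphisms between its objects `1, 2, 3`. -/
noncomputable def AltCat.mkFunctor {D : Type*} [Category* D] [Preadditive D] (o : CubicObj → D)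
    (φ : ∀ X Y, (AltCat.ob X ⟶ AltCat.ob Y) →+ (o X ⟶ o Y)) (id : ∀ X, φ X X (𝟙 _) = 𝟙 _)
    (comp : ∀ X Y Z f g, φ X Z (f ≫ g) = φ X Y f ≫ φ Y Z g) : AltCat ⥤+ D where
  obj :=
    { obj := fun X => o X.as.as
      map := fun {X Y} f => φ X.as.as Y.as.as f
      map_id := fun X => id X.as.as
      map_comp := fun f g => comp _ _ _ f g }
  property :=
    { map_add := fun {X Y f g} => map_add (φ X.as.as Y.as.as) f g }

namespace IsWeaklyAlternativeCubic

variable {F G : Fab ⥤ AddCommGrpCat.{u}} (hF : IsWeaklyAlternativeCubic F)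
  (hG : IsWeaklyAlternativeCubic G) {X Y Z : CubicObj}

open CubicLin

lemma mapHom_eps (m : ℕ) : hF.mapHom (eps m) = crossIdem F (fun _ : Fin m => Fab.Z) := by
  simp only [eps, map_sum, map_zsmul, mapHom_cls]
  rfl

/-- The `m`-th cross-effect of `F`, where `m` is an object of `𝐀ᵃ`. -/
abbrev cross (F : Fab ⥤ AddCommGrpCat.{u}) (X : CubicObj) : AddCommGrpCat.{u} :=
  crossEffect F (fun _ : Fin X.deg => Fab.Z)

/-- The embedding of a cross-effect. -/
abbrev incl (F : Fab ⥤ AddCommGrpCat.{u}) (X : CubicObj) : cross F X ⟶ F.obj (Fab.pow X.deg) :=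
  crossIncl F _

/-- The projection onto a cross-effect. -/
abbrev prj (F : Fab ⥤ AddCommGrpCat.{u}) (X : CubicObj) : F.obj (Fab.pow X.deg) ⟶ cross F X :=
  crossProj F _

lemma prj_comp_incl (X : CubicObj) : prj F X ≫ incl F X = hF.mapHom (eps X.deg) :=
  (hF.mapHom_eps _).symm

lemma mapHom_eps_comp_prj (X : CubicObj) : hF.mapHom (eps X.deg) ≫ prj F X = prj F X := by
  apply crossIncl_ext
  rw [Category.assoc, prj_comp_incl hF, ← mapHom_comp, eps_deg_idem]

include hF in
lemma incl_comp_prj (X : CubicObj) : incl F X ≫ prj F X = 𝟙 _ := by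
  apply crossProj_ext
  rw [← Category.assoc, prj_comp_incl hF, mapHom_eps_comp_prj, Category.comp_id]

lemma incl_comp_mapHom_eps (X : CubicObj) : incl F X ≫ hF.mapHom (eps X.deg) = incl F X := by
  rw [← prj_comp_incl, ← Category.assoc, incl_comp_prj hF, Category.id_comp]

/-- The action of a morphism of `𝐀ᵃ` on the cross-effects of `F`. -/
noncomputable def crossMap (X Y : CubicObj) :
    (AltCat.ob X ⟶ AltCat.ob Y) →+ (cross F X ⟶ cross F Y) where
  toFun f := incl F X ≫ hF.mapHom (theta f) ≫ prj F Y
  map_zero' := by simp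
  map_add' f g := by simp

lemma prj_comp_crossMap (f : AltCat.ob X ⟶ AltCat.ob Y) :
    prj F X ≫ hF.crossMap X Y f = hF.mapHom (theta f) ≫ prj F Y := by
  change prj F X ≫ incl F X ≫ hF.mapHom (theta f) ≫ prj F Y = _
  rw [← Category.assoc, prj_comp_incl hF, ← Category.assoc, ← mapHom_comp, eps_comp_theta]

lemma crossMap_comp_incl (f : AltCat.ob X ⟶ AltCat.ob Y) :
    hF.crossMap X Y f ≫ incl F Y = incl F X ≫ hF.mapHom (theta f) := by
  change (incl F X ≫ hF.mapHom (theta f) ≫ prj F Y) ≫ incl F Y = _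
  rw [Category.assoc, Category.assoc, prj_comp_incl hF, ← mapHom_comp, theta_comp_eps]

lemma crossMap_id (X : CubicObj) : hF.crossMap X X (𝟙 _) = 𝟙 _ := by
  change incl F X ≫ hF.mapHom (theta (𝟙 _)) ≫ prj F X = _
  rw [theta_id, mapHom_eps_comp_prj, incl_comp_prj hF]

lemma crossMap_comp (X Y Z : CubicObj) (f : AltCat.ob X ⟶ AltCat.ob Y)
    (g : AltCat.ob Y ⟶ AltCat.ob Z) :
    hF.crossMap X Z (f ≫ g) = hF.crossMap X Y f ≫ hF.crossMap Y Z g := by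
  apply crossIncl_ext
  rw [crossMap_comp_incl hF, Category.assoc, crossMap_comp_incl hF, ← Category.assoc,
    crossMap_comp_incl hF, theta_comp, mapHom_comp, Category.assoc]

/-- The `𝐀ᵃ`-module of cross-effects of `F`. -/
noncomputable def toModule : AltCat ⥤+ AddCommGrpCat.{u} :=
  AltCat.mkFunctor (cross F) hF.crossMap hF.crossMap_id hF.crossMap_comp

lemma crossMap_naturality (η : F ⟶ G) (f : AltCat.ob X ⟶ AltCat.ob Y) :
    hF.crossMap X Y f ≫ crossEffectMap F _ η = crossEffectMap F _ η ≫ hG.crossMap X Y f := by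
  apply crossIncl_ext
  rw [Category.assoc, crossEffectMap_comp_crossIncl, Category.assoc, crossMap_comp_incl hG,
    ← Category.assoc, crossMap_comp_incl hF, Category.assoc, mapHom_naturality hF hG,
    ← Category.assoc, ← Category.assoc, crossEffectMap_comp_crossIncl]

/-- The morphism of modules of cross-effects that is induced by a natural transformation. -/
noncomputable def toModuleMap (η : F ⟶ G) : hF.toModule ⟶ hG.toModule :=
  ObjectProperty.homMk
    { app := fun X => crossEffectMap F (fun _ : Fin X.as.as.deg => Fab.Z) η
      naturality := fun X Y f => crossMap_naturality hF hG (X := X.as.as) (Y := Y.as.as) η f }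

section generators

lemma crossMap_eq (f : AltCat.ob X ⟶ AltCat.ob Y) {a : Fab.pow X.deg ⟶ Fab.pow Y.deg}
    (h : theta f = eps X.deg ≫ cls a ≫ eps Y.deg) :
    hF.crossMap X Y f = incl F X ≫ F.map a ≫ prj F Y := by
  change incl F X ≫ hF.mapHom (theta f) ≫ prj F Y = _
  rw [h, mapHom_comp, mapHom_comp, mapHom_cls, Category.assoc, Category.assoc,
    mapHom_eps_comp_prj, ← Category.assoc, incl_comp_mapHom_eps]

include hF in
lemma incl_one_eq_zero : incl F .one = 0 := by
  rw [← incl_comp_mapHom_eps hF .one]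
  refine (congrArg (incl F .one ≫ hF.mapHom ·) eps_one).trans ?_
  exact (congrArg (incl F .one ≫ ·) (_root_.map_zero _)).trans Limits.comp_zero

include hF in
lemma prj_one_eq_zero : prj F .one = 0 := by
  rw [← mapHom_eps_comp_prj hF .one]
  refine (congrArg (hF.mapHom · ≫ prj F .one) eps_one).trans ?_
  exact (congrArg (· ≫ prj F .one) (_root_.map_zero _)).trans Limits.zero_comp

/-- For h and p both sides vanish because `eps 1 = 0`; the other generators were sent by `theta` to
the corresponding diagonals and codiagonals. -/
lemma crossMap_gen (g : X ⟶ Y) : hF.crossMap X Y (AltCat.gen g) = crossGen F g := by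
  change CubicGen X Y at g
  cases g
  · rw [AltCat.eq_zero_of_source_one (AltCat.gen CubicGen.h), _root_.map_zero]
    refine Eq.trans ?_ (congrArg (· ≫ F.map (Fab.diag 0) ≫ prj F .two) hF.incl_one_eq_zero).symm
    exact Limits.zero_comp.symm
  · rw [AltCat.eq_zero_of_target_one (AltCat.gen CubicGen.p), _root_.map_zero]
    refine Eq.trans ?_
      (congrArg (incl F .two ≫ F.map (Fab.codiag 0) ≫ ·) hF.prj_one_eq_zero).symm
    exact ((congrArg (incl F .two ≫ ·) Limits.comp_zero).trans Limits.comp_zero).symm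
  · refine hF.crossMap_eq AltCat.h₁ (a := Fab.diag (0 : Fin 2)) (theta_h₁.trans ?_)
    change _ = eps 2 ≫ _ ≫ eps 3
    rw [eps_two, Category.id_comp]
    rfl
  · refine hF.crossMap_eq AltCat.h₂ (a := Fab.diag (1 : Fin 2)) (theta_h₂.trans ?_)
    change _ = eps 2 ≫ _ ≫ eps 3
    rw [eps_two, Category.id_comp]
    rfl
  · refine hF.crossMap_eq AltCat.p₁ (a := Fab.codiag (0 : Fin 2)) (theta_p₁.trans ?_)
    change _ = eps 3 ≫ _ ≫ eps 2
    rw [eps_two]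
    exact (congrArg (eps 3 ≫ ·) (Category.comp_id _)).symm
  · refine hF.crossMap_eq AltCat.p₂ (a := Fab.codiag (1 : Fin 2)) (theta_p₂.trans ?_)
    change _ = eps 3 ≫ _ ≫ eps 2
    rw [eps_two]
    exact (congrArg (eps 3 ≫ ·) (Category.comp_id _)).symm

end generators

end IsWeaklyAlternativeCubic

/-- The functor that sends a weakly alternative cubic functor to its module of cross-effects. -/
noncomputable def crossModule : WeaklyAlternativeCubic.{u} ⥤ (AltCat ⥤+ AddCommGrpCat.{u}) where
  obj F := F.property.toModule
  map {F G} η := F.property.toModuleMap G.property η.hom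
  map_id _ := rfl
  map_comp _ _ := rfl

instance : crossModule.{u}.Additive where
  map_add := rfl

/-! ## Cross-effects determine a weakly alternative cubic functor -/

namespace IsWeaklyAlternativeCubic

open CubicLin

variable {F G : Fab ⥤ AddCommGrpCat.{u}} (hF : IsWeaklyAlternativeCubic F)
  (hG : IsWeaklyAlternativeCubic G) {X Y : CubicObj} {A B C : Fab}

lemma mapHom_eps_comp_app (η : F ⟶ G) (X : CubicObj) :
    hF.mapHom (eps X.deg) ≫ η.app _ = prj F X ≫ crossEffectMap F _ η ≫ incl G X := by
  rw [crossEffectMap_comp_crossIncl, ← Category.assoc, prj_comp_incl hF]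

include hF hG in
-- Transformations that agree on cross-effects agree after F(y) for every y through a summand, hence
-- for sums of such y, and the identity is one of these.
lemma hom_ext {η η' : F ⟶ G} (h : ∀ X : CubicObj, crossEffectMap F (fun _ : Fin X.deg => Fab.Z) η =
    crossEffectMap F _ η') : η = η' := by
  ext1
  ext1 B
  have key : ∀ y ∈ summandIdeal B B, hF.mapHom y ≫ η.app B = hF.mapHom y ≫ η'.app B := by
    intro y hy
    induction hy using AddSubgroup.closure_induction with
    | mem y hy =>
      obtain ⟨X, v, w, rfl⟩ := hy
      simp only [mapHom_comp, Category.assoc, hF.mapHom_naturality hG]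
      rw [← Category.assoc (hF.mapHom (eps X.deg)), ← Category.assoc (hF.mapHom (eps X.deg)),
        mapHom_eps_comp_app, mapHom_eps_comp_app, h]
    | zero => simp
    | add y z _ _ hy hz => simp only [map_add, Preadditive.add_comp, hy, hz]
    | neg y _ hy => simp only [map_neg, Preadditive.neg_comp, hy]
  have h' := key _ (id_mem_summandIdeal B)
  rwa [mapHom_id, Category.id_comp, Category.id_comp] at h'

section extension

variable (t : ∀ X, cross F X ⟶ cross G X)

/-- The pairs `(y, τ)` of a morphism `y : A ⟶ B` and a map `τ : F(A) ⟶ G(B)` such that `τ` is the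
composite of `y` with the extension to all objects of a family `t` of maps between the
cross-effects. -/
noncomputable def transports (A B : Fab) : AddSubgroup ((of A ⟶ of B) × (F.obj A ⟶ G.obj B)) :=
  AddSubgroup.closure {q | ∃ (X : CubicObj) (v : of A ⟶ of (Fab.pow X.deg))
    (w : of (Fab.pow X.deg) ⟶ of B),
    q = (v ≫ eps X.deg ≫ w, hF.mapHom v ≫ prj F X ≫ t X ≫ incl G X ≫ hG.mapHom w)}

lemma exists_transport {y : of A ⟶ of B} (hy : y ∈ summandIdeal A B) :
    ∃ τ, (y, τ) ∈ transports hF hG t A B := by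
  induction hy using AddSubgroup.closure_induction with
  | mem y hy =>
    obtain ⟨X, v, w, rfl⟩ := hy
    exact ⟨_, AddSubgroup.subset_closure ⟨X, v, w, rfl⟩⟩
  | zero => exact ⟨0, zero_mem _⟩
  | add y z _ _ hy hz =>
    obtain ⟨σ, hσ⟩ := hy
    obtain ⟨τ, hτ⟩ := hz
    exact ⟨σ + τ, add_mem hσ hτ⟩
  | neg y _ hy =>
    obtain ⟨σ, hσ⟩ := hy
    exact ⟨-σ, neg_mem hσ⟩

lemma comp_mem_transports (y : of A ⟶ of B) {q : (of B ⟶ of C) × (F.obj B ⟶ G.obj C)}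
    (hq : q ∈ transports hF hG t B C) :
    (y ≫ q.1, hF.mapHom y ≫ q.2) ∈ transports hF hG t A C := by
  induction hq using AddSubgroup.closure_induction with
  | mem q hq =>
    obtain ⟨X, v, w, rfl⟩ := hq
    exact AddSubgroup.subset_closure ⟨X, y ≫ v, w, by simp only [mapHom_comp, Category.assoc]⟩
  | zero =>
    simp only [Prod.fst_zero, Prod.snd_zero, Limits.comp_zero]
    exact zero_mem _
  | add q r _ _ hq hr =>
    simp only [Prod.fst_add, Prod.snd_add, Preadditive.comp_add]
    exact add_mem hq hr
  | neg q _ hq =>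
    simp only [Prod.fst_neg, Prod.snd_neg, Preadditive.comp_neg]
    exact neg_mem hq

variable (ht : ∀ X Y (f : AltCat.ob X ⟶ AltCat.ob Y),
  hF.crossMap X Y f ≫ t Y = t X ≫ hG.crossMap X Y f)
include ht

/-- By fullness the compression of y to the summands is a morphism of 𝐀ᵃ, and t commutes with those.
-/
lemma transport_middle (y : of (Fab.pow X.deg) ⟶ of (Fab.pow Y.deg)) :
    hF.mapHom (eps X.deg) ≫ hF.mapHom y ≫ prj F Y ≫ t Y ≫ incl G Y =
      prj F X ≫ t X ≫ incl G X ≫ hG.mapHom y ≫ hG.mapHom (eps Y.deg) := by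
  obtain ⟨f, hf⟩ := theta_full y
  have h : hF.mapHom (theta f) ≫ prj F Y ≫ t Y ≫ incl G Y =
      prj F X ≫ t X ≫ incl G X ≫ hG.mapHom (theta f) := by
    rw [← Category.assoc, ← prj_comp_crossMap, Category.assoc, ← Category.assoc (hF.crossMap X Y f),
      ht, Category.assoc, crossMap_comp_incl]
  simp only [hf, mapHom_comp, Category.assoc] at h
  rw [← Category.assoc (hF.mapHom (eps Y.deg)), mapHom_eps_comp_prj,
    ← Category.assoc (incl G X), incl_comp_mapHom_eps] at h
  exact h

/-- Applied to two transports of an identity it shows that they agree; applied to a transport of an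
identity and one of y it gives naturality. -/
lemma transport_comm {q : (of A ⟶ of B) × (F.obj A ⟶ G.obj B)} (hq : q ∈ transports hF hG t A B)
    {r : (of B ⟶ of C) × (F.obj B ⟶ G.obj C)} (hr : r ∈ transports hF hG t B C) :
    hF.mapHom q.1 ≫ r.2 = q.2 ≫ hG.mapHom r.1 := by
  induction hq using AddSubgroup.closure_induction with
  | zero => simp
  | add q q' _ _ h h' =>
    simp only [Prod.fst_add, Prod.snd_add, map_add, Preadditive.add_comp, h, h']
  | neg q _ h => simp only [Prod.fst_neg, Prod.snd_neg, map_neg, Preadditive.neg_comp, h]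
  | mem q hq =>
    obtain ⟨X, v, w, rfl⟩ := hq
    induction hr using AddSubgroup.closure_induction with
    | zero => simp
    | add q q' _ _ h h' =>
      simp only [Prod.fst_add, Prod.snd_add, map_add, Preadditive.comp_add, h, h']
    | neg q _ h => simp only [Prod.fst_neg, Prod.snd_neg, map_neg, Preadditive.comp_neg, h]
    | mem r hr =>
      obtain ⟨Y, v', w', rfl⟩ := hr
      have h := transport_middle hF hG t ht (w ≫ v')
      have h' := congrArg (fun z => hF.mapHom v ≫ z ≫ hG.mapHom w') h
      simpa only [mapHom_comp, Category.assoc] using h'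

lemma exists_extension : ∃ η : F ⟶ G, ∀ X, crossEffectMap F (fun _ : Fin X.deg => Fab.Z) η = t X := by
  -- The component at B is a transport of the identity; by `transport_comm` the arbitrary choice is
  -- harmless.
  choose τ hτ using fun B => exists_transport hF hG t (id_mem_summandIdeal B)
  refine ⟨{ app := τ, naturality := fun A B y => ?_ }, fun X => ?_⟩
  · have h := transport_comm hF hG t ht (hτ A) (comp_mem_transports hF hG t (cls y) (hτ B))
    rw [mapHom_id, Category.id_comp, mapHom_cls, Category.comp_id, mapHom_cls] at h
    exact h
  · have hmem : (𝟙 (of (Fab.pow X.deg)) ≫ eps X.deg ≫ 𝟙 _, hF.mapHom (𝟙 _) ≫ prj F X ≫ t X ≫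
        incl G X ≫ hG.mapHom (𝟙 _)) ∈ transports hF hG t _ _ :=
      AddSubgroup.subset_closure ⟨X, 𝟙 _, 𝟙 _, rfl⟩
    have h := transport_comm hF hG t ht hmem (hτ _)
    simp only [mapHom_id, Category.comp_id, Category.id_comp] at h
    have h' : incl F X ≫ τ (Fab.pow X.deg) = t X ≫ incl G X := by
      rw [← incl_comp_mapHom_eps hF, Category.assoc, h, ← Category.assoc, incl_comp_prj hF,
        Category.id_comp]
    exact crossIncl_ext _ _ h'

end extension

end IsWeaklyAlternativeCubic

instance : crossModule.{u}.Faithful where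
  map_injective {F G η η'} h := by
    apply ObjectProperty.hom_ext
    refine F.property.hom_ext G.property fun X => ?_
    exact congrArg (fun t => t.hom.app (AltCat.ob X)) h

instance : crossModule.{u}.Full where
  map_surjective {F G} t := by
    obtain ⟨η, hη⟩ := F.property.exists_extension G.property (fun X => t.hom.app (AltCat.ob X))
      (fun X Y f => t.hom.naturality f)
    refine ⟨ObjectProperty.homMk η, ?_⟩
    apply ObjectProperty.hom_ext
    ext1
    ext1 X
    exact hη X.as.as

/-! ## The weakly alternative cubic functor of a module -/

namespace CubicLin

variable {X Y Z : CubicObj}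

/-- The morphism of `𝐀ᵃ` given by the compression of a morphism to the cross-effect summands. -/
noncomputable def lower :
    (of (Fab.pow X.deg) ⟶ of (Fab.pow Y.deg)) →+ (AltCat.ob X ⟶ AltCat.ob Y) where
  toFun y := (theta_full y).choose
  map_zero' := theta_injective (by rw [(theta_full _).choose_spec]; simp)
  map_add' y z := theta_injective (by
    rw [map_add, (theta_full _).choose_spec, (theta_full _).choose_spec, (theta_full _).choose_spec]
    simp only [Preadditive.add_comp, Preadditive.comp_add])

lemma theta_lower (y : of (Fab.pow X.deg) ⟶ of (Fab.pow Y.deg)) :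
    theta (lower y) = eps X.deg ≫ y ≫ eps Y.deg := (theta_full y).choose_spec

lemma lower_eps (X : CubicObj) : lower (eps X.deg) = 𝟙 (AltCat.ob X) :=
  theta_injective (by rw [theta_lower, eps_deg_idem, eps_deg_idem, theta_id])

/-- Compression need not be multiplicative, since an `eps` is missing in the middle; it is so when
the second factor already lives between summands. -/
lemma lower_comp_theta (y : of (Fab.pow X.deg) ⟶ of (Fab.pow Y.deg))
    (f : AltCat.ob Y ⟶ AltCat.ob Z) : lower (y ≫ theta f) = lower y ≫ f :=
  theta_injective (by
    rw [theta_lower, theta_comp, theta_lower, Category.assoc, Category.assoc, Category.assoc,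
      theta_comp_eps, eps_comp_theta])

/-- The functor from finitely generated free abelian groups to `CubicLin`. -/
noncomputable def clsFunctor : Fab ⥤ CubicLin where
  obj := of
  map f := cls f
  map_id := cls_id
  map_comp := cls_comp

lemma isWeaklyAlternativeCubic (H : CubicLin ⥤ AddCommGrpCat.{u}) [H.Additive] :
    IsWeaklyAlternativeCubic (clsFunctor ⋙ H) where
  map_zero A B := (congrArg H.map cls_zero).trans (H.map_zero _ _)
  degree_le m hm A := by
    have h : crossIdem (clsFunctor ⋙ H) A = 0 := by
      refine Eq.trans ?_ ((congrArg H.map (sum_cls_proj hm A)).trans (H.map_zero _ _))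
      rw [H.map_sum]
      exact Finset.sum_congr rfl fun S _ => H.map_zsmul.symm
    refine ⟨?_⟩
    rintro ⟨_, x, rfl⟩ ⟨_, y, rfl⟩
    refine Subtype.ext ?_
    rw [h]
    rfl
  zero_at_Z := by
    have h : 𝟙 (H.obj (of Fab.Z)) = 0 := by
      rw [← H.map_id]
      exact (congrArg H.map cls_id_Z).trans (H.map_zero _ _)
    refine ⟨fun x y => ?_⟩
    exact (ConcreteCategory.congr_hom h x).trans (ConcreteCategory.congr_hom h y).symm

lemma mapHom_clsFunctor_comp (H : CubicLin ⥤ AddCommGrpCat.{u}) [H.Additive] {A B : Fab}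
    (y : of A ⟶ of B) : (isWeaklyAlternativeCubic H).mapHom y = H.map y := by
  induction y using hom_induction with
  | zero => rw [map_zero, H.map_zero]; rfl
  | add f g hf hg => rw [map_add, hf, hg, H.map_add]; rfl
  | neg f hf => rw [map_neg, hf, H.map_neg]; rfl
  | cls f => exact (isWeaklyAlternativeCubic H).mapHom_cls f

end CubicLin

namespace AltCat

open CubicLin

variable (M : AltCat ⥤+ AddCommGrpCat.{u})

/-- The natural families of additive maps from the morphisms into cross-effect summands to the
values of a module. -/
noncomputable def sections (B : CubicLin) :
    AddSubgroup (∀ X : CubicObj, (B ⟶ of (Fab.pow X.deg)) →+ M.obj.obj (ob X)) where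
  carrier := {t | ∀ (X Y : CubicObj) (f : ob X ⟶ ob Y) (z : B ⟶ of (Fab.pow X.deg)),
    t Y (z ≫ theta f) = M.obj.map f (t X z)}
  zero_mem' _ _ f _ := (map_zero (M.obj.map f).hom).symm
  add_mem' hs ht X Y f z :=
    (congrArg₂ (· + ·) (hs X Y f z) (ht X Y f z)).trans (map_add (M.obj.map f).hom _ _).symm
  neg_mem' hs X Y f z :=
    (congrArg (- ·) (hs X Y f z)).trans (map_neg (M.obj.map f).hom _).symm

/-- The functor of natural families of additive maps to the values of a module. -/
noncomputable def sectionsFunctor : CubicLin ⥤ AddCommGrpCat.{u} where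
  obj B := AddCommGrpCat.of (sections M B)
  map {B C} y := AddCommGrpCat.ofHom
    { toFun := fun t => ⟨fun X => (t.1 X).comp (Preadditive.leftComp _ y), fun X Y f z =>
        (congrArg (t.1 Y) (Category.assoc _ _ _).symm).trans (t.2 X Y f (y ≫ z))⟩
      map_zero' := rfl
      map_add' := fun _ _ => rfl }
  map_id B := by
    refine AddCommGrpCat.hom_ext (AddMonoidHom.ext fun t => Subtype.ext (funext fun X => AddMonoidHom.ext fun z => ?_))
    exact congrArg (t.1 X) (Category.id_comp z)
  map_comp x y := by
    refine AddCommGrpCat.hom_ext (AddMonoidHom.ext fun t => Subtype.ext (funext fun X => AddMonoidHom.ext fun z => ?_))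
    exact congrArg (t.1 X) (Category.assoc x y z)

instance : (sectionsFunctor M).Additive where
  map_add {B C x y} := by
    refine AddCommGrpCat.hom_ext (AddMonoidHom.ext fun t => Subtype.ext (funext fun X => AddMonoidHom.ext fun z => ?_))
    exact (congrArg (t.1 X) (Preadditive.add_comp _ _ _ x y z)).trans (map_add (t.1 X) _ _)

/-- The value of a family at the universal element of a cross-effect. -/
noncomputable def evalSection (X : CubicObj) :
    (sectionsFunctor M).obj (of (Fab.pow X.deg)) ⟶ M.obj.obj (ob X) :=
  AddCommGrpCat.ofHom
    { toFun := fun t => t.1 X (eps X.deg)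
      map_zero' := rfl
      map_add' := fun _ _ => rfl }

/-- The family given by an element of a module. -/
noncomputable def eltSection (X : CubicObj) :
    M.obj.obj (ob X) ⟶ (sectionsFunctor M).obj (of (Fab.pow X.deg)) :=
  AddCommGrpCat.ofHom
    { toFun := fun m => ⟨fun Y =>
        { toFun := fun z => M.obj.map (lower z) m
          map_zero' := by rw [map_zero, M.obj.map_zero]; rfl
          map_add' := fun y z => by rw [map_add, M.obj.map_add]; rfl }, fun Y Z f z => by
        change M.obj.map (lower (z ≫ theta f)) m = M.obj.map f (M.obj.map (lower z) m)
        rw [lower_comp_theta, M.obj.map_comp]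
        rfl⟩
      map_zero' := Subtype.ext (funext fun Y => AddMonoidHom.ext fun z =>
        map_zero (M.obj.map (lower z)).hom)
      map_add' := fun m n => Subtype.ext (funext fun Y => AddMonoidHom.ext fun z =>
        map_add (M.obj.map (lower z)).hom m n) }

lemma eltSection_comp_evalSection (X : CubicObj) : eltSection M X ≫ evalSection M X = 𝟙 _ := by
  ext m
  change M.obj.map (lower (eps X.deg)) m = m
  rw [lower_eps, M.obj.map_id]
  rfl

/-- Yoneda for a direct summand: naturality along `lower z` expresses a family on maps beginning
with `eps` through its value at `eps`. With `eltSection_comp_evalSection` it identifies the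
cross-effects of the coinduced functor with the module. -/
lemma evalSection_comp_eltSection (X : CubicObj) :
    evalSection M X ≫ eltSection M X = (sectionsFunctor M).map (eps X.deg) := by
  ext t
  refine Subtype.ext (funext fun Y => AddMonoidHom.ext fun z => ?_)
  change M.obj.map (lower z) (t.1 X (eps X.deg)) = t.1 Y (eps X.deg ≫ z)
  -- Since `theta` sends the identity to `eps`, naturality along the identity lets t absorb an `eps`
  -- on the right.
  have h := t.2 Y Y (𝟙 _) (eps X.deg ≫ z)
  rw [theta_id, M.obj.map_id, Category.assoc] at h
  rw [← t.2, theta_lower, ← Category.assoc, eps_deg_idem]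
  exact h

variable {X Y : CubicObj}

lemma map_theta_comp_evalSection (f : ob X ⟶ ob Y) :
    (sectionsFunctor M).map (theta f) ≫ evalSection M Y = evalSection M X ≫ M.obj.map f := by
  ext t
  change t.1 Y (theta f ≫ eps Y.deg) = M.obj.map f (t.1 X (eps X.deg))
  rw [theta_comp_eps, ← t.2, eps_comp_theta]

/-- The weakly alternative cubic functor of a module. -/
noncomputable def toFunctor : WeaklyAlternativeCubic.{u} :=
  ⟨clsFunctor ⋙ sectionsFunctor M, isWeaklyAlternativeCubic _⟩

lemma toFunctor_mapHom {A B : Fab} (y : of A ⟶ of B) :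
    (toFunctor M).property.mapHom y = (sectionsFunctor M).map y :=
  mapHom_clsFunctor_comp _ y

open IsWeaklyAlternativeCubic

/-- The cross-effects of the functor of a module are the values of the module. -/
noncomputable def crossIso (X : CubicObj) : cross (toFunctor M).obj X ≅ M.obj.obj (ob X) where
  hom := incl (toFunctor M).obj X ≫ evalSection M X
  inv := eltSection M X ≫ prj (toFunctor M).obj X
  hom_inv_id := by
    have h := (toFunctor M).property.incl_comp_mapHom_eps X
    rw [toFunctor_mapHom, ← evalSection_comp_eltSection] at h
    have h' := congrArg (· ≫ prj (toFunctor M).obj X) h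
    refine Eq.trans ?_ (h'.trans (incl_comp_prj (toFunctor M).property X))
    refine (Category.assoc _ _ _).trans (Eq.trans ?_ (Category.assoc _ _ _).symm)
    exact congrArg (incl (toFunctor M).obj X ≫ ·) (Category.assoc _ _ _).symm
  inv_hom_id := by
    have h := (toFunctor M).property.prj_comp_incl X
    rw [toFunctor_mapHom, ← evalSection_comp_eltSection] at h
    have h' := congrArg (fun y => eltSection M X ≫ y ≫ evalSection M X) h
    refine Eq.trans ?_ (h'.trans ?_)
    · refine (Category.assoc _ _ _).trans ?_
      exact congrArg (eltSection M X ≫ ·) (Category.assoc _ _ _).symm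
    · rw [Category.assoc, eltSection_comp_evalSection, Category.comp_id, eltSection_comp_evalSection]

lemma crossIso_hom_naturality (f : ob X ⟶ ob Y) :
    (toFunctor M).property.crossMap X Y f ≫ (crossIso M Y).hom =
      (crossIso M X).hom ≫ M.obj.map f := by
  have h := (toFunctor M).property.crossMap_comp_incl f
  rw [toFunctor_mapHom] at h
  have h' := congrArg (· ≫ evalSection M Y) h
  refine Eq.trans (Category.assoc _ _ _).symm (h'.trans ?_)
  refine (Category.assoc _ _ _).trans ?_
  exact (congrArg (incl _ X ≫ ·) (map_theta_comp_evalSection M f)).trans (Category.assoc _ _ _).symm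

end AltCat

instance : crossModule.{u}.EssSurj where
  mem_essImage M := ⟨AltCat.toFunctor M, ⟨ObjectProperty.isoMk _
    (NatIso.ofComponents (fun X => AltCat.crossIso M X.as.as) fun {X Y} f =>
      AltCat.crossIso_hom_naturality M (X := X.as.as) (Y := Y.as.as) f)⟩⟩

instance : crossModule.{u}.IsEquivalence where

theorem weaklyAlternativeCubic_equivalence :
    ∃ (E : WeaklyAlternativeCubic.{u} ≌ (AltCat ⥤+ AddCommGrpCat.{u}))
        (α : ∀ X : CubicObj,
          E.functor ⋙ AdditiveFunctor.forget AltCat (AddCommGrpCat.{u}) ⋙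
              (evaluation AltCat (AddCommGrpCat.{u})).obj (AltCat.ob X) ≅
            ObjectProperty.ι (fun F : Fab ⥤ AddCommGrpCat.{u} => IsWeaklyAlternativeCubic F) ⋙
              crossEffectFunctor (fun _ : Fin X.deg => Fab.Z)),
        E.functor.Additive ∧
        ∀ (F : WeaklyAlternativeCubic.{u}) (X Y : CubicObj) (g : X ⟶ Y),
          (E.functor.obj F).obj.map (AltCat.gen g) ≫ (α Y).hom.app F =
            (α X).hom.app F ≫ (crossGen F.obj g :) := by
  refine ⟨crossModule.asEquivalence, fun X => Iso.refl _, inferInstanceAs crossModule.Additive,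
    fun F X Y g => ?_⟩
  refine (Category.comp_id _).trans ((F.property.crossMap_gen g).trans ?_)
  exact (Category.id_comp _).symm

/-! ## Generators and relations for the ring `𝐂` -/

/-- The relations between the generators of `𝐂`. -/
structure RingCRels {R : Type*} [Ring R] (e x₁ x₂ ξ η : R) : Prop where
  e_e : e * e = e
  e_x₁ : e * x₁ = 0
  x₁_e : x₁ * e = 0
  e_x₂ : e * x₂ = 0
  x₂_e : x₂ * e = 0
  x₁_x₁ : x₁ * x₁ = (2 : ℤ) • x₁
  x₂_x₂ : x₂ * x₂ = (2 : ℤ) • x₂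
  x₁_x₂_x₁ : x₁ * (x₂ * x₁) = x₁
  x₂_x₁_x₂ : x₂ * (x₁ * x₂) = x₂
  e_ξ : e * ξ = ξ
  ξ_e : ξ * e = 0
  e_η : e * η = 0
  η_e : η * e = η
  ξ_x₁ : ξ * x₁ = 0
  ξ_x₂ : ξ * x₂ = 0
  x₁_η : x₁ * η = 0
  x₂_η : x₂ * η = 0
  η_ξ : η * ξ = 0
  two_ξ : (2 : ℤ) • ξ = 0
  two_η : (2 : ℤ) • η = 0

namespace RingC

/-- The linear combination of the standard elements of a ring with given coefficients. -/
def comb {R : Type*} [Ring R] (e x₁ x₂ ξ η : R) (n a α β γ δ x y t : ℤ) : R :=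
  n • e + a • (1 - e) + α • x₁ + β • x₂ + γ • (x₁ * x₂) + δ • (x₂ * x₁) + x • ξ + y • η +
    t • (ξ * η)

/-- The matrix with given coefficients with respect to the standard elements. -/
def combC₀ (a α β γ δ : ℤ) : C₀ :=
  -- The coefficients belong to 1, x₁, x₂, x₁x₂, x₂x₁, whose matrices are 1, (0,0;−1,2), (0,3;0,2),
  -- (0,0;0,1), (−3,6;−2,4); the last four have first component 0.
  ⟨(a, !![a - 3 * δ, 3 * β + 6 * δ; -α - 2 * δ, a + 2 * α + 2 * β + γ + 4 * δ]), by
    constructor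
    · exact (Int.modEq_zero_iff_dvd).2 ⟨β + 2 * δ, by simp; ring⟩
    · exact (Int.modEq_iff_dvd).2 ⟨-δ, by simp⟩⟩

lemma exists_combC₀ (c : C₀) : ∃ a α β γ δ, c = combC₀ a α β γ δ := by
  obtain ⟨⟨a, B⟩, h₁, h₂⟩ := c
  obtain ⟨k, hk⟩ := Int.modEq_zero_iff_dvd.1 h₁
  obtain ⟨l, hl⟩ := Int.modEq_iff_dvd.1 h₂
  simp only at hk hl
  -- The difference b₁₁ − a = 3l forces δ = −l; then b₂₁ gives α, b₁₂ = 3k gives β, and b₂₂ gives γ.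
  refine ⟨a, -B 1 0 + 2 * l, k + 2 * l,
    B 1 1 - a - 2 * (-B 1 0 + 2 * l) - 2 * (k + 2 * l) + 4 * l, -l, ?_⟩
  refine Subtype.ext (Prod.ext rfl ?_)
  ext i j
  fin_cases i <;> fin_cases j <;> simp [combC₀] <;> linarith

lemma combC₀_mul (a α β γ δ a' α' β' γ' δ' : ℤ) :
    combC₀ a α β γ δ * combC₀ a' α' β' γ' δ' = combC₀ (a * a')
      (a * α' + α * a' + 2 * α * α' + α * δ' + γ * α' + 2 * γ * δ')
      (a * β' + β * a' + 2 * β * β' + β * γ' + δ * β' + 2 * δ * γ')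
      (a * γ' + γ * a' + α * β' + 2 * α * γ' + 2 * γ * β' + γ * γ')
      (a * δ' + δ * a' + β * α' + 2 * β * δ' + 2 * δ * α' + δ * δ') := by
  refine Subtype.ext (Prod.ext rfl ?_)
  ext i j
  fin_cases i <;> fin_cases j <;> simp [combC₀] <;> ring

/-- The element of `𝐂` with given coefficients with respect to the standard elements. -/
def ofCoeff (n a α β γ δ x y t : ℤ) : RingC := ⟨n, combC₀ a α β γ δ, x, y, t⟩

lemma exists_ofCoeff (r : RingC) : ∃ n a α β γ δ x y t, r = ofCoeff n a α β γ δ x y t := by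
  obtain ⟨a, α, β, γ, δ, h⟩ := exists_combC₀ r.c
  obtain ⟨x, hx⟩ := ZMod.intCast_surjective r.x
  obtain ⟨y, hy⟩ := ZMod.intCast_surjective r.y
  obtain ⟨t, ht⟩ := ZMod.intCast_surjective r.t
  exact ⟨r.n, a, α, β, γ, δ, x, y, t, RingC.ext rfl h hx.symm hy.symm ht.symm⟩

lemma ofCoeff_mul (n a α β γ δ x y t n' a' α' β' γ' δ' x' y' t' : ℤ) :
    ofCoeff n a α β γ δ x y t * ofCoeff n' a' α' β' γ' δ' x' y' t' = ofCoeff (n * n') (a * a')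
      (a * α' + α * a' + 2 * α * α' + α * δ' + γ * α' + 2 * γ * δ')
      (a * β' + β * a' + 2 * β * β' + β * γ' + δ * β' + 2 * δ * γ')
      (a * γ' + γ * a' + α * β' + 2 * α * γ' + 2 * γ * β' + γ * γ')
      (a * δ' + δ * a' + β * α' + 2 * β * δ' + 2 * δ * α' + δ * δ')
      (n * x' + x * a') (a * y' + y * n') (n * t' + t * n' + x * y') := by
  refine RingC.ext rfl (combC₀_mul _ _ _ _ _ _ _ _ _ _) ?_ ?_ ?_
  all_goals
    simp only [ofCoeff, Int.cast_add, Int.cast_mul]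
    rfl

lemma ofCoeff_add (n a α β γ δ x y t n' a' α' β' γ' δ' x' y' t' : ℤ) :
    ofCoeff n a α β γ δ x y t + ofCoeff n' a' α' β' γ' δ' x' y' t' = ofCoeff (n + n') (a + a')
      (α + α') (β + β') (γ + γ') (δ + δ') (x + x') (y + y') (t + t') := by
  refine RingC.ext rfl ?_ (Int.cast_add _ _).symm (Int.cast_add _ _).symm (Int.cast_add _ _).symm
  refine Subtype.ext (Prod.ext rfl ?_)
  ext i j
  fin_cases i <;> fin_cases j <;> simp [ofCoeff, combC₀] <;> ring

lemma ofCoeff_zero : ofCoeff 0 0 0 0 0 0 0 0 0 = 0 := by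
  refine RingC.ext rfl (Subtype.ext (Prod.ext rfl ?_)) rfl rfl rfl
  ext i j
  fin_cases i <;> fin_cases j <;> rfl

lemma ofCoeff_one : ofCoeff 1 1 0 0 0 0 0 0 0 = 1 := by
  refine RingC.ext rfl (Subtype.ext (Prod.ext rfl ?_)) rfl rfl rfl
  ext i j
  fin_cases i <;> fin_cases j <;> rfl

lemma zsmul_ofCoeff (k n a α β γ δ x y t : ℤ) : k • ofCoeff n a α β γ δ x y t =
    ofCoeff (k * n) (k * a) (k * α) (k * β) (k * γ) (k * δ) (k * x) (k * y) (k * t) := by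
  induction k using Int.induction_on with
  | zero => simp [ofCoeff_zero]
  | succ k ih => rw [add_smul, ih, one_smul, ofCoeff_add]; congr 1 <;> ring
  | pred k ih =>
    rw [sub_smul, ih, one_smul, sub_eq_iff_eq_add, ofCoeff_add]
    congr 1 <;> ring

/-- The idempotent `(1, 0, 0)`. -/
def e : RingC := ofCoeff 1 0 0 0 0 0 0 0 0

/-- The element of `𝐂₀` with the components `0` and `(0, 0; -1, 2)`. -/
def x₁ : RingC := ofCoeff 0 0 1 0 0 0 0 0 0

/-- The element of `𝐂₀` with the components `0` and `(0, 3; 0, 2)`. -/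
def x₂ : RingC := ofCoeff 0 0 0 1 0 0 0 0 0

/-- The element `ξ`. -/
def ξ : RingC := ofCoeff 0 0 0 0 0 0 1 0 0

/-- The element `η`. -/
def η : RingC := ofCoeff 0 0 0 0 0 0 0 1 0

lemma ofCoeff_eq_comb (n a α β γ δ x y t : ℤ) :
    ofCoeff n a α β γ δ x y t = comb e x₁ x₂ ξ η n a α β γ δ x y t := by
  have h : (1 - e : RingC) = ofCoeff 0 1 0 0 0 0 0 0 0 := by
    rw [sub_eq_iff_eq_add, ← ofCoeff_one, e, ofCoeff_add]
    norm_num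
  rw [comb, h]
  simp only [e, x₁, x₂, ξ, η, ofCoeff_mul, zsmul_ofCoeff, ofCoeff_add]
  norm_num

lemma ofCoeff_two_xi (x y t : ℤ) : ofCoeff 0 0 0 0 0 0 (2 * x) (2 * y) (2 * t) = 0 := by
  rw [← ofCoeff_zero]
  refine RingC.ext rfl rfl ?_ ?_ ?_ <;> exact (ZMod.intCast_zmod_eq_zero_iff_dvd _ 2).2 ⟨_, rfl⟩

lemma rels : RingCRels e x₁ x₂ ξ η := by
  constructor
  all_goals first
    | (simp only [e, x₁, x₂, ξ, η, ofCoeff_mul, zsmul_ofCoeff, ← ofCoeff_zero]; norm_num; done)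
    | exact (zsmul_ofCoeff _ _ _ _ _ _ _ _ _ _).trans (ofCoeff_two_xi _ _ _)

lemma ofCoeff_inj {n a α β γ δ x y t n' a' α' β' γ' δ' x' y' t' : ℤ}
    (h : ofCoeff n a α β γ δ x y t = ofCoeff n' a' α' β' γ' δ' x' y' t') :
    n = n' ∧ a = a' ∧ α = α' ∧ β = β' ∧ γ = γ' ∧ δ = δ' ∧ (x : ZMod 2) = x' ∧ (y : ZMod 2) = y' ∧
      (t : ZMod 2) = t' := by
  have hc : combC₀ a α β γ δ = combC₀ a' α' β' γ' δ' := congrArg RingC.c h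
  have ha : a = a' := congrArg (fun c : C₀ => c.1.1) hc
  have h₁₁ : a - 3 * δ = a' - 3 * δ' := congrArg (fun c : C₀ => c.1.2 0 0) hc
  have h₁₂ : 3 * β + 6 * δ = 3 * β' + 6 * δ' := congrArg (fun c : C₀ => c.1.2 0 1) hc
  have h₂₁ : -α - 2 * δ = -α' - 2 * δ' := congrArg (fun c : C₀ => c.1.2 1 0) hc
  have h₂₂ : a + 2 * α + 2 * β + γ + 4 * δ = a' + 2 * α' + 2 * β' + γ' + 4 * δ' :=
    congrArg (fun c : C₀ => c.1.2 1 1) hc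
  refine ⟨congrArg RingC.n h, ha, by omega, by omega, by omega, by omega, congrArg RingC.x h,
    congrArg RingC.y h, congrArg RingC.t h⟩

section lift

variable {R : Type*} [Ring R] {e x₁ x₂ ξ η : R} (h : RingCRels e x₁ x₂ ξ η)
include h

/-- The relations alone force the structure constants of `ofCoeff_mul`, so 𝐂 is presented by them
and `lift` is multiplicative. -/
lemma comb_mul (n a α β γ δ x y t n' a' α' β' γ' δ' x' y' t' : ℤ) :
    comb e x₁ x₂ ξ η n a α β γ δ x y t * comb e x₁ x₂ ξ η n' a' α' β' γ' δ' x' y' t' =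
      comb e x₁ x₂ ξ η (n * n') (a * a')
      (a * α' + α * a' + 2 * α * α' + α * δ' + γ * α' + 2 * γ * δ')
      (a * β' + β * a' + 2 * β * β' + β * γ' + δ * β' + 2 * δ * γ')
      (a * γ' + γ * a' + α * β' + 2 * α * γ' + 2 * γ * β' + γ * γ')
      (a * δ' + δ * a' + β * α' + 2 * β * δ' + 2 * δ * α' + δ * δ')
      (n * x' + x * a') (a * y' + y * n') (n * t' + t * n' + x * y') := by
  have assoc₀ {u v : R} (huv : u * v = 0) (w : R) : u * (v * w) = 0 := by
    rw [← mul_assoc, huv, zero_mul]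
  have assoc₁ {u v z : R} (huv : u * v = z) (w : R) : u * (v * w) = z * w := by
    rw [← mul_assoc, huv]
  -- The zero products not listed among the relations follow by inserting e through ξ = eξ and η =
  -- ηe.
  have xi_xi : ξ * ξ = 0 := by rw [← h.e_ξ, mul_assoc, assoc₀ h.ξ_e, mul_zero]
  have eta_eta : η * η = 0 := by rw [← h.η_e, mul_assoc, assoc₀ h.e_η, mul_zero]
  have x₁_xi : x₁ * ξ = 0 := by rw [← h.e_ξ, assoc₀ h.x₁_e]
  have x₂_xi : x₂ * ξ = 0 := by rw [← h.e_ξ, assoc₀ h.x₂_e]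
  have eta_x₁ : η * x₁ = 0 := by rw [← h.η_e, mul_assoc, h.e_x₁, mul_zero]
  have eta_x₂ : η * x₂ = 0 := by rw [← h.η_e, mul_assoc, h.e_x₂, mul_zero]
  simp only [comb, add_mul, mul_add, sub_mul, mul_sub, one_mul, mul_one, smul_mul_assoc,
    mul_smul_comm, mul_assoc, h.e_e, h.e_x₁, h.x₁_e, h.e_x₂, h.x₂_e, h.x₁_x₁, h.x₂_x₂,
    h.x₁_x₂_x₁, h.x₂_x₁_x₂, h.e_ξ, h.ξ_e, h.e_η, h.η_e, h.ξ_x₁, h.ξ_x₂, h.x₁_η, h.x₂_η, h.η_ξ,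
    assoc₀ h.e_x₁, assoc₀ h.e_x₂, assoc₁ h.x₁_x₁, assoc₁ h.x₂_x₂, assoc₁ h.e_ξ, assoc₀ h.ξ_x₁,
    assoc₀ h.ξ_x₂, assoc₀ h.η_ξ, xi_xi, eta_eta, x₁_xi, x₂_xi, eta_x₁,
    eta_x₂, assoc₀ xi_xi, assoc₀ x₁_xi, assoc₀ x₂_xi, assoc₀ eta_x₁, assoc₀ eta_x₂,
    mul_zero, smul_zero, add_zero, zero_add, sub_zero]
  module

omit h in
lemma zsmul_eq_of_two_smul {v : R} (hv : (2 : ℤ) • v = 0) {k l : ℤ} (hkl : (k : ZMod 2) = l) :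
    k • v = l • v := by
  obtain ⟨m, hm⟩ := (ZMod.intCast_eq_intCast_iff_dvd_sub k l 2).1 hkl
  have : l = k + m * 2 := by push_cast at hm; linarith
  rw [this, add_smul, mul_smul, hv, smul_zero, add_zero]

/-- The integers x, y, t are determined by r only modulo 2; since ξ, η and ξη are killed by 2, the
combination does not depend on their choice. -/
lemma exists_eq_comb (r : RingC) : ∃ z : R, ∀ n a α β γ δ x y t,
    r = ofCoeff n a α β γ δ x y t → z = comb e x₁ x₂ ξ η n a α β γ δ x y t := by
  obtain ⟨n, a, α, β, γ, δ, x, y, t, rfl⟩ := exists_ofCoeff r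
  refine ⟨comb e x₁ x₂ ξ η n a α β γ δ x y t, ?_⟩
  rintro n' a' α' β' γ' δ' x' y' t' hr
  obtain ⟨rfl, rfl, rfl, rfl, rfl, rfl, hx, hy, ht⟩ := ofCoeff_inj hr
  have h₂ : (2 : ℤ) • (ξ * η) = 0 := by rw [← smul_mul_assoc, h.two_ξ, zero_mul]
  rw [comb, comb, zsmul_eq_of_two_smul h.two_ξ hx, zsmul_eq_of_two_smul h.two_η hy,
    zsmul_eq_of_two_smul h₂ ht]

/-- The value of the homomorphism from `𝐂` that is given by elements with the relations of the
generators. -/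
noncomputable def liftFun (r : RingC) : R := (exists_eq_comb h r).choose

lemma liftFun_ofCoeff (n a α β γ δ x y t : ℤ) :
    liftFun h (ofCoeff n a α β γ δ x y t) = comb e x₁ x₂ ξ η n a α β γ δ x y t :=
  (exists_eq_comb h _).choose_spec _ _ _ _ _ _ _ _ _ rfl

/-- The homomorphism from `𝐂` that is given by elements with the relations of the generators. -/
noncomputable def lift : RingC →+* R where
  toFun := liftFun h
  map_one' := by
    rw [← ofCoeff_one, liftFun_ofCoeff, comb]
    module
  map_zero' := by
    rw [← ofCoeff_zero, liftFun_ofCoeff, comb]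
    module
  map_mul' r s := by
    obtain ⟨n, a, α, β, γ, δ, x, y, t, rfl⟩ := exists_ofCoeff r
    obtain ⟨n', a', α', β', γ', δ', x', y', t', rfl⟩ := exists_ofCoeff s
    rw [ofCoeff_mul, liftFun_ofCoeff, liftFun_ofCoeff, liftFun_ofCoeff, comb_mul h]
  map_add' r s := by
    obtain ⟨n, a, α, β, γ, δ, x, y, t, rfl⟩ := exists_ofCoeff r
    obtain ⟨n', a', α', β', γ', δ', x', y', t', rfl⟩ := exists_ofCoeff s
    rw [ofCoeff_add, liftFun_ofCoeff, liftFun_ofCoeff, liftFun_ofCoeff]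
    simp only [comb]
    module

lemma lift_e : lift h RingC.e = e := by
  refine (liftFun_ofCoeff h _ _ _ _ _ _ _ _ _).trans ?_
  simp [comb]

lemma lift_x₁ : lift h RingC.x₁ = x₁ := by
  refine (liftFun_ofCoeff h _ _ _ _ _ _ _ _ _).trans ?_
  simp [comb]

lemma lift_x₂ : lift h RingC.x₂ = x₂ := by
  refine (liftFun_ofCoeff h _ _ _ _ _ _ _ _ _).trans ?_
  simp [comb]

lemma lift_ξ : lift h RingC.ξ = ξ := by
  refine (liftFun_ofCoeff h _ _ _ _ _ _ _ _ _).trans ?_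
  simp [comb]

lemma lift_η : lift h RingC.η = η := by
  refine (liftFun_ofCoeff h _ _ _ _ _ _ _ _ _).trans ?_
  simp [comb]

end lift

lemma map_smul_of_generators {N N' : Type*} [AddCommGroup N] [Module RingC N] [AddCommGroup N']
    [Module RingC N'] (f : N →+ N') (he : ∀ m, f (e • m) = e • f m)
    (h₁ : ∀ m, f (x₁ • m) = x₁ • f m) (h₂ : ∀ m, f (x₂ • m) = x₂ • f m)
    (hξ : ∀ m, f (ξ • m) = ξ • f m) (hη : ∀ m, f (η • m) = η • f m) (r : RingC) (m : N) :
    f (r • m) = r • f m := by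
  obtain ⟨n, a, α, β, γ, δ, x, y, t, rfl⟩ := exists_ofCoeff r
  rw [ofCoeff_eq_comb]
  simp only [comb, add_smul, smul_assoc, sub_smul, one_smul, mul_smul, map_add, map_zsmul, map_sub,
    he, h₁, h₂, hξ, hη]

end RingC

/-! ## The `𝐀ᵃ`-module of a `𝐂`-module -/

namespace RingC

section groups

variable (N : Type u) [AddCommGroup N] [Module RingC N]

/-- The value at the object `2` of the `𝐀ᵃ`-module of a `𝐂`-module. -/
def groupTwo : AddSubgroup (N × N × N) where
  carrier := {m | e • m.1 = m.1 ∧ x₁ • x₂ • m.2.1 = m.2.1 ∧ x₂ • x₁ • m.2.2 = m.2.2}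
  zero_mem' := by simp
  add_mem' := by
    rintro m m' ⟨h, h₁, h₂⟩ ⟨h', h₁', h₂'⟩
    simp only [Set.mem_ofPred_eq, Prod.fst_add, Prod.snd_add, smul_add, h, h₁, h₂, h', h₁', h₂',
      and_self]
  neg_mem' := by
    rintro m ⟨h, h₁, h₂⟩
    simp only [Set.mem_ofPred_eq, Prod.fst_neg, Prod.snd_neg, smul_neg, h, h₁, h₂, and_self]

/-- The value at the object `3` of the `𝐀ᵃ`-module of a `𝐂`-module. -/
def groupThree : AddSubgroup N where
  carrier := {y | e • y = 0}
  zero_mem' := smul_zero _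
  add_mem' {y z} hy hz := by
    rw [Set.mem_ofPred_eq, smul_add, hy, hz, add_zero]
  neg_mem' {y} hy := by
    rw [Set.mem_ofPred_eq, smul_neg, hy, neg_zero]

variable {N}

lemma smul_smul_eq {a b c : RingC} (h : a * b = c) (m : N) : a • b • m = c • m := by
  rw [← mul_smul, h]

lemma smul_smul_eq_zero {a b : RingC} (h : a * b = 0) (m : N) : a • b • m = 0 := by
  rw [← mul_smul, h, zero_smul]

lemma groupTwo_ext {m m' : groupTwo N} (h : m.1.1 = m'.1.1) (h₁ : m.1.2.1 = m'.1.2.1)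
    (h₂ : m.1.2.2 = m'.1.2.2) : m = m' :=
  Subtype.ext (Prod.ext h (Prod.ext h₁ h₂))

variable (N) in
/-- The action of `h₁`. -/
def actH₁ : groupTwo N →+ groupThree N where
  toFun m := ⟨η • m.1.1 + m.1.2.1, by
    change e • _ = 0
    rw [← m.2.2.1, smul_add, smul_smul_eq_zero rels.e_η, smul_smul_eq_zero rels.e_x₁, add_zero]⟩
  map_zero' := Subtype.ext (by simp)
  map_add' m m' := Subtype.ext (by simp [add_add_add_comm])

variable (N) in
/-- The action of `h₂`. -/
def actH₂ : groupTwo N →+ groupThree N where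
  toFun m := ⟨η • m.1.1 + m.1.2.2, by
    change e • _ = 0
    rw [← m.2.2.2, smul_add, smul_smul_eq_zero rels.e_η, smul_smul_eq_zero rels.e_x₂, add_zero]⟩
  map_zero' := Subtype.ext (by simp)
  map_add' m m' := Subtype.ext (by simp [add_add_add_comm])

variable (N) in
/-- The action of `p₁`. -/
def actP₁ : groupThree N →+ groupTwo N where
  toFun y := ⟨(ξ • y.1, x₁ • y.1, 0), smul_smul_eq rels.e_ξ _, by
    rw [← mul_smul, ← mul_smul, mul_assoc, rels.x₁_x₂_x₁], by simp⟩
  map_zero' := Subtype.ext (by simp)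
  map_add' y z := Subtype.ext (by simp)

variable (N) in
/-- The action of `p₂`. -/
def actP₂ : groupThree N →+ groupTwo N where
  toFun y := ⟨(ξ • y.1, 0, x₂ • y.1), smul_smul_eq rels.e_ξ _, by simp, by
    rw [← mul_smul, ← mul_smul, mul_assoc, rels.x₂_x₁_x₂]⟩
  map_zero' := Subtype.ext (by simp)
  map_add' y z := Subtype.ext (by simp)

lemma two_smul_ξ (y : N) : (2 : ℤ) • ξ • y = 0 := by
  rw [← smul_assoc, rels.two_ξ, zero_smul]

lemma two_smul_η (y : N) : (2 : ℤ) • η • y = 0 := by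
  rw [← smul_assoc, rels.two_η, zero_smul]

lemma actH₁_actP₁ (y : groupThree N) : (actH₁ N (actP₁ N y)).1 = x₁ • y.1 := by
  change η • ξ • y.1 + x₁ • y.1 = _
  rw [smul_smul_eq_zero rels.η_ξ, zero_add]

lemma actH₂_actP₂ (y : groupThree N) : (actH₂ N (actP₂ N y)).1 = x₂ • y.1 := by
  change η • ξ • y.1 + x₂ • y.1 = _
  rw [smul_smul_eq_zero rels.η_ξ, zero_add]

lemma x₁_smul_actH₁ (m : groupTwo N) : x₁ • (actH₁ N m).1 = x₁ • m.1.2.1 := by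
  change x₁ • (η • m.1.1 + m.1.2.1) = _
  rw [smul_add, smul_smul_eq_zero rels.x₁_η, zero_add]

lemma x₂_smul_actH₁ (m : groupTwo N) : x₂ • (actH₁ N m).1 = x₂ • m.1.2.1 := by
  change x₂ • (η • m.1.1 + m.1.2.1) = _
  rw [smul_add, smul_smul_eq_zero rels.x₂_η, zero_add]

lemma x₁_smul_actH₂ (m : groupTwo N) : x₁ • (actH₂ N m).1 = x₁ • m.1.2.2 := by
  change x₁ • (η • m.1.1 + m.1.2.2) = _
  rw [smul_add, smul_smul_eq_zero rels.x₁_η, zero_add]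

lemma x₂_smul_actH₂ (m : groupTwo N) : x₂ • (actH₂ N m).1 = x₂ • m.1.2.2 := by
  change x₂ • (η • m.1.1 + m.1.2.2) = _
  rw [smul_add, smul_smul_eq_zero rels.x₂_η, zero_add]

variable (N) in
lemma actRels : AltRels (AddCommGrpCat.ofHom (actH₁ N)) (AddCommGrpCat.ofHom (actH₂ N))
    (AddCommGrpCat.ofHom (actP₁ N)) (AddCommGrpCat.ofHom (actP₂ N)) where
  p₂h₁ := by
    ext y
    change η • ξ • y.1 + 0 = 0
    rw [smul_smul_eq_zero rels.η_ξ, zero_add]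
  p₁h₂ := by
    ext y
    change η • ξ • y.1 + 0 = 0
    rw [smul_smul_eq_zero rels.η_ξ, zero_add]
  h₁p₁h₁ := by
    ext m
    change (actH₁ N (actP₁ N (actH₁ N m))).1 = (2 : ℤ) • (η • m.1.1 + m.1.2.1)
    rw [actH₁_actP₁, x₁_smul_actH₁, smul_add, two_smul_η, zero_add, ← m.2.2.1,
      smul_smul_eq rels.x₁_x₁, smul_assoc]
  h₂p₂h₂ := by
    ext m
    change (actH₂ N (actP₂ N (actH₂ N m))).1 = (2 : ℤ) • (η • m.1.1 + m.1.2.2)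
    rw [actH₂_actP₂, x₂_smul_actH₂, smul_add, two_smul_η, zero_add, ← m.2.2.2,
      smul_smul_eq rels.x₂_x₂, smul_assoc]
  p₁h₁p₁ := by
    refine AddCommGrpCat.hom_ext (AddMonoidHom.ext fun y => ?_)
    change actP₁ N (actH₁ N (actP₁ N y)) = (2 : ℤ) • actP₁ N y
    refine groupTwo_ext ?_ ?_ ?_
    · change ξ • (actH₁ N (actP₁ N y)).1 = (2 : ℤ) • ξ • y.1
      rw [actH₁_actP₁, two_smul_ξ, smul_smul_eq_zero rels.ξ_x₁]
    · change x₁ • (actH₁ N (actP₁ N y)).1 = (2 : ℤ) • x₁ • y.1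
      rw [actH₁_actP₁, smul_smul_eq rels.x₁_x₁, smul_assoc]
    · exact (smul_zero (2 : ℤ)).symm
  p₂h₂p₂ := by
    refine AddCommGrpCat.hom_ext (AddMonoidHom.ext fun y => ?_)
    change actP₂ N (actH₂ N (actP₂ N y)) = (2 : ℤ) • actP₂ N y
    refine groupTwo_ext ?_ ?_ ?_
    · change ξ • (actH₂ N (actP₂ N y)).1 = (2 : ℤ) • ξ • y.1
      rw [actH₂_actP₂, two_smul_ξ, smul_smul_eq_zero rels.ξ_x₂]
    · exact (smul_zero (2 : ℤ)).symm
    · change x₂ • (actH₂ N (actP₂ N y)).1 = (2 : ℤ) • x₂ • y.1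
      rw [actH₂_actP₂, smul_smul_eq rels.x₂_x₂, smul_assoc]
  -- The left side contains η twice, once from each hᵢ, and 2η = 0 removes it; the words on the
  -- right only see the other two components.
  add_h := by
    ext m
    change (η • m.1.1 + m.1.2.1) + (η • m.1.1 + m.1.2.2) =
      (actH₁ N (actP₁ N (actH₂ N (actP₂ N (actH₁ N m))))).1 +
      (actH₂ N (actP₂ N (actH₁ N (actP₁ N (actH₂ N m))))).1
    rw [actH₁_actP₁, actH₂_actP₂, actH₂_actP₂, actH₁_actP₁, x₂_smul_actH₁, x₁_smul_actH₂,
      m.2.2.1, m.2.2.2, add_add_add_comm, ← two_zsmul, two_smul_η, zero_add]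
  add_p := by
    refine AddCommGrpCat.hom_ext (AddMonoidHom.ext fun y => ?_)
    change actP₁ N y + actP₂ N y = actP₁ N (actH₂ N (actP₂ N (actH₁ N (actP₁ N y)))) +
      actP₂ N (actH₁ N (actP₁ N (actH₂ N (actP₂ N y))))
    refine groupTwo_ext ?_ ?_ ?_
    · change ξ • y.1 + ξ • y.1 = ξ • (actH₂ N (actP₂ N (actH₁ N (actP₁ N y)))).1 +
        ξ • (actH₁ N (actP₁ N (actH₂ N (actP₂ N y)))).1
      rw [actH₂_actP₂, actH₁_actP₁ (actH₂ N _), smul_smul_eq_zero rels.ξ_x₁,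
        smul_smul_eq_zero rels.ξ_x₂, ← two_zsmul, two_smul_ξ, add_zero]
    · change x₁ • y.1 + 0 = x₁ • (actH₂ N (actP₂ N (actH₁ N (actP₁ N y)))).1 + 0
      rw [actH₂_actP₂, actH₁_actP₁, ← mul_smul, ← mul_smul, mul_assoc, rels.x₁_x₂_x₁]
    · change 0 + x₂ • y.1 = 0 + x₂ • (actH₁ N (actP₁ N (actH₂ N (actP₂ N y)))).1
      rw [actH₁_actP₁, actH₂_actP₂, ← mul_smul, ← mul_smul, mul_assoc, rels.x₂_x₁_x₂]

end groups

end RingC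

namespace AltCat

section naturality

variable {D : Type*} [Category* D] [Preadditive D] {F G : AltCat ⥤ D} [F.Additive] [G.Additive]
  (t : ∀ X, F.obj (ob X) ⟶ G.obj (ob X))
  (ht₁ : F.map h₁ ≫ t .three = t .two ≫ G.map h₁) (ht₂ : F.map h₂ ≫ t .three = t .two ≫ G.map h₂)
  (hs₁ : F.map p₁ ≫ t .two = t .three ≫ G.map p₁) (hs₂ : F.map p₂ ≫ t .two = t .three ≫ G.map p₂)
include ht₁ ht₂ hs₁ hs₂

lemma naturality_of_generators ⦃X Y : CubicObj⦄ (f : ob X ⟶ ob Y) :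
    F.map f ≫ t Y = t X ≫ G.map f := by
  induction f using hom_induction with
  | zero => simp only [F.map_zero, G.map_zero, Limits.zero_comp, Limits.comp_zero]
  | add f g hf hg =>
    simp only [F.map_add, G.map_add, Preadditive.add_comp, Preadditive.comp_add, hf, hg]
  | neg f hf => simp only [F.map_neg, G.map_neg, Preadditive.neg_comp, Preadditive.comp_neg, hf]
  | id X => simp only [F.map_id, G.map_id, Category.id_comp, Category.comp_id]
  | @comp X Y Z f g hf =>
    have key : F.map (gen g) ≫ t Z = t Y ≫ G.map (gen g) := by
      change CubicGen Y Z at g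
      cases g
      · rw [eq_zero_of_source_one (gen CubicGen.h), F.map_zero, G.map_zero, Limits.zero_comp,
          Limits.comp_zero]
      · rw [eq_zero_of_target_one (gen CubicGen.p), F.map_zero, G.map_zero, Limits.zero_comp,
          Limits.comp_zero]
      · exact ht₁
      · exact ht₂
      · exact hs₁
      · exact hs₂
    rw [F.map_comp, G.map_comp, Category.assoc, key, ← Category.assoc, hf, Category.assoc]

/-- The natural transformation with given components at the objects `1, 2, 3`. -/
noncomputable def natTrans : F ⟶ G where
  app X := t X.as.as
  naturality X Y f :=
    naturality_of_generators t ht₁ ht₂ hs₁ hs₂ (X := X.as.as) (Y := Y.as.as) f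

end naturality

end AltCat

namespace RingC

variable (N : Type u) [AddCommGroup N] [Module RingC N]

/-- The values of the `𝐀ᵃ`-module of a `𝐂`-module. -/
def groupObj : CubicObj → AddCommGrpCat.{u}
  | .one => AddCommGrpCat.of PUnit
  | .two => AddCommGrpCat.of (groupTwo N)
  | .three => AddCommGrpCat.of (groupThree N)

lemma id_groupObj_one : 𝟙 (groupObj N .one) = 0 := by
  ext x
  rfl

/-- The `𝐀ᵃ`-module of a `𝐂`-module. -/
noncomputable def toAltModule : AltCat ⥤+ AddCommGrpCat.{u} :=
  ⟨AltCat.lift (groupObj N) (id_groupObj_one N) (actRels N), AltCat.lift_additive _ _ _⟩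

lemma toAltModule_map_h₁ : (toAltModule N).obj.map AltCat.h₁ = AddCommGrpCat.ofHom (actH₁ N) :=
  AltCat.lift_gen _ (id_groupObj_one N) (actRels N) CubicGen.h₁

lemma toAltModule_map_h₂ : (toAltModule N).obj.map AltCat.h₂ = AddCommGrpCat.ofHom (actH₂ N) :=
  AltCat.lift_gen _ (id_groupObj_one N) (actRels N) CubicGen.h₂

lemma toAltModule_map_p₁ : (toAltModule N).obj.map AltCat.p₁ = AddCommGrpCat.ofHom (actP₁ N) :=
  AltCat.lift_gen _ (id_groupObj_one N) (actRels N) CubicGen.p₁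

lemma toAltModule_map_p₂ : (toAltModule N).obj.map AltCat.p₂ = AddCommGrpCat.ofHom (actP₂ N) :=
  AltCat.lift_gen _ (id_groupObj_one N) (actRels N) CubicGen.p₂

variable {N} {N' : Type u} [AddCommGroup N'] [Module RingC N'] (f : N →ₗ[RingC] N')

/-- The map of the values at the object `2` that is induced by a linear map. -/
def mapTwo : groupTwo N →+ groupTwo N' where
  toFun m := ⟨(f m.1.1, f m.1.2.1, f m.1.2.2), by rw [← map_smul, m.2.1], by
    rw [← map_smul, ← map_smul, m.2.2.1], by rw [← map_smul, ← map_smul, m.2.2.2]⟩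
  map_zero' := Subtype.ext (by simp)
  map_add' m m' := Subtype.ext (by simp)

/-- The map of the values at the object `3` that is induced by a linear map. -/
def mapThree : groupThree N →+ groupThree N' where
  toFun y := ⟨f y.1, by
    change e • f y.1 = 0
    rw [← map_smul, y.2, map_zero]⟩
  map_zero' := Subtype.ext (by simp)
  map_add' m m' := Subtype.ext (by simp)

/-- The components of the map of modules that is induced by a linear map. -/
def mapObj : ∀ X, groupObj N X ⟶ groupObj N' X
  | .one => 0
  | .two => AddCommGrpCat.ofHom (mapTwo f)
  | .three => AddCommGrpCat.ofHom (mapThree f)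

/-- The map of modules that is induced by a linear map. -/
noncomputable def toAltModuleMap : toAltModule N ⟶ toAltModule N' :=
  ObjectProperty.homMk (AltCat.natTrans (F := (toAltModule N).obj) (G := (toAltModule N').obj)
    (mapObj f)
    (by
      rw [toAltModule_map_h₁, toAltModule_map_h₁]
      refine AddCommGrpCat.hom_ext (AddMonoidHom.ext fun m => Subtype.ext ?_)
      exact (map_add f _ _).trans (congrArg (· + f m.1.2.1) (map_smul f _ _)))
    (by
      rw [toAltModule_map_h₂, toAltModule_map_h₂]
      refine AddCommGrpCat.hom_ext (AddMonoidHom.ext fun m => Subtype.ext ?_)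
      exact (map_add f _ _).trans (congrArg (· + f m.1.2.2) (map_smul f _ _)))
    (by
      rw [toAltModule_map_p₁, toAltModule_map_p₁]
      exact AddCommGrpCat.hom_ext (AddMonoidHom.ext fun y =>
        groupTwo_ext (map_smul f _ _) (map_smul f _ _) (map_zero f)))
    (by
      rw [toAltModule_map_p₂, toAltModule_map_p₂]
      exact AddCommGrpCat.hom_ext (AddMonoidHom.ext fun y =>
        groupTwo_ext (map_smul f _ _) (map_zero f) (map_smul f _ _))))

end RingC

/-- The functor from `𝐂`-modules to `𝐀ᵃ`-modules. -/
noncomputable def altModule : ModuleCat.{u} RingC ⥤ (AltCat ⥤+ AddCommGrpCat.{u}) where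
  obj N := RingC.toAltModule N
  map f := RingC.toAltModuleMap f.hom
  map_id N := by
    apply ObjectProperty.hom_ext
    ext1
    ext1 ⟨⟨X⟩⟩
    cases X <;> rfl
  map_comp f g := by
    apply ObjectProperty.hom_ext
    ext1
    ext1 ⟨⟨X⟩⟩
    cases X <;> rfl

instance : altModule.{u}.Additive where
  map_add {N N' f g} := by
    apply ObjectProperty.hom_ext
    ext1
    ext1 ⟨⟨X⟩⟩
    cases X <;> rfl

/-! ## The functor from `𝐂`-modules to `𝐀ᵃ`-modules is fully faithful -/

namespace RingC

section

variable (N : Type u) [AddCommGroup N] [Module RingC N]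

/-- The projection to the summand `e • N`, as a subgroup of the value at the object `2`. -/
def inTwo : N →+ groupTwo N where
  toFun n := ⟨(e • n, 0, 0), smul_smul_eq rels.e_e n, by simp, by simp⟩
  map_zero' := Subtype.ext (by simp)
  map_add' m n := Subtype.ext (by simp)

/-- The projection to the value at the object `3`. -/
def inThree : N →+ groupThree N where
  toFun n := ⟨n - e • n, by
    change e • _ = 0
    rw [smul_sub, smul_smul_eq rels.e_e, sub_self]⟩
  map_zero' := Subtype.ext (by simp)
  map_add' m n := Subtype.ext (by simp [add_sub_add_comm])

variable {N}

lemma inThree_coe (y : groupThree N) : inThree N y.1 = y :=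
  Subtype.ext ((congrArg (y.1 - ·) y.2).trans (sub_zero _))

lemma inTwo_coe (y : groupThree N) : inTwo N y.1 = 0 := groupTwo_ext y.2 rfl rfl

lemma inTwo_e_smul (n : N) : inTwo N (e • n) = inTwo N n :=
  groupTwo_ext (smul_smul_eq rels.e_e n) rfl rfl

lemma inThree_e_smul (n : N) : inThree N (e • n) = 0 := Subtype.ext (by
  change e • n - e • e • n = 0
  rw [smul_smul_eq rels.e_e, sub_self])

lemma smul_inThree {r : RingC} (h : r * e = 0) (n : N) : r • (inThree N n).1 = r • n := by
  change r • (n - e • n) = _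
  rw [smul_sub, smul_smul_eq_zero h, sub_zero]

lemma actH₁_inTwo (n : N) : (actH₁ N (inTwo N n)).1 = η • n := by
  change η • e • n + 0 = _
  rw [smul_smul_eq rels.η_e, add_zero]

lemma smul_e_smul_add (n : N) : e • n + (inThree N n).1 = n := add_sub_cancel _ _

variable {N' : Type u} [AddCommGroup N'] [Module RingC N'] {t₂ : groupTwo N →+ groupTwo N'}
  {t₃ : groupThree N →+ groupThree N'}
  (h₁ : ∀ m, t₃ (actH₁ N m) = actH₁ N' (t₂ m)) (h₂ : ∀ m, t₃ (actH₂ N m) = actH₂ N' (t₂ m))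
  (k₁ : ∀ y, t₂ (actP₁ N y) = actP₁ N' (t₃ y)) (k₂ : ∀ y, t₂ (actP₂ N y) = actP₂ N' (t₃ y))

/-- The additive map given by a map of modules. -/
def glue (t₂ : groupTwo N →+ groupTwo N') (t₃ : groupThree N →+ groupThree N') : N →+ N' where
  toFun n := (t₂ (inTwo N n)).1.1 + (t₃ (inThree N n)).1
  map_zero' := by simp
  map_add' m n := by
    simp only [map_add, AddSubgroup.coe_add, Prod.fst_add]
    abel

lemma glue_coe (y : groupThree N) : glue t₂ t₃ y.1 = (t₃ y).1 := by
  change (t₂ (inTwo N y.1)).1.1 + (t₃ (inThree N y.1)).1 = _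
  rw [inTwo_coe, inThree_coe, map_zero]
  exact zero_add _

lemma glue_e_smul (n : N) : glue t₂ t₃ (e • n) = (t₂ (inTwo N n)).1.1 := by
  change (t₂ (inTwo N (e • n))).1.1 + (t₃ (inThree N (e • n))).1 = _
  rw [inTwo_e_smul, inThree_e_smul, map_zero]
  exact add_zero _

lemma e_smul_glue (n : N) : e • glue t₂ t₃ n = (t₂ (inTwo N n)).1.1 := by
  change e • ((t₂ (inTwo N n)).1.1 + (t₃ (inThree N n)).1) = _
  rw [smul_add, (t₂ (inTwo N n)).2.1]
  exact (congrArg ((t₂ (inTwo N n)).1.1 + ·) (t₃ (inThree N n)).2).trans (add_zero _)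

lemma smul_glue {r : RingC} (h : r * e = 0) (n : N) :
    r • glue t₂ t₃ n = r • (t₃ (inThree N n)).1 := by
  change r • ((t₂ (inTwo N n)).1.1 + (t₃ (inThree N n)).1) = _
  rw [← (t₂ (inTwo N n)).2.1, smul_add, smul_smul_eq_zero h, zero_add]

include h₁ k₁ in
-- On the kernel of e the element x₁ acts as p₁ followed by h₁, and the given maps commute with
-- both.
lemma glue_x₁_smul (n : N) : glue t₂ t₃ (x₁ • n) = x₁ • glue t₂ t₃ n := by
  rw [smul_glue rels.x₁_e, ← smul_inThree rels.x₁_e, ← actH₁_actP₁, glue_coe, h₁, k₁, actH₁_actP₁]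

include h₂ k₂ in
lemma glue_x₂_smul (n : N) : glue t₂ t₃ (x₂ • n) = x₂ • glue t₂ t₃ n := by
  rw [smul_glue rels.x₂_e, ← smul_inThree rels.x₂_e, ← actH₂_actP₂, glue_coe, h₂, k₂, actH₂_actP₂]

section

include h₁ h₂ k₁ k₂

/-- The last two components are recovered by the words h₁p₂h₂p₁ and h₂p₁h₁p₂, which annihilate the
summand eN; t₂ commutes with these words. -/
lemma apply_inTwo (n : N) : (t₂ (inTwo N n)).1.2 = 0 := by
  have hw : actP₁ N (actH₂ N (actP₂ N (actH₁ N (inTwo N n)))) = 0 := by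
    refine groupTwo_ext ?_ ?_ rfl
    · change ξ • (actH₂ N (actP₂ N (actH₁ N (inTwo N n)))).1 = 0
      rw [actH₂_actP₂, smul_smul_eq_zero rels.ξ_x₂]
    · change x₁ • (actH₂ N (actP₂ N (actH₁ N (inTwo N n)))).1 = 0
      rw [actH₂_actP₂, x₂_smul_actH₁]
      exact (congrArg (x₁ • ·) (smul_zero x₂)).trans (smul_zero x₁)
  have hz : actP₂ N (actH₁ N (actP₁ N (actH₂ N (inTwo N n)))) = 0 := by
    refine groupTwo_ext ?_ rfl ?_
    · change ξ • (actH₁ N (actP₁ N (actH₂ N (inTwo N n)))).1 = 0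
      rw [actH₁_actP₁, smul_smul_eq_zero rels.ξ_x₁]
    · change x₂ • (actH₁ N (actP₁ N (actH₂ N (inTwo N n)))).1 = 0
      rw [actH₁_actP₁, x₁_smul_actH₂]
      exact (congrArg (x₂ • ·) (smul_zero x₁)).trans (smul_zero x₂)
  have hw' := congrArg (fun m => (t₂ m).1.2.1) hw
  have hz' := congrArg (fun m => (t₂ m).1.2.2) hz
  simp only [map_zero, h₁, h₂, k₁, k₂] at hw' hz'
  refine Prod.ext ?_ ?_
  · refine Eq.trans ?_ hw'
    change _ = x₁ • (actH₂ N' (actP₂ N' (actH₁ N' (t₂ (inTwo N n))))).1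
    rw [actH₂_actP₂, x₂_smul_actH₁, (t₂ (inTwo N n)).2.2.1]
  · refine Eq.trans ?_ hz'
    change _ = x₂ • (actH₁ N' (actP₁ N' (actH₂ N' (t₂ (inTwo N n))))).1
    rw [actH₁_actP₁, x₁_smul_actH₂, (t₂ (inTwo N n)).2.2.2]

lemma apply_two (m : groupTwo N) : (t₂ m).1 =
    (glue t₂ t₃ m.1.1, glue t₂ t₃ m.1.2.1, glue t₂ t₃ m.1.2.2) := by
  have hw : e • m.1.2.1 = 0 := by rw [← m.2.2.1, smul_smul_eq_zero rels.e_x₁]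
  have hz : e • m.1.2.2 = 0 := by rw [← m.2.2.2, smul_smul_eq_zero rels.e_x₂]
  let w : groupThree N := ⟨m.1.2.1, hw⟩
  let z : groupThree N := ⟨m.1.2.2, hz⟩
  -- The last two components are written as images from the object 3, so that t₂ on them is
  -- determined by t₃.
  have hm : m = inTwo N m.1.1 + actP₁ N (actH₂ N (actP₂ N w)) + actP₂ N (actH₁ N (actP₁ N z)) := by
    refine groupTwo_ext ?_ ?_ ?_
    · change m.1.1 = e • m.1.1 + ξ • (actH₂ N (actP₂ N w)).1 + ξ • (actH₁ N (actP₁ N z)).1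
      rw [actH₂_actP₂, actH₁_actP₁, smul_smul_eq_zero rels.ξ_x₁, smul_smul_eq_zero rels.ξ_x₂,
        m.2.1, add_zero, add_zero]
    · change m.1.2.1 = 0 + x₁ • (actH₂ N (actP₂ N w)).1 + 0
      rw [actH₂_actP₂, m.2.2.1, zero_add, add_zero]
    · change m.1.2.2 = 0 + 0 + x₂ • (actH₁ N (actP₁ N z)).1
      rw [actH₁_actP₁, m.2.2.2, zero_add, zero_add]
  have ht : t₂ m = t₂ (inTwo N m.1.1) + actP₁ N' (actH₂ N' (actP₂ N' (t₃ w))) +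
      actP₂ N' (actH₁ N' (actP₁ N' (t₃ z))) := by
    rw [← k₂ w, ← h₂, ← k₁ (actH₂ N _), ← k₁ z, ← h₁, ← k₂ (actH₁ N _), ← map_add, ← map_add]
    exact congrArg t₂ hm
  have h₀ := apply_inTwo h₁ h₂ k₁ k₂ m.1.1
  rw [ht]
  refine Prod.ext ?_ (Prod.ext ?_ ?_)
  · change (t₂ (inTwo N m.1.1)).1.1 + ξ • (actH₂ N' (actP₂ N' (t₃ w))).1 +
      ξ • (actH₁ N' (actP₁ N' (t₃ z))).1 = glue t₂ t₃ m.1.1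
    rw [actH₂_actP₂, actH₁_actP₁, smul_smul_eq_zero rels.ξ_x₁, smul_smul_eq_zero rels.ξ_x₂,
      add_zero, add_zero, ← glue_e_smul (t₃ := t₃), m.2.1]
  · change (t₂ (inTwo N m.1.1)).1.2.1 + x₁ • (actH₂ N' (actP₂ N' (t₃ w))).1 + 0 =
      glue t₂ t₃ w.1
    rw [h₀, actH₂_actP₂, ← glue_coe (t₂ := t₂), ← glue_x₂_smul h₂ k₂, ← glue_x₁_smul h₁ k₁, m.2.2.1]
    exact (add_zero _).trans (zero_add _)
  · change (t₂ (inTwo N m.1.1)).1.2.2 + 0 + x₂ • (actH₁ N' (actP₁ N' (t₃ z))).1 = glue t₂ t₃ z.1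
    rw [h₀, actH₁_actP₁, ← glue_coe (t₂ := t₂), ← glue_x₁_smul h₁ k₁, ← glue_x₂_smul h₂ k₂, m.2.2.2]
    exact (congrArg (· + _) (add_zero _)).trans (zero_add _)

/-- The linear map given by a map of modules. -/
def glueLinear : N →ₗ[RingC] N' where
  toFun := glue t₂ t₃
  map_add' := map_add _
  map_smul' := map_smul_of_generators (glue t₂ t₃)
    (fun n => by rw [glue_e_smul, e_smul_glue]) (glue_x₁_smul h₁ k₁) (glue_x₂_smul h₂ k₂)
    (fun n => by
      rw [smul_glue rels.ξ_e]
      have h := congrArg Prod.fst (apply_two h₁ h₂ k₁ k₂ (actP₁ N (inThree N n)))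
      rw [k₁] at h
      change ξ • (t₃ (inThree N n)).1 = glue t₂ t₃ (ξ • (inThree N n).1) at h
      rw [h, smul_inThree rels.ξ_e])
    (fun n => by
      rw [← actH₁_inTwo, glue_coe, h₁]
      change η • (t₂ (inTwo N n)).1.1 + (t₂ (inTwo N n)).1.2.1 = _
      rw [apply_inTwo h₁ h₂ k₁ k₂, ← e_smul_glue (t₃ := t₃), smul_smul_eq rels.η_e]
      exact add_zero _)

end

end

end RingC

open RingC

instance : altModule.{u}.Faithful where
  map_injective {N N' f g} h := by
    have key (X : CubicObj) : mapObj f.hom X = mapObj g.hom X :=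
      congrArg (fun t : toAltModule N ⟶ toAltModule N' => t.hom.app (AltCat.ob X)) h
    have key₂ : mapTwo f.hom = mapTwo g.hom := congrArg AddCommGrpCat.Hom.hom (key .two)
    have key₃ : mapThree f.hom = mapThree g.hom := congrArg AddCommGrpCat.Hom.hom (key .three)
    ext n
    have h₂ : f.hom (e • n) = g.hom (e • n) :=
      congrArg (fun m : groupTwo N' => m.1.1) (DFunLike.congr_fun key₂ (inTwo N n))
    have h₃ : f.hom (inThree N n).1 = g.hom (inThree N n).1 :=
      congrArg (fun y : groupThree N' => y.1) (DFunLike.congr_fun key₃ (inThree N n))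
    rw [← smul_e_smul_add n, map_add, map_add, h₂, h₃]

instance : altModule.{u}.Full where
  map_surjective {N N'} t := by
    let t₂ : groupTwo N →+ groupTwo N' := (t.hom.app (AltCat.ob .two)).hom
    let t₃ : groupThree N →+ groupThree N' := (t.hom.app (AltCat.ob .three)).hom
    have h₁ (m) : t₃ (actH₁ N m) = actH₁ N' (t₂ m) := by
      have h := t.hom.naturality AltCat.h₁
      erw [toAltModule_map_h₁, toAltModule_map_h₁] at h
      exact ConcreteCategory.congr_hom h m
    have h₂ (m) : t₃ (actH₂ N m) = actH₂ N' (t₂ m) := by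
      have h := t.hom.naturality AltCat.h₂
      erw [toAltModule_map_h₂, toAltModule_map_h₂] at h
      exact ConcreteCategory.congr_hom h m
    have k₁ (y) : t₂ (actP₁ N y) = actP₁ N' (t₃ y) := by
      have h := t.hom.naturality AltCat.p₁
      erw [toAltModule_map_p₁, toAltModule_map_p₁] at h
      exact ConcreteCategory.congr_hom h y
    have k₂ (y) : t₂ (actP₂ N y) = actP₂ N' (t₃ y) := by
      have h := t.hom.naturality AltCat.p₂
      erw [toAltModule_map_p₂, toAltModule_map_p₂] at h
      exact ConcreteCategory.congr_hom h y
    refine ⟨ModuleCat.ofHom (glueLinear h₁ h₂ k₁ k₂), ?_⟩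
    apply ObjectProperty.hom_ext
    ext1
    ext1 ⟨⟨X⟩⟩
    cases X with
    | one => exact AddCommGrpCat.hom_ext (AddMonoidHom.ext fun _ => rfl)
    | two =>
      exact AddCommGrpCat.hom_ext (AddMonoidHom.ext fun m =>
        Subtype.ext (apply_two h₁ h₂ k₁ k₂ m).symm)
    | three =>
      exact AddCommGrpCat.hom_ext (AddMonoidHom.ext fun y => Subtype.ext (glue_coe y))

/-! ## Every `𝐀ᵃ`-module comes from a `𝐂`-module -/

namespace AltRels

section

variable {D : Type*} [Category* D] [Preadditive D] {A B : D} {h₁ h₂ : A ⟶ B} {p₁ p₂ : B ⟶ A}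

/-- The idempotent of the object `2` that corresponds to the element `e` of `𝐂`. -/
def idem (_ : AltRels h₁ h₂ p₁ p₂) : A ⟶ A :=
  𝟙 A - h₁ ≫ p₂ ≫ h₂ ≫ p₁ - h₂ ≫ p₁ ≫ h₁ ≫ p₂

variable (r : AltRels h₁ h₂ p₁ p₂)

lemma idem_h₁ : r.idem ≫ h₁ = h₁ - h₁ ≫ p₂ ≫ h₂ ≫ p₁ ≫ h₁ := by
  simp only [idem, Preadditive.sub_comp, Category.id_comp, Category.assoc, r.p₂h₁,
    Limits.comp_zero, sub_zero]

lemma two_idem_h₁ : (2 : ℤ) • (r.idem ≫ h₁) = 0 := by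
  rw [idem_h₁, smul_sub, r.two_long_h, sub_self]

/-- `long_h` makes the two composites negatives of each other, and they are killed by 2. Hence one
element η accounts for both h₁ and h₂. -/
lemma idem_h₂ : r.idem ≫ h₂ = r.idem ≫ h₁ := by
  have h : r.idem ≫ h₂ = -(r.idem ≫ h₁) := by
    rw [idem_h₁]
    simp only [idem, Preadditive.sub_comp, Category.id_comp, Category.assoc, r.p₁h₂,
      Limits.comp_zero, sub_zero, r.long_h]
    abel
  rw [h, neg_eq_iff_add_eq_zero, ← two_zsmul, two_idem_h₁]

lemma p₁_idem : p₁ ≫ r.idem = p₁ - p₁ ≫ h₁ ≫ p₂ ≫ h₂ ≫ p₁ := by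
  simp only [idem, Preadditive.comp_sub, Category.comp_id, r.p₁h₂_assoc, sub_zero]

lemma two_p₁_idem : (2 : ℤ) • (p₁ ≫ r.idem) = 0 := by
  rw [p₁_idem, smul_sub, r.two_long_p, sub_self]

/-- The dual argument; one element ξ accounts for both p₁ and p₂. -/
lemma p₂_idem : p₂ ≫ r.idem = p₁ ≫ r.idem := by
  have h : p₂ ≫ r.idem = -(p₁ ≫ r.idem) := by
    rw [p₁_idem]
    simp only [idem, Preadditive.comp_sub, Category.comp_id, r.p₂h₁_assoc, sub_zero, r.long_p]
    abel
  rw [h, neg_eq_iff_add_eq_zero, ← two_zsmul, two_p₁_idem]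

lemma idem_h₁_p₁_h₁ : r.idem ≫ h₁ ≫ p₁ ≫ h₁ = 0 := by
  rw [r.h₁p₁h₁, Preadditive.comp_zsmul, two_idem_h₁]

lemma idem_h₁_p₂_h₂ : r.idem ≫ h₁ ≫ p₂ ≫ h₂ = 0 := by
  rw [← Category.assoc, ← idem_h₂, Category.assoc, r.h₂p₂h₂, Preadditive.comp_zsmul, idem_h₂,
    two_idem_h₁]

lemma idem_idem : r.idem ≫ r.idem = r.idem := by
  have h := congrArg (· ≫ p₁) r.idem_h₁_p₂_h₂
  have h' := congrArg (· ≫ p₂) r.idem_h₁_p₁_h₁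
  simp only [Category.assoc, Limits.zero_comp] at h h'
  rw [← Category.assoc, ← idem_h₂, Category.assoc] at h'
  change r.idem ≫ (𝟙 A - h₁ ≫ p₂ ≫ h₂ ≫ p₁ - h₂ ≫ p₁ ≫ h₁ ≫ p₂) = _
  rw [Preadditive.comp_sub, Preadditive.comp_sub, h, h', Category.comp_id, sub_zero, sub_zero]

lemma p₁_idem_h₁ : p₁ ≫ r.idem ≫ h₁ = 0 := by
  rw [idem_h₁, Preadditive.comp_sub, r.braid₁, sub_self]

lemma p₁_h₁_p₁_idem : p₁ ≫ h₁ ≫ p₁ ≫ r.idem = 0 := by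
  rw [r.p₁h₁p₁_assoc, two_p₁_idem]

lemma p₂_h₂_p₁_idem : p₂ ≫ h₂ ≫ p₁ ≫ r.idem = 0 := by
  rw [← p₂_idem, r.p₂h₂p₂_assoc, p₂_idem, two_p₁_idem]

lemma p₁_h₁_p₂_idem : p₁ ≫ h₁ ≫ p₂ ≫ r.idem = 0 := by
  rw [p₂_idem, p₁_h₁_p₁_idem]

lemma idem_long_h₁ : r.idem ≫ h₁ ≫ p₂ ≫ h₂ ≫ p₁ ≫ h₁ = 0 := by
  have h := congrArg (· ≫ p₁ ≫ h₁) r.idem_h₁_p₂_h₂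
  simpa only [Category.assoc, Limits.zero_comp] using h

lemma idem_long_h₂ : r.idem ≫ h₂ ≫ p₁ ≫ h₁ ≫ p₂ ≫ h₂ = 0 := by
  have h := congrArg (· ≫ p₂ ≫ h₂) r.idem_h₁_p₁_h₁
  simp only [Category.assoc, Limits.zero_comp] at h
  rw [← Category.assoc, idem_h₂, Category.assoc, h]

/-- By the braid relations the two long words shorten to the idempotents h₁p₂h₂p₁ and h₂p₁h₁p₂
subtracted in `idem`. -/
lemma idem_add : r.idem + (h₁ ≫ p₂ ≫ h₂ ≫ p₁ ≫ h₁) ≫ p₂ ≫ h₂ ≫ p₁ +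
    (h₂ ≫ p₁ ≫ h₁ ≫ p₂ ≫ h₂) ≫ p₁ ≫ h₁ ≫ p₂ = 𝟙 A := by
  simp only [Category.assoc, r.braid₁_assoc, r.braid₂_assoc, idem]
  abel

end

section

variable {A B : AddCommGrpCat.{u}} {h₁ h₂ : A ⟶ B} {p₁ p₂ : B ⟶ A} (r : AltRels h₁ h₂ p₁ p₂)

/-- The image of the idempotent of the object `2`. -/
def fixed : AddSubgroup A where
  carrier := {a | r.idem a = a}
  zero_mem' := map_zero _
  add_mem' ha hb := (map_add _ _ _).trans (congrArg₂ (· + ·) ha hb)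
  neg_mem' ha := (map_neg _ _).trans (congrArg Neg.neg ha)

/-- The projection to the image of the idempotent of the object `2`. -/
def toFixed : A →+ r.fixed :=
  r.idem.hom.codRestrict r.fixed fun a => ConcreteCategory.congr_hom r.idem_idem a

/-- The `𝐂`-module of a diagram with the relations of `𝐀ᵃ`. -/
def Glued : Type u := r.fixed × B

instance : AddCommGroup r.Glued := inferInstanceAs (AddCommGroup (r.fixed × B))

/-- The action of `e`. -/
def gluedE : AddMonoid.End r.Glued :=
  (AddMonoidHom.inl r.fixed B).comp (AddMonoidHom.fst r.fixed B)

/-- An endomorphism of the value at the object `3` as an endomorphism of the `𝐂`-module. -/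
def gluedThree (f : B ⟶ B) : AddMonoid.End r.Glued :=
  ((AddMonoidHom.inr r.fixed B).comp f.hom).comp (AddMonoidHom.snd r.fixed B)

/-- The action of `ξ`. -/
def gluedXi : AddMonoid.End r.Glued :=
  ((AddMonoidHom.inl r.fixed B).comp (r.toFixed.comp p₁.hom)).comp (AddMonoidHom.snd r.fixed B)

/-- The action of `η`. -/
def gluedEta : AddMonoid.End r.Glued :=
  ((AddMonoidHom.inr r.fixed B).comp (h₁.hom.comp r.fixed.subtype)).comp
    (AddMonoidHom.fst r.fixed B)

/-- Products in `AddMonoid.End` are read from right to left, opposite to `≫`. So ηξ = 0 is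
`p₁_idem_h₁`, and the relations between x₁ and x₂ are the braid relations. -/
lemma gluedRels : RingCRels r.gluedE (r.gluedThree (p₁ ≫ h₁)) (r.gluedThree (p₂ ≫ h₂))
    r.gluedXi r.gluedEta where
  e_e := rfl
  e_x₁ := rfl
  x₁_e := AddMonoidHom.ext fun _ => Prod.ext rfl (map_zero (p₁ ≫ h₁).hom)
  e_x₂ := rfl
  x₂_e := AddMonoidHom.ext fun _ => Prod.ext rfl (map_zero (p₂ ≫ h₂).hom)
  x₁_x₁ := AddMonoidHom.ext fun n => Prod.ext (smul_zero (2 : ℤ)).symm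
    (congrArg h₁ (ConcreteCategory.congr_hom r.p₁h₁p₁ n.2) |>.trans (map_zsmul h₁.hom 2 _))
  x₂_x₂ := AddMonoidHom.ext fun n => Prod.ext (smul_zero (2 : ℤ)).symm
    (congrArg h₂ (ConcreteCategory.congr_hom r.p₂h₂p₂ n.2) |>.trans (map_zsmul h₂.hom 2 _))
  x₁_x₂_x₁ := AddMonoidHom.ext fun n => Prod.ext rfl (ConcreteCategory.congr_hom r.braid₁ n.2)
  x₂_x₁_x₂ := AddMonoidHom.ext fun n => Prod.ext rfl (ConcreteCategory.congr_hom r.braid₂ n.2)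
  e_ξ := rfl
  ξ_e := AddMonoidHom.ext fun _ => Prod.ext (map_zero (r.toFixed.comp p₁.hom)) rfl
  e_η := rfl
  η_e := rfl
  ξ_x₁ := AddMonoidHom.ext fun n =>
    Prod.ext (Subtype.ext (ConcreteCategory.congr_hom r.p₁_h₁_p₁_idem n.2)) rfl
  ξ_x₂ := AddMonoidHom.ext fun n =>
    Prod.ext (Subtype.ext (ConcreteCategory.congr_hom r.p₂_h₂_p₁_idem n.2)) rfl
  x₁_η := AddMonoidHom.ext fun n => Prod.ext rfl
    ((congrArg (h₁ ≫ p₁ ≫ h₁) n.1.2.symm).trans (ConcreteCategory.congr_hom r.idem_h₁_p₁_h₁ n.1.1))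
  x₂_η := AddMonoidHom.ext fun n => Prod.ext rfl
    ((congrArg (h₁ ≫ p₂ ≫ h₂) n.1.2.symm).trans (ConcreteCategory.congr_hom r.idem_h₁_p₂_h₂ n.1.1))
  η_ξ := AddMonoidHom.ext fun n => Prod.ext rfl (ConcreteCategory.congr_hom r.p₁_idem_h₁ n.2)
  two_ξ := AddMonoidHom.ext fun n => Prod.ext
    (Subtype.ext (ConcreteCategory.congr_hom r.two_p₁_idem n.2)) (smul_zero (2 : ℤ))
  two_η := AddMonoidHom.ext fun n => Prod.ext (smul_zero (2 : ℤ))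
    ((congrArg (fun a => (2 : ℤ) • h₁ a) n.1.2.symm).trans
      (ConcreteCategory.congr_hom r.two_idem_h₁ n.1.1))

noncomputable instance : Module RingC r.Glued := Module.compHom r.Glued (RingC.lift r.gluedRels)

/-- An element of the `𝐂`-module with given components. -/
def glued (a : r.fixed) (b : B) : r.Glued := (a, b)

variable {r}

lemma e_smul_glued (a : r.fixed) (b : B) : RingC.e • r.glued a b = r.glued a 0 :=
  congrArg (fun f : AddMonoid.End r.Glued => f (r.glued a b)) (RingC.lift_e r.gluedRels)

lemma x₁_smul_glued (a : r.fixed) (b : B) : RingC.x₁ • r.glued a b = r.glued 0 (h₁ (p₁ b)) :=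
  congrArg (fun f : AddMonoid.End r.Glued => f (r.glued a b)) (RingC.lift_x₁ r.gluedRels)

lemma x₂_smul_glued (a : r.fixed) (b : B) : RingC.x₂ • r.glued a b = r.glued 0 (h₂ (p₂ b)) :=
  congrArg (fun f : AddMonoid.End r.Glued => f (r.glued a b)) (RingC.lift_x₂ r.gluedRels)

lemma ξ_smul_glued (a : r.fixed) (b : B) :
    RingC.ξ • r.glued a b = r.glued (r.toFixed (p₁ b)) 0 :=
  congrArg (fun f : AddMonoid.End r.Glued => f (r.glued a b)) (RingC.lift_ξ r.gluedRels)

lemma η_smul_glued (a : r.fixed) (b : B) : RingC.η • r.glued a b = r.glued 0 (h₁ a.1) :=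
  congrArg (fun f : AddMonoid.End r.Glued => f (r.glued a b)) (RingC.lift_η r.gluedRels)

variable (r)

/-- The inverse of the isomorphism `gluedTwo`. -/
def twoGlued (a : A) : RingC.groupTwo r.Glued :=
  ⟨(r.glued (r.toFixed a) 0, r.glued 0 ((h₁ ≫ p₂ ≫ h₂ ≫ p₁ ≫ h₁) a),
    r.glued 0 ((h₂ ≫ p₁ ≫ h₁ ≫ p₂ ≫ h₂) a)), e_smul_glued _ _,
    (congrArg (RingC.x₁ • ·) (x₂_smul_glued _ _)).trans ((x₁_smul_glued _ _).trans
      (congrArg (r.glued 0) (ConcreteCategory.congr_hom r.braid₁ (h₂ (p₂ (h₁ a)))))),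
    (congrArg (RingC.x₂ • ·) (x₁_smul_glued _ _)).trans ((x₂_smul_glued _ _).trans
      (congrArg (r.glued 0) (ConcreteCategory.congr_hom r.braid₂ (h₁ (p₁ (h₂ a))))))⟩

variable {r} in
lemma two_fst (m : RingC.groupTwo r.Glued) : m.1.1 = r.glued m.1.1.1 0 :=
  m.2.1.symm.trans (e_smul_glued m.1.1.1 m.1.1.2)

variable {r} in
lemma two_snd₁ (m : RingC.groupTwo r.Glued) :
    r.glued 0 ((p₂ ≫ h₂ ≫ p₁ ≫ h₁) m.1.2.1.2) = m.1.2.1 :=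
  (((congrArg (RingC.x₁ • ·) (x₂_smul_glued m.1.2.1.1 m.1.2.1.2)).trans
    (x₁_smul_glued _ _)).symm).trans m.2.2.1

variable {r} in
lemma two_snd₂ (m : RingC.groupTwo r.Glued) :
    r.glued 0 ((p₁ ≫ h₁ ≫ p₂ ≫ h₂) m.1.2.2.2) = m.1.2.2 :=
  (((congrArg (RingC.x₂ • ·) (x₁_smul_glued m.1.2.2.1 m.1.2.2.2)).trans
    (x₂_smul_glued _ _)).symm).trans m.2.2.2

/-- The isomorphism with the value at the object `2` of the module of `r.Glued`. -/
def gluedTwo : RingC.groupTwo r.Glued ≃+ A where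
  toFun m := m.1.1.1.1 + (p₂ ≫ h₂ ≫ p₁) m.1.2.1.2 + (p₁ ≫ h₁ ≫ p₂) m.1.2.2.2
  invFun := r.twoGlued
  left_inv m := by
    refine RingC.groupTwo_ext ?_ ?_ ?_
    · refine Eq.trans (congrArg (r.glued · 0) (Subtype.ext ?_)) (two_fst m).symm
      change r.idem _ = _
      rw [map_add, map_add]
      exact (congrArg₂ (· + ·) (congrArg₂ (· + ·) m.1.1.1.2
        (ConcreteCategory.congr_hom r.p₂_h₂_p₁_idem m.1.2.1.2))
        (ConcreteCategory.congr_hom r.p₁_h₁_p₂_idem m.1.2.2.2)).trans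
        ((add_zero _).trans (add_zero _))
    · refine Eq.trans (congrArg (r.glued 0) ?_) (two_snd₁ m)
      rw [map_add, map_add]
      refine (congrArg₂ (· + ·) (congrArg₂ (· + ·)
        ((congrArg (h₁ ≫ p₂ ≫ h₂ ≫ p₁ ≫ h₁) m.1.1.1.2.symm).trans
          (ConcreteCategory.congr_hom r.idem_long_h₁ m.1.1.1.1))
        (ConcreteCategory.congr_hom (r.braid₂_assoc (p₁ ≫ h₁)) m.1.2.1.2)) ?_).trans
        ((add_zero _).trans (zero_add _))
      -- Orthogonality of the two idempotents through 3: the word contains p₂ ≫ h₁.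
      refine ConcreteCategory.congr_hom (f := (p₁ ≫ h₁ ≫ p₂) ≫ h₁ ≫ p₂ ≫ h₂ ≫ p₁ ≫ h₁)
        (g := 0) ?_ m.1.2.2.2
      simp only [Category.assoc, r.p₂h₁_assoc, Limits.comp_zero]
    · refine Eq.trans (congrArg (r.glued 0) ?_) (two_snd₂ m)
      rw [map_add, map_add]
      refine (congrArg₂ (· + ·) (congrArg₂ (· + ·)
        ((congrArg (h₂ ≫ p₁ ≫ h₁ ≫ p₂ ≫ h₂) m.1.1.1.2.symm).trans
          (ConcreteCategory.congr_hom r.idem_long_h₂ m.1.1.1.1)) ?_)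
        (ConcreteCategory.congr_hom (r.braid₁_assoc (p₂ ≫ h₂)) m.1.2.2.2)).trans
        ((congrArg (· + _) (add_zero _)).trans (zero_add _))
      refine ConcreteCategory.congr_hom (f := (p₂ ≫ h₂ ≫ p₁) ≫ h₂ ≫ p₁ ≫ h₁ ≫ p₂ ≫ h₂)
        (g := 0) ?_ m.1.2.1.2
      simp only [Category.assoc, r.p₁h₂_assoc, Limits.comp_zero]
  right_inv a := ConcreteCategory.congr_hom r.idem_add a
  map_add' m m' := by
    change m.1.1.1.1 + m'.1.1.1.1 + (p₂ ≫ h₂ ≫ p₁) (m.1.2.1.2 + m'.1.2.1.2) +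
      (p₁ ≫ h₁ ≫ p₂) (m.1.2.2.2 + m'.1.2.2.2) = _
    rw [map_add, map_add]
    abel

/-- The isomorphism with the value at the object `3` of the module of `r.Glued`. -/
def gluedThreeEquiv : RingC.groupThree r.Glued ≃+ B where
  toFun y := y.1.2
  invFun b := ⟨r.glued 0 b, e_smul_glued _ _⟩
  left_inv y := Subtype.ext (Prod.ext
    (congrArg Prod.fst ((e_smul_glued y.1.1 y.1.2).symm.trans y.2)).symm rfl)
  right_inv _ := rfl
  map_add' _ _ := rfl

lemma gluedThreeEquiv_actH₁ (m : RingC.groupTwo r.Glued) :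
    r.gluedThreeEquiv (RingC.actH₁ _ m) = h₁ (r.gluedTwo m) := by
  have hη : (RingC.η • m.1.1).2 = h₁ m.1.1.1.1 := congrArg Prod.snd (η_smul_glued _ _)
  have hw : (p₂ ≫ h₂ ≫ p₁ ≫ h₁) m.1.2.1.2 = m.1.2.1.2 := congrArg Prod.snd (two_snd₁ m)
  have hz : (p₁ ≫ h₁ ≫ p₂ ≫ h₁) m.1.2.2.2 = 0 := by
    rw [r.p₂h₁, Limits.comp_zero, Limits.comp_zero]
    rfl
  change (RingC.η • m.1.1).2 + m.1.2.1.2 =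
    h₁ (m.1.1.1.1 + (p₂ ≫ h₂ ≫ p₁) m.1.2.1.2 + (p₁ ≫ h₁ ≫ p₂) m.1.2.2.2)
  rw [map_add, map_add, hη]
  exact ((congrArg₂ (· + ·) (congrArg (_ + ·) hw) hz).trans (add_zero _)).symm

/-- η was defined through h₁; on the image of `idem` it also computes h₂, by `idem_h₂`. -/
lemma gluedThreeEquiv_actH₂ (m : RingC.groupTwo r.Glued) :
    r.gluedThreeEquiv (RingC.actH₂ _ m) = h₂ (r.gluedTwo m) := by
  have hη : (RingC.η • m.1.1).2 = h₁ m.1.1.1.1 := congrArg Prod.snd (η_smul_glued _ _)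
  have ha : h₂ m.1.1.1.1 = h₁ m.1.1.1.1 := by
    rw [← m.1.1.1.2]
    exact ConcreteCategory.congr_hom r.idem_h₂ m.1.1.1.1
  have hz : (p₁ ≫ h₁ ≫ p₂ ≫ h₂) m.1.2.2.2 = m.1.2.2.2 := congrArg Prod.snd (two_snd₂ m)
  have hw : (p₂ ≫ h₂ ≫ p₁ ≫ h₂) m.1.2.1.2 = 0 := by
    rw [r.p₁h₂, Limits.comp_zero, Limits.comp_zero]
    rfl
  change (RingC.η • m.1.1).2 + m.1.2.2.2 =
    h₂ (m.1.1.1.1 + (p₂ ≫ h₂ ≫ p₁) m.1.2.1.2 + (p₁ ≫ h₁ ≫ p₂) m.1.2.2.2)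
  rw [map_add, map_add, hη, ha]
  exact (congrArg₂ (· + ·) ((congrArg (_ + ·) hw).trans (add_zero _)) hz).symm

lemma gluedTwo_actP₁ (y : RingC.groupThree r.Glued) :
    r.gluedTwo (RingC.actP₁ _ y) = p₁ (r.gluedThreeEquiv y) := by
  have hξ : (RingC.ξ • y.1).1.1 = (p₁ ≫ r.idem) y.1.2 :=
    congrArg (fun n : r.Glued => n.1.1) (ξ_smul_glued _ _)
  have hw : (RingC.x₁ • y.1).2 = h₁ (p₁ y.1.2) := congrArg Prod.snd (x₁_smul_glued _ _)
  change (RingC.ξ • y.1).1.1 + (p₂ ≫ h₂ ≫ p₁) (RingC.x₁ • y.1).2 + (p₁ ≫ h₁ ≫ p₂) 0 = p₁ y.1.2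
  rw [hξ, hw, map_zero, add_zero]
  exact ConcreteCategory.congr_hom (f := p₁ ≫ r.idem + p₁ ≫ h₁ ≫ p₂ ≫ h₂ ≫ p₁)
    (by rw [r.p₁_idem, sub_add_cancel]) y.1.2

lemma gluedTwo_actP₂ (y : RingC.groupThree r.Glued) :
    r.gluedTwo (RingC.actP₂ _ y) = p₂ (r.gluedThreeEquiv y) := by
  have hξ : (RingC.ξ • y.1).1.1 = (p₁ ≫ r.idem) y.1.2 :=
    congrArg (fun n : r.Glued => n.1.1) (ξ_smul_glued _ _)
  have hz : (RingC.x₂ • y.1).2 = h₂ (p₂ y.1.2) := congrArg Prod.snd (x₂_smul_glued _ _)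
  change (RingC.ξ • y.1).1.1 + (p₂ ≫ h₂ ≫ p₁) 0 + (p₁ ≫ h₁ ≫ p₂) (RingC.x₂ • y.1).2 = p₂ y.1.2
  rw [hξ, hz, map_zero, add_zero]
  refine ConcreteCategory.congr_hom (f := p₁ ≫ r.idem + p₂ ≫ h₂ ≫ p₁ ≫ h₁ ≫ p₂) ?_ y.1.2
  rw [← r.p₂_idem]
  simp only [idem, Preadditive.comp_sub, Category.comp_id, r.p₂h₁_assoc, sub_zero, sub_add_cancel]

end

lemma map {D D' : Type*} [Category* D] [Preadditive D] [Category* D'] [Preadditive D']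
    {A B : D} {h₁ h₂ : A ⟶ B} {p₁ p₂ : B ⟶ A} (r : AltRels h₁ h₂ p₁ p₂) (F : D ⥤ D')
    [F.Additive] : AltRels (F.map h₁) (F.map h₂) (F.map p₁) (F.map p₂) := by
  constructor
  all_goals
    simp only [← F.map_comp, ← F.map_zsmul, ← F.map_add, r.p₂h₁, r.p₁h₂, r.h₁p₁h₁, r.h₂p₂h₂,
      r.p₁h₁p₁, r.p₂h₂p₂, r.add_h, r.add_p, F.map_zero]

end AltRels

/-! ### The isomorphism between a module and that of its 𝐂-module -/

open RingC

section

variable (M : AltCat ⥤+ AddCommGrpCat.{u})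

lemma map_altRels : AltRels (M.obj.map AltCat.h₁) (M.obj.map AltCat.h₂) (M.obj.map AltCat.p₁)
    (M.obj.map AltCat.p₂) :=
  have : M.obj.Additive := M.property
  AltCat.altRels.map M.obj

/-- The components of the isomorphism between a module and that of its `𝐂`-module. -/
noncomputable def gluedObj : ∀ X, groupObj (map_altRels M).Glued X ⟶ M.obj.obj (AltCat.ob X)
  | .one => 0
  | .two => AddCommGrpCat.ofHom (map_altRels M).gluedTwo.toAddMonoidHom
  | .three => AddCommGrpCat.ofHom (map_altRels M).gluedThreeEquiv.toAddMonoidHom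

lemma isIso_gluedObj (X : CubicObj) : IsIso (gluedObj M X) := by
  have : M.obj.Additive := M.property
  cases X with
  | one =>
    have h : 𝟙 (M.obj.obj (AltCat.ob .one)) = 0 := by
      rw [← M.obj.map_id, AltCat.id_one, M.obj.map_zero]
    exact ⟨0, (Limits.comp_zero.trans (id_groupObj_one _).symm), Limits.comp_zero.trans h.symm⟩
  | two =>
    let E := (map_altRels M).gluedTwo
    exact ⟨AddCommGrpCat.ofHom E.symm.toAddMonoidHom,
      AddCommGrpCat.hom_ext (AddMonoidHom.ext E.symm_apply_apply),
      AddCommGrpCat.hom_ext (AddMonoidHom.ext E.apply_symm_apply)⟩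
  | three =>
    let E := (map_altRels M).gluedThreeEquiv
    exact ⟨AddCommGrpCat.ofHom E.symm.toAddMonoidHom,
      AddCommGrpCat.hom_ext (AddMonoidHom.ext E.symm_apply_apply),
      AddCommGrpCat.hom_ext (AddMonoidHom.ext E.apply_symm_apply)⟩

/-- The map to a module from that of its `𝐂`-module. -/
noncomputable def gluedNatTrans : (toAltModule (map_altRels M).Glued).obj ⟶ M.obj :=
  have : M.obj.Additive := M.property
  AltCat.natTrans (F := (toAltModule (map_altRels M).Glued).obj) (G := M.obj) (gluedObj M)
    (by
      rw [toAltModule_map_h₁]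
      exact AddCommGrpCat.hom_ext (AddMonoidHom.ext (map_altRels M).gluedThreeEquiv_actH₁))
    (by
      rw [toAltModule_map_h₂]
      exact AddCommGrpCat.hom_ext (AddMonoidHom.ext (map_altRels M).gluedThreeEquiv_actH₂))
    (by
      rw [toAltModule_map_p₁]
      exact AddCommGrpCat.hom_ext (AddMonoidHom.ext (map_altRels M).gluedTwo_actP₁))
    (by
      rw [toAltModule_map_p₂]
      exact AddCommGrpCat.hom_ext (AddMonoidHom.ext (map_altRels M).gluedTwo_actP₂))

/-- Every module is isomorphic to that of its `𝐂`-module. -/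
noncomputable def gluedIso : toAltModule (map_altRels M).Glued ≅ M :=
  have (X : AltCat) : IsIso ((gluedNatTrans M).app X) := isIso_gluedObj M X.as.as
  have : IsIso (gluedNatTrans M) := NatIso.isIso_of_isIso_app _
  ObjectProperty.isoMk _ (asIso (gluedNatTrans M))

end

instance : altModule.{u}.EssSurj where
  mem_essImage M := ⟨ModuleCat.of RingC (map_altRels M).Glued, ⟨gluedIso M⟩⟩

instance : altModule.{u}.IsEquivalence where

theorem altModule_equivalence :
    ∃ E : (AltCat ⥤+ AddCommGrpCat.{u}) ≌ ModuleCat.{u} RingC, E.functor.Additive :=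
  have : altModule.{u}.asEquivalence.functor.Additive := inferInstanceAs altModule.{u}.Additive
  ⟨altModule.asEquivalence.symm, altModule.asEquivalence.inverse_additive⟩

theorem mainTheorem9 :
    (∃ (E : WeaklyAlternativeCubic.{u} ≌ (AltCat ⥤+ AddCommGrpCat.{u}))
        (α : ∀ X : CubicObj,
          E.functor ⋙ AdditiveFunctor.forget AltCat (AddCommGrpCat.{u}) ⋙
              (evaluation AltCat (AddCommGrpCat.{u})).obj (AltCat.ob X) ≅
            ObjectProperty.ι (fun F : Fab ⥤ AddCommGrpCat.{u} => IsWeaklyAlternativeCubic F) ⋙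
              crossEffectFunctor (fun _ : Fin X.deg => Fab.Z)),
        E.functor.Additive ∧
        ∀ (F : WeaklyAlternativeCubic.{u}) (X Y : CubicObj) (g : X ⟶ Y),
          (E.functor.obj F).obj.map (AltCat.gen g) ≫ (α Y).hom.app F =
            (α X).hom.app F ≫ (crossGen F.obj g :)) ∧
    (∃ E : (AltCat ⥤+ AddCommGrpCat.{u}) ≌ ModuleCat.{u} RingC, E.functor.Additive) :=
  ⟨weaklyAlternativeCubic_equivalence, altModule_equivalence⟩
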